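/- **Setting.** Let $F=\frac1M\sum_{m=1}^M F_m$ on $\mathbb R^n$ ($M\ge 1$ clients, client $1$ is the coordinator), where every $F_m$ is differentiable with $L$-Lipschitz gradient, $L>0$. Client $m$ can draw samples $\xi\sim P_m$ and compute a stochastic gradient $g_m(x;\xi)$ with $\mathbb E\,g_m(x;\xi)=\nabla F_m(x)$ and $\mathbb E\|g_m(x;\xi)-\nabla F_m(x)\|^2\le\sigma^2$; all samples are independent. Put $F^*=\inf F$. **Catalyst.** Start with $y^0=y^1=x^0$. For $s=1,\dots,S$, let $x^s$ be an approximate minimizer of $F^s(x)=F(x)+L\|x-y^s\|^2$ with $\mathbb E[F^s(x^s)-\min F^s]\le\epsilon^s$, and put $y^{s+1}=x^s+\beta_s(x^s-x^{s-1})$. In the strongly convex and convex cases $\alpha_s\in(0,1)$ solves $\alpha_s^2=(1-\alpha_s)\alpha_{s-1}^2+q\alpha_s$ and $\beta_s=\frac{\alpha_{s-1}(1-\alpha_{s-1})}{\alpha_{s-1}^2+\alpha_s}$, with $q=\frac{\mu}{\mu+2L}$, $\alpha_0=\sqrt q$ in the strongly convex case and $q=0$, $\alpha_0=1$ in the convex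 case; in the nonconvex case $\beta_s=0$. **GA-MSGD as subproblem solver.** The $s$-th subproblem has the local functions $F_m+L\|\cdot-y^s\|^2$, with stochastic gradients $g^s_m(x;\xi)=g_m(x;\xi)+2L(x-y^s)$, and these are $\nu$-strongly convex with $\nu=\mu+2L$, $2L$, $L$ in the strongly convex, convex, nonconvex case. With parameters $T,K$ and step sizes $\tau_1^k,\tau_2^k,\tau_3>0$ (which may differ from one $s$ to another), start all clients at $x_s^0=x^{s-1}+c\,(y^s-y^{s-1})$, where $c=\frac{2L}{2L+\mu}$, $1$, $0$ respectively, and at $\lambda_m^0=-\frac1M g_m^s(x_s^0;\xi)+\frac{\nu}{2M}x_s^0$. For $t=0,\dots,T$: for $k=0,\dots,K-1$ every client draws a fresh sample and $$x_m^{t,k+1}=x_m^{t,k}-\tau_1^k\Big[\tfrac1M g^s_m(x_m^{t,k};\xi_m)-\tfrac{\nu}{2M}x_m^{t,k}+\lambda_m^t\Big]\quad(m\ge2),$$ $$x_1^{t,k+1}=x_1^{t,k}-\tau_2^k\Big[\tfrac1M g^s_1(x_1^{t,k};\xi_1)+\tfrac{\nu(M-1)}{2M}x_1^{t,k}-\sum_{m\ge2}\lambda_m^t\Big];$$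 then $x_m^{t+1,0}=x_m^{t,K}$ for all $m$ and $\lambda_m^{t+1}=\lambda_m^t+\tau_3(x_m^{t+1,0}-x_1^{t+1,0})$ for $m\ge2$. The output is $x^s=\frac1M\sum_m x_m^{T,K}$. Such a call costs $T+2$ communication rounds and $(T+1)K+1$ samples per client; the communication complexity is the total number of rounds, the sample complexity the total number of samples per client, over all $S$ calls. **Claim.** In each of the following cases, $S\ge 1$ and the parameters of all calls can be chosen, depending only on the given numbers ($M,L,\sigma,\epsilon$ and $\mu,\Delta,D,\gamma$ where they occur), so that for every problem as above (any dimension, local functions, distributions, stochastic gradients and initial point $x^0$ satisfying the stated conditions) the criterion $\mathbb E[F^s(x^s)-\min F^s]\le\epsilon^s$ holds for all $1\le s\le S$, the stated accuracy is reached, and the stated cost bounds hold. Here $C$ and $p$ are universal constants (depending on $\gamma$ only, in the convex case). * **Strongly convex.** Let $0<\mu\le L$, $\kappa=L/\mu$, every $F_m$ be $\mu$-strongly convex, $F(x^0)-F^*\le\Delta$ and $0<\epsilon\le\Delta$. With $\epsilon^s=\frac29(1-0.9\sqrt q)^s\Delta$ one gets $\mathbb E F(x^S)-F^*\le\epsilon$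 with at most $C\sqrt\kappa\,\Lambda^p$ communication rounds and $C\big(\sqrt\kappa+\frac{\sqrt\kappa\,\sigma^2}{\mu\epsilon}\big)\Lambda^p$ samples, where $\Lambda=\log\!\big(e+\kappa+\frac\Delta\epsilon+\frac{M\sigma^2}{\mu\epsilon}\big)$; that is, $\widetilde O(\sqrt\kappa)$ and $\widetilde O(\sqrt\kappa+\sqrt\kappa\sigma^2/(\mu\epsilon))$. * **Convex.** Let $\gamma\in(0,1]$, every $F_m$ be convex, $F$ have a minimizer $x^*$ with $\|x^0-x^*\|\le D$, $F(x^0)-F^*\le\Delta$ and $0<\epsilon\le\Delta$; put $R=LD^2+\Delta$. With $\epsilon^s=\frac{2\Delta}{9(s+1)^{4+\gamma}}$ one gets $\mathbb E F(x^S)-F^*\le\epsilon$ with at most $C\sqrt{R/\epsilon}\,\Lambda^p$ communication rounds and $C\Big(\sqrt{R/\epsilon}+\frac{\sigma^2}{L\Delta}\big(\frac R\epsilon\big)^{2.5+\gamma/2}\Big)\Lambda^p$ samples, where $\Lambda=\log\!\big(e+\frac R\epsilon+\frac{M\sigma^2}{L\epsilon}\big)$; that is, for fixed $L,D,\Delta,\gamma$,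 $\widetilde O(\epsilon^{-1/2})$ and $\widetilde O(\epsilon^{-1/2}+\sigma^2\epsilon^{-2.5-\gamma/2})$. * **Nonconvex.** Let $F$ be bounded below, $F(x^0)-F^*\le\Delta$ and $0<\epsilon^2\le L\Delta$. With $\epsilon^s=\Delta/S$ one gets $\frac1S\sum_{s=1}^S\mathbb E\|\nabla F(x^s)\|^2\le\epsilon^2$ (that is, $\mathbb E\|\nabla F(x)\|^2\le\epsilon^2$ for $x$ uniform on $\{x^1,\dots,x^S\}$) with at most $C\,\frac{L\Delta}{\epsilon^2}\Lambda^p$ communication rounds and $C\big(\frac{L\Delta}{\epsilon^2}+\frac{L\Delta\sigma^2}{\epsilon^4}\big)\Lambda^p$ samples, where $\Lambda=\log\!\big(e+\frac{L\Delta}{\epsilon^2}+\frac{M\sigma^2}{\epsilon^2}\big)$; that is, for fixed $L,\Delta$, $\widetilde O(\epsilon^{-2})$ and $\widetilde O(\epsilon^{-2}+\sigma^2\epsilon^{-4})$. -/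

import Mathlib

open MeasureTheory ProbabilityTheory

noncomputable section

namespace LocalCatalyst

/-- The decision space `ℝⁿ` with the Euclidean norm. -/
abbrev Vec (n : ℕ) := EuclideanSpace ℝ (Fin n)

/-- The objective `F = (1/M) ∑ₘ Fₘ`. -/
def globalObj {M n : ℕ} (F : Fin M → Vec n → ℝ) (x : Vec n) : ℝ :=
  (1 / (M : ℝ)) * ∑ m, F m x

/-- A distributed stochastic optimization problem with `M` clients: the local functions are
differentiable with `L`-Lipschitz gradients, client `m` can query an unbiased stochastic gradient
`g m x z`, `z ∼ P m`, of variance at most `σ²`, and `ξ (s, j, m)` is the `j`-th sample that client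
`m` draws while the `s`-th subproblem is being solved; all samples are independent. -/
structure StochasticProblem.{u, v} (M : ℕ) (L σ : ℝ) where
  /-- the dimension -/
  n : ℕ
  /-- the local functions -/
  F : Fin M → Vec n → ℝ
  /-- the space of data points of each client -/
  Ξ : Fin M → Type u
  [measΞ : ∀ m, MeasurableSpace (Ξ m)]
  /-- the data distribution of each client -/
  P : (m : Fin M) → Measure (Ξ m)
  [probP : ∀ m, IsProbabilityMeasure (P m)]
  /-- the stochastic gradients -/
  g : (m : Fin M) → Vec n → Ξ m → Vec n
  /-- the underlying probability space -/
  Ω : Type v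
  [measΩ : MeasurableSpace Ω]
  /-- the underlying probability measure -/
  Pr : Measure Ω
  [probΩ : IsProbabilityMeasure Pr]
  /-- the samples -/
  ξ : (i : ℕ × ℕ × Fin M) → Ω → Ξ i.2.2
  differentiable : ∀ m, Differentiable ℝ (F m)
  smooth : ∀ m x y, ‖gradient (F m) x - gradient (F m) y‖ ≤ L * ‖x - y‖
  measurable_g : ∀ m, Measurable (Function.uncurry (g m))
  integrable_g : ∀ m x, Integrable (g m x) (P m)
  unbiased : ∀ m x, ∫ z, g m x z ∂(P m) = gradient (F m) x
  integrable_sq : ∀ m x, Integrable (fun z => ‖g m x z - gradient (F m) x‖ ^ 2) (P m)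
  variance_le : ∀ m x, ∫ z, ‖g m x z - gradient (F m) x‖ ^ 2 ∂(P m) ≤ σ ^ 2
  measurable_ξ : ∀ i, Measurable (ξ i)
  law_ξ : ∀ i, Measure.map (ξ i) Pr = P i.2.2
  indep_ξ : iIndepFun ξ Pr

attribute [instance] StochasticProblem.measΞ StochasticProblem.probP StochasticProblem.measΩ
  StochasticProblem.probΩ

/-! ### GA-MSGD -/

/-- The parameters of one call of GA-MSGD: the outer loop runs over `t = 0, …, T`, the inner loop
over `k = 0, …, K - 1`; `τ₁ k` and `τ₂ k` are the primal step sizes of the workers and of the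
coordinator, `τ₃` is the dual step size. -/
structure GAParams where
  T : ℕ
  K : ℕ
  τ₁ : ℕ → ℝ
  τ₂ : ℕ → ℝ
  τ₃ : ℝ
  τ₁_pos : ∀ k, 0 < τ₁ k
  τ₂_pos : ∀ k, 0 < τ₂ k
  τ₃_pos : 0 < τ₃

section GAMSGD

variable {M n : ℕ} [NeZero M]

/-- One local stochastic gradient step (number `k` of the inner loop) on the primal variables of
all clients, for a `ν`-strongly convex problem. Client `0` is the coordinator; the dual variables
are `lam m`, `m ≠ 0`. Here `G m x` is the stochastic gradient of client `m` at `x`. -/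
def innerStep (ν : ℝ) (θ : GAParams) (G : Fin M → Vec n → Vec n) (lam : Fin M → Vec n) (k : ℕ)
    (x : Fin M → Vec n) : Fin M → Vec n := fun m =>
  if m = 0 then
    x 0 - θ.τ₂ k • ((1 / (M : ℝ)) • G 0 (x 0) + (ν * ((M : ℝ) - 1) / (2 * M)) • x 0
      - ∑ i ∈ Finset.univ.erase (0 : Fin M), lam i)
  else
    x m - θ.τ₁ k • ((1 / (M : ℝ)) • G m (x m) - (ν / (2 * (M : ℝ))) • x m + lam m)

/-- `k` inner steps of round `t`. `G j m x` is the stochastic gradient of client `m` at `x` that is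
computed from its `j`-th sample; sample `0` is reserved for the initialization of the dual
variables, and inner step `k` of round `t` uses sample `t * K + k + 1`. -/
def innerLoop (ν : ℝ) (θ : GAParams) (G : ℕ → Fin M → Vec n → Vec n) (lam : Fin M → Vec n) (t : ℕ)
    (x : Fin M → Vec n) : ℕ → (Fin M → Vec n)
  | 0 => x
  | k + 1 => innerStep ν θ (G (t * θ.K + k + 1)) lam k (innerLoop ν θ G lam t x k)

/-- The dual initialization `λₘ⁰ = -(1/M) gₘ(x⁰; ξ) + (ν/(2M)) x⁰`. -/
def initialDual (ν : ℝ) (G : ℕ → Fin M → Vec n → Vec n) (x0 : Vec n) : Fin M → Vec n := fun m =>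
  -((1 / (M : ℝ)) • G 0 m x0) + (ν / (2 * (M : ℝ))) • x0

/-- The pair `((x₁^{t,0}, …, x_M^{t,0}), λᵗ)` at the start of round `t`. The component `lam 0`
of the dual variable is never used. -/
def outerLoop (ν : ℝ) (θ : GAParams) (G : ℕ → Fin M → Vec n → Vec n) (x0 : Vec n) :
    ℕ → (Fin M → Vec n) × (Fin M → Vec n)
  | 0 => (fun _ => x0, initialDual ν G x0)
  | t + 1 =>
    let st := outerLoop ν θ G x0 t
    let X := innerLoop ν θ G st.2 t st.1 θ.K
    (X, fun m => st.2 m + θ.τ₃ • (X m - X 0))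

/-- The output `(1/M) ∑ₘ xₘ^{T,K}` of GA-MSGD (note `xₘ^{T,K} = xₘ^{T+1,0}`). -/
def gaMSGD (ν : ℝ) (θ : GAParams) (G : ℕ → Fin M → Vec n → Vec n) (x0 : Vec n) : Vec n :=
  (1 / (M : ℝ)) • ∑ m, (outerLoop ν θ G x0 (θ.T + 1)).1 m

end GAMSGD

/-- Communication rounds of one call of GA-MSGD: one for each of the `T + 1` outer iterations and
one for the initialization (broadcast of the proximal center, collection of the dual variables). -/
def GAParams.rounds (θ : GAParams) : ℕ := θ.T + 2

/-- Samples drawn by each client in one call of GA-MSGD: `K` in each of the `T + 1` outer iterations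
and one for the initialization of the dual variables. -/
def GAParams.samples (θ : GAParams) : ℕ := (θ.T + 1) * θ.K + 1

/-! ### Catalyst -/

/-- The positive root `α` of `α² = (1 - α) a² + q α`. -/
def nextAlpha (q a : ℝ) : ℝ := ((q - a ^ 2) + √((q - a ^ 2) ^ 2 + 4 * a ^ 2)) / 2

theorem nextAlpha_sq (q a : ℝ) :
    nextAlpha q a ^ 2 = (1 - nextAlpha q a) * a ^ 2 + q * nextAlpha q a := by
  have h := Real.sq_sqrt (show 0 ≤ (q - a ^ 2) ^ 2 + 4 * a ^ 2 by positivity)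
  unfold nextAlpha
  linear_combination h / 4

theorem nextAlpha_mem {q a : ℝ} (hq : q < 1) (ha : 0 < a) : nextAlpha q a ∈ Set.Ioo (0 : ℝ) 1 := by
  have h0 : 0 ≤ (q - a ^ 2) ^ 2 + 4 * a ^ 2 := by positivity
  have ha2 : 0 < a ^ 2 := by positivity
  have h1 : |q - a ^ 2| < √((q - a ^ 2) ^ 2 + 4 * a ^ 2) := by
    rw [← Real.sqrt_sq_eq_abs]
    exact Real.sqrt_lt_sqrt (by positivity) (by linarith)
  have h2 : √((q - a ^ 2) ^ 2 + 4 * a ^ 2) < 2 - (q - a ^ 2) := by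
    rw [Real.sqrt_lt' (by linarith)]
    nlinarith
  have h3 := neg_abs_le (q - a ^ 2)
  constructor <;> unfold nextAlpha <;> linarith

/-- The sequence `α₀, α₁, α₂, …` with `α_s² = (1 - α_s) α_{s-1}² + q α_s`. -/
def alphaSeq (q α₀ : ℝ) : ℕ → ℝ
  | 0 => α₀
  | s + 1 => nextAlpha q (alphaSeq q α₀ s)

/-- `β_s = α_{s-1} (1 - α_{s-1}) / (α_{s-1}² + α_s)`, for `s ≥ 1`. -/
def momentum (q α₀ : ℝ) (s : ℕ) : ℝ :=
  alphaSeq q α₀ (s - 1) * (1 - alphaSeq q α₀ (s - 1))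
    / (alphaSeq q α₀ (s - 1) ^ 2 + alphaSeq q α₀ s)

/-- What differs between the three versions of Catalyst with GA-MSGD: the momentum `β_s`, the
coefficient `c` in the initial point `x^{s-1} + c (y^s - y^{s-1})` of the `s`-th call of GA-MSGD,
and the strong convexity modulus `ν` of the local functions of the subproblems. -/
structure Scheme where
  β : ℕ → ℝ
  c : ℝ
  ν : ℝ

/-- Strongly convex local functions. -/
def scScheme (L μ : ℝ) : Scheme where
  β := momentum (μ / (μ + 2 * L)) (√(μ / (μ + 2 * L)))
  c := 2 * L / (2 * L + μ)
  ν := μ + 2 * L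

/-- Convex local functions. -/
def convexScheme (L : ℝ) : Scheme where
  β := momentum 0 1
  c := 1
  ν := 2 * L

/-- Nonconvex local functions: no momentum, and GA-MSGD starts at the last iterate. -/
def nonconvexScheme (L : ℝ) : Scheme where
  β := fun _ => 0
  c := 0
  ν := L

namespace StochasticProblem

variable {M : ℕ} {L σ : ℝ} (Q : StochasticProblem M L σ)

/-- The objective `F`. -/
def obj : Vec Q.n → ℝ := globalObj Q.F

/-- The optimal value `F* = inf F`. -/
def optVal : ℝ := ⨅ x, Q.obj x

/-- The objective `F(x) + L ‖x - y‖²` of the subproblem with proximal center `y`. -/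
def subObj (y x : Vec Q.n) : ℝ := Q.obj x + L * ‖x - y‖ ^ 2

/-- Stochastic gradients `gₘ(x; ξ) + 2 L (x - y)` of the local functions `Fₘ(x) + L ‖x - y‖²` of the
`s`-th subproblem, for the `j`-th sample of client `m`. -/
def subGrad (s : ℕ) (y : Vec Q.n) (ω : Q.Ω) (j : ℕ) (m : Fin M) (x : Vec Q.n) : Vec Q.n :=
  Q.g m x (Q.ξ (s, j, m) ω) + (2 * L) • (x - y)

variable [NeZero M]

/-- The triple `(x^s, y^{s+1}, y^s)` of Catalyst with GA-MSGD as the subproblem solver, where `θ s`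
are the parameters of the `s`-th call of GA-MSGD and `y⁰ = y¹ = x⁰`. -/
def catalystState (sch : Scheme) (θ : ℕ → GAParams) (x0 : Vec Q.n) (ω : Q.Ω) :
    ℕ → Vec Q.n × Vec Q.n × Vec Q.n
  | 0 => (x0, x0, x0)
  | s + 1 =>
    let x := (catalystState sch θ x0 ω s).1
    let y := (catalystState sch θ x0 ω s).2.1
    let y' := (catalystState sch θ x0 ω s).2.2
    let xnew := gaMSGD sch.ν (θ (s + 1)) (Q.subGrad (s + 1) y ω) (x + sch.c • (y - y'))
    (xnew, xnew + sch.β (s + 1) • (xnew - x), y)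

/-- The iterate `x^s` of Catalyst. -/
def catX (sch : Scheme) (θ : ℕ → GAParams) (x0 : Vec Q.n) (s : ℕ) (ω : Q.Ω) : Vec Q.n :=
  (Q.catalystState sch θ x0 ω s).1

/-- The proximal center `y^s` of the `s`-th subproblem. -/
def catY (sch : Scheme) (θ : ℕ → GAParams) (x0 : Vec Q.n) (s : ℕ) (ω : Q.Ω) : Vec Q.n :=
  (Q.catalystState sch θ x0 ω s).2.2

/-- The suboptimality `F^s(x^s) - min F^s` of the solution of the `s`-th subproblem. -/
def subGap (sch : Scheme) (θ : ℕ → GAParams) (x0 : Vec Q.n) (s : ℕ) (ω : Q.Ω) : ℝ :=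
  Q.subObj (Q.catY sch θ x0 s ω) (Q.catX sch θ x0 s ω)
    - ⨅ z, Q.subObj (Q.catY sch θ x0 s ω) z

/-- The stopping criterion of Catalyst: for `s = 1, …, S`, the `s`-th subproblem is solved up to
the error `acc s` in expectation. -/
def MeetsCriterion (sch : Scheme) (S : ℕ) (θ : ℕ → GAParams) (x0 : Vec Q.n) (acc : ℕ → ℝ) : Prop :=
  ∀ s ∈ Finset.Icc 1 S, Integrable (Q.subGap sch θ x0 s) Q.Pr ∧
    ∫ ω, Q.subGap sch θ x0 s ω ∂Q.Pr ≤ acc s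

end StochasticProblem

/-- Total number of communication rounds of `S` iterations of Catalyst. -/
def commRounds (S : ℕ) (θ : ℕ → GAParams) : ℕ := ∑ s ∈ Finset.Icc 1 S, (θ s).rounds

/-- Total number of samples drawn by each client in `S` iterations of Catalyst. -/
def sampleCount (S : ℕ) (θ : ℕ → GAParams) : ℕ := ∑ s ∈ Finset.Icc 1 S, (θ s).samples

/-- The logarithm `log (e + r)`, whose powers are the factors hidden in `Õ`. -/
def logFactor (r : ℝ) : ℝ := Real.log (Real.exp 1 + r)

end LocalCatalyst

end

universe u v

open LocalCatalyst

noncomputable section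

namespace LocalCatalyst

open scoped RealInnerProductSpace

/-! ### Differentiable functions and their gradients -/

section Gradient

variable {E : Type*} [NormedAddCommGroup E] [InnerProductSpace ℝ E] [CompleteSpace E]

/-! Catalyst replaces the minimization of F by proximal subproblems F + L‖· - y‖². Their local
functions have strong convexity modulus ν between L and 3L and 3L-Lipschitz gradients, so every
subproblem is well conditioned. It therefore suffices that GA-MSGD reaches accuracy `a` in
logarithmically many rounds with O(1 + σ²/(La)) samples per client and round (`gaMSGD_solves`). The
total costs are the number S of proximal steps times the cost for the smallest accuracy in use.

Inner solver. The shifts by ν/(2M) move half of each worker's curvature to the coordinator. For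
frozen dual variables every client then solves its own equation for an operator with monotonicity
constant L/2 and Lipschitz constant 3L, whatever M is. Local SGD contracts towards the solution with
factor 1 - ηL/2, down to a noise level proportional to η (`innerLoop_bound`). The dual update is an
inexact gradient step that contracts the dual error by a universal factor (`dual_ascent_step`). A
weighted sum of dual and primal errors thus contracts by 287/288 per round, up to noise
(`outerLoop_bound`). Then η is fixed by the noise, K by the required inner contraction, and T by the
logarithm of the initial error.

Outer loop. `inexact_prox_le` compares an inexact proximal point with any z, and a Young parameter θ
trades contraction against the cost 1 + 1/θ of the subproblem error. In the strongly convex case the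
Lyapunov function is F(x) - F* + (μ/2)‖v - x*‖², and θ proportional to √q preserves the rate 1 -
0.9√q. In the convex case the function is F(x) - F* divided by α², plus L‖v - x*‖², and a summable
sequence of θ's costs only a bounded factor; the accuracies (s+1)^{-(4+γ)} are just small enough for
this. In the nonconvex case the descent inequality telescopes, and the gradient is controlled by the
step length and the subproblem gap.

Coupling. Each call needs a bound on its expected initial error. This bound enters T only through a
logarithm, so a crude uniform bound on the second moments of the iterates suffices; it is propagated
together with the Lyapunov estimate (`accelerated_run`). Noise is always handled by integrating out
one fresh sample, independent of the sigma-algebra `past` that contains the current iterate. The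
clients are treated one at a time, so no averaging of noise over clients is used. -/

theorem hasDerivAt_comp_line {f : E → ℝ} (hf : Differentiable ℝ f) (x d : E) (t : ℝ) :
    HasDerivAt (fun t : ℝ => f (x + t • d)) ⟪gradient f (x + t • d), d⟫ t := by
  have h1 : HasDerivAt (fun t : ℝ => x + t • d) d t := by
    simpa using ((hasDerivAt_id t).smul_const d).const_add x
  have h2 := (hf (x + t • d)).hasGradientAt.hasFDerivAt
  have h3 := h2.comp_hasDerivAt t h1
  rw [InnerProductSpace.toDual_apply_apply] at h3
  exact h3

/-- A strongly monotone gradient gives a quadratic lower bound (`m` may be negative). -/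
theorem quadratic_lower_bound {f : E → ℝ} (hf : Differentiable ℝ f) {m : ℝ}
    (hm : ∀ x y, m * ‖x - y‖ ^ 2 ≤ ⟪gradient f x - gradient f y, x - y⟫) (x y : E) :
    f y + ⟪gradient f y, x - y⟫ + m / 2 * ‖x - y‖ ^ 2 ≤ f x := by
  set d := x - y with hd
  -- The claim is ψ 0 ≤ ψ 1. The monotonicity hypothesis on the segment, divided by t, says that the
  -- derivative of ψ is nonnegative.
  let ψ : ℝ → ℝ := fun t => f (y + t • d) - t * ⟪gradient f y, d⟫ - m / 2 * t ^ 2 * ‖d‖ ^ 2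
  have hψ : ∀ t, HasDerivAt ψ
      (⟪gradient f (y + t • d), d⟫ - ⟪gradient f y, d⟫ - m * t * ‖d‖ ^ 2) t := by
    intro t
    have h1 := hasDerivAt_comp_line hf y d t
    have h2 := (hasDerivAt_id t).mul_const ⟪gradient f y, d⟫
    have h3 := (((hasDerivAt_id t).pow 2).const_mul (m / 2)).mul_const (‖d‖ ^ 2)
    refine ((h1.sub h2).sub h3).congr_deriv ?_
    simp only [id, one_mul, mul_one]
    push_cast
    ring
  have hmono : MonotoneOn ψ (Set.Icc 0 1) := by
    refine monotoneOn_of_deriv_nonneg (convex_Icc 0 1)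
      (fun t _ => (hψ t).continuousAt.continuousWithinAt)
      (fun t _ => (hψ t).differentiableAt.differentiableWithinAt) ?_
    intro t ht
    rw [interior_Icc] at ht
    rw [(hψ t).deriv]
    have h1 := hm (y + t • d) y
    rw [add_sub_cancel_left, norm_smul, inner_smul_right, inner_sub_left, mul_pow,
      Real.norm_eq_abs, sq_abs] at h1
    have h2 : t * (m * t * ‖d‖ ^ 2) ≤ t * (⟪gradient f (y + t • d), d⟫ - ⟪gradient f y, d⟫) := by
      linarith
    have := le_of_mul_le_mul_left h2 ht.1
    linarith
  have h := hmono (Set.left_mem_Icc.2 zero_le_one) (Set.right_mem_Icc.2 zero_le_one) zero_le_one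
  have hx : y + d = x := by simp [hd]
  simp only [ψ, zero_smul, add_zero, one_smul, hx] at h
  linarith

theorem gradient_neg' (f : E → ℝ) (x : E) : gradient (fun x => -f x) x = -gradient f x := by
  simp [gradient, fderiv_fun_neg]

/-- By Cauchy–Schwarz the gradient of -f is monotone with modulus -L, so this is the lower bound for
-f. -/
theorem quadratic_upper_bound {f : E → ℝ} (hf : Differentiable ℝ f) {L : ℝ}
    (hL : ∀ x y, ‖gradient f x - gradient f y‖ ≤ L * ‖x - y‖) (x y : E) :
    f x ≤ f y + ⟪gradient f y, x - y⟫ + L / 2 * ‖x - y‖ ^ 2 := by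
  have h := quadratic_lower_bound (f := fun x => -f x) (m := -L) hf.neg (fun x y => by
    rw [gradient_neg', gradient_neg', neg_sub_neg, ← neg_sub (gradient f x), inner_neg_left, neg_mul,
      neg_le_neg_iff]
    refine (real_inner_le_norm _ _).trans ?_
    rw [pow_two, ← mul_assoc]
    gcongr
    exact hL x y) x y
  rw [gradient_neg', inner_neg_left] at h
  linarith

-- This supplies the modulus -L of the nonconvex case; the proximal term 2L lifts it to ν = L.
omit [CompleteSpace E] in
theorem monotone_of_lipschitz {g : E → E} {L : ℝ} (hL : ∀ x y, ‖g x - g y‖ ≤ L * ‖x - y‖)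
    (x y : E) : -L * ‖x - y‖ ^ 2 ≤ ⟪g x - g y, x - y⟫ := by
  have h1 := (abs_le.1 (abs_real_inner_le_norm (g x - g y) (x - y))).1
  have h2 := mul_le_mul_of_nonneg_right (hL x y) (norm_nonneg (x - y))
  nlinarith

theorem StrongConvexOn.gradient_inequality {f : E → ℝ} (hf : Differentiable ℝ f) {m : ℝ}
    (hm : StrongConvexOn Set.univ m f) (x y : E) :
    f x + ⟪gradient f x, y - x⟫ + m / 2 * ‖y - x‖ ^ 2 ≤ f y := by
  set d := y - x with hd
  -- ψ is the slack of the strong convexity inequality on the segment. It vanishes at 0 and is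
  -- nonnegative on (0, 1), so its derivative at 0 is nonnegative, which is the claim.
  let ψ : ℝ → ℝ := fun t => f x + t * (f y - f x) - t * (1 - t) * (m / 2 * ‖d‖ ^ 2) - f (x + t • d)
  have h0 : ψ 0 = 0 := by simp [ψ]
  have hnn : ∀ t ∈ Set.Ioo (0 : ℝ) 1, 0 ≤ ψ t := by
    intro t ht
    have h := hm.2 (Set.mem_univ x) (Set.mem_univ y) (sub_nonneg.2 ht.2.le) ht.1.le (by ring)
    have he : (1 - t) • x + t • y = x + t • d := by rw [hd]; module
    rw [he, norm_sub_rev] at h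
    simp only [smul_eq_mul] at h
    simp only [ψ]
    linarith
  have hψ : HasDerivAt ψ (f y - f x - m / 2 * ‖d‖ ^ 2 - ⟪gradient f x, d⟫) 0 := by
    have h1 := hasDerivAt_comp_line hf x d 0
    have h2 := ((hasDerivAt_id (0 : ℝ)).mul_const (f y - f x)).const_add (f x)
    have h3 := ((hasDerivAt_id (0 : ℝ)).mul ((hasDerivAt_id (0 : ℝ)).const_sub 1)).mul_const
      (m / 2 * ‖d‖ ^ 2)
    refine ((h2.sub h3).sub h1).congr_deriv ?_
    simp
  have hlim := hψ.tendsto_slope_zero_right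
  have hge : 0 ≤ f y - f x - m / 2 * ‖d‖ ^ 2 - ⟪gradient f x, d⟫ := by
    refine ge_of_tendsto hlim ?_
    filter_upwards [Ioo_mem_nhdsGT (zero_lt_one' ℝ)] with t ht
    rw [zero_add, h0, sub_zero, smul_eq_mul]
    exact mul_nonneg (inv_nonneg.2 ht.1.le) (hnn t ht)
  linarith

theorem StrongConvexOn.gradient_monotone {f : E → ℝ} (hf : Differentiable ℝ f) {m : ℝ}
    (hm : StrongConvexOn Set.univ m f) (x y : E) :
    m * ‖x - y‖ ^ 2 ≤ ⟪gradient f x - gradient f y, x - y⟫ := by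
  have h1 := StrongConvexOn.gradient_inequality hf hm x y
  have h2 := StrongConvexOn.gradient_inequality hf hm y x
  rw [← neg_sub x y, inner_neg_right, norm_neg] at h1
  rw [inner_sub_left]
  linarith

end Gradient

/-! ### Strongly monotone Lipschitz operators -/

section Monotone

variable {E : Type*} [NormedAddCommGroup E] [InnerProductSpace ℝ E]

theorem forward_step_norm_sq_le {a ℓ η : ℝ} (hη : 0 ≤ η) {d e : E}
    (hmono : a * ‖d‖ ^ 2 ≤ ⟪e, d⟫) (hlip : ‖e‖ ≤ ℓ * ‖d‖) :
    ‖d - η • e‖ ^ 2 ≤ (1 - 2 * η * a + η ^ 2 * ℓ ^ 2) * ‖d‖ ^ 2 := by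
  rw [norm_sub_sq_real, inner_smul_right, norm_smul, Real.norm_eq_abs, mul_pow, sq_abs,
    real_inner_comm]
  have h1 : ‖e‖ ^ 2 ≤ (ℓ * ‖d‖) ^ 2 := pow_le_pow_left₀ (norm_nonneg _) hlip 2
  nlinarith [mul_le_mul_of_nonneg_left hmono hη, mul_le_mul_of_nonneg_left h1 (sq_nonneg η)]

theorem norm_sub_le_of_strongly_monotone {H : E → E} {a : ℝ}
    (hmono : ∀ x y, a * ‖x - y‖ ^ 2 ≤ ⟪H x - H y, x - y⟫) (x y : E) :
    a * ‖x - y‖ ≤ ‖H x - H y‖ := by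
  rcases (norm_nonneg (x - y)).eq_or_lt with h | h
  · rw [← h, mul_zero]; exact norm_nonneg _
  · refine le_of_mul_le_mul_right ?_ h
    calc a * ‖x - y‖ * ‖x - y‖ = a * ‖x - y‖ ^ 2 := by ring
      _ ≤ _ := hmono x y
      _ ≤ _ := real_inner_le_norm _ _

/-- For small r > 0 the forward step x ↦ x - r (H x - b) is a contraction, and its fixed point
solves H x = b. This is what makes the inverse functions in `prox` and `clientTarget` genuine
solutions. -/
theorem surjective_of_strongly_monotone [CompleteSpace E] {H : E → E} {a ℓ : ℝ} (ha : 0 < a)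
    (hmono : ∀ x y, a * ‖x - y‖ ^ 2 ≤ ⟪H x - H y, x - y⟫)
    (hlip : ∀ x y, ‖H x - H y‖ ≤ ℓ * ‖x - y‖) : Function.Surjective H := by
  intro b
  -- This r turns the factor 1 - 2ra + r²ℓ² into 1 - ra - r²a².
  obtain ⟨r, hr0, hr⟩ : ∃ r : ℝ, 0 < r ∧ r * (ℓ ^ 2 + a ^ 2) = a :=
    ⟨a / (ℓ ^ 2 + a ^ 2), by positivity, by field_simp⟩
  have hc : 1 - 2 * r * a + r ^ 2 * ℓ ^ 2 ≤ 1 - r * a := by nlinarith [sq_nonneg (r * a)]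
  have hra : r * a ≤ 1 := by nlinarith [sq_nonneg (r * ℓ), sq_nonneg (r * a - 1)]
  have hk : √(1 - r * a) < 1 := by
    rw [Real.sqrt_lt' one_pos]
    nlinarith [mul_pos hr0 ha]
  let Φ : E → E := fun x => x - r • (H x - b)
  have hΦ : ContractingWith (Real.toNNReal √(1 - r * a)) Φ := by
    refine ⟨by rwa [Real.toNNReal_lt_one], LipschitzWith.of_dist_le_mul fun x y => ?_⟩
    rw [dist_eq_norm, dist_eq_norm, Real.coe_toNNReal _ (Real.sqrt_nonneg _)]
    refine le_of_sq_le_sq ?_ (by positivity)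
    rw [mul_pow, Real.sq_sqrt (by linarith)]
    have he : Φ x - Φ y = (x - y) - r • (H x - H y) := by simp only [Φ]; module
    rw [he]
    exact (forward_step_norm_sq_le hr0.le (hmono x y) (hlip x y)).trans
      (mul_le_mul_of_nonneg_right hc (sq_nonneg _))
  refine ⟨hΦ.fixedPoint, ?_⟩
  have h := hΦ.fixedPoint_isFixedPt
  simp only [Function.IsFixedPt, Φ, sub_eq_self, smul_eq_zero, hr0.ne', false_or] at h
  exact sub_eq_zero.1 h

end Monotone

/-! ### Bounds in expectation -/

section ExpLE

variable {Ω : Type*} {mΩ : MeasurableSpace Ω} {μ : Measure Ω} {f g : Ω → ℝ} {b c : ℝ}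

/-- `f` is integrable and its expectation is at most `b`. -/
def ExpLE (μ : Measure Ω) (f : Ω → ℝ) (b : ℝ) : Prop := Integrable f μ ∧ ∫ ω, f ω ∂μ ≤ b

theorem ExpLE.trans (h : ExpLE μ f b) (hbc : b ≤ c) : ExpLE μ f c := ⟨h.1, h.2.trans hbc⟩

theorem ExpLE.of_le (hg : ExpLE μ g b) (hf : Measurable f) (h0 : ∀ ω, 0 ≤ f ω)
    (hfg : ∀ ω, f ω ≤ g ω) : ExpLE μ f b := by
  have hi : Integrable f μ := hg.1.mono' hf.aestronglyMeasurable
    (Filter.Eventually.of_forall fun ω => by rw [Real.norm_of_nonneg (h0 ω)]; exact hfg ω)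
  exact ⟨hi, (integral_mono hi hg.1 hfg).trans hg.2⟩

theorem ExpLE.add (hf : ExpLE μ f b) (hg : ExpLE μ g c) :
    ExpLE μ (fun ω => f ω + g ω) (b + c) :=
  ⟨hf.1.add hg.1, by rw [integral_add hf.1 hg.1]; exact add_le_add hf.2 hg.2⟩

theorem ExpLE.const_mul (hf : ExpLE μ f b) {a : ℝ} (ha : 0 ≤ a) :
    ExpLE μ (fun ω => a * f ω) (a * b) :=
  ⟨hf.1.const_mul a, by rw [integral_const_mul]; exact mul_le_mul_of_nonneg_left hf.2 ha⟩

theorem ExpLE.const [IsProbabilityMeasure μ] (b : ℝ) : ExpLE μ (fun _ => b) b :=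
  ⟨integrable_const b, by simp⟩

theorem ExpLE.sum {ι : Type*} {s : Finset ι} {f : ι → Ω → ℝ} {b : ι → ℝ}
    (h : ∀ i ∈ s, ExpLE μ (f i) (b i)) : ExpLE μ (fun ω => ∑ i ∈ s, f i ω) (∑ i ∈ s, b i) :=
  ⟨integrable_finsetSum _ fun i hi => (h i hi).1, by
    rw [integral_finsetSum _ fun i hi => (h i hi).1]
    exact Finset.sum_le_sum fun i hi => (h i hi).2⟩

theorem ExpLE.nonneg (h : ExpLE μ f b) (h0 : ∀ ω, 0 ≤ f ω) : 0 ≤ b :=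
  (integral_nonneg h0).trans h.2

end ExpLE

/-- Integrating out a variable that is independent of the past. -/
theorem ExpLE.of_indep {Ω : Type*} {𝓖 mΩ : MeasurableSpace Ω} {μ : Measure Ω}
    [IsProbabilityMeasure μ] {b : ℝ} (h𝓖 : 𝓖 ≤ mΩ) {Z X : Type*} [MeasurableSpace Z] [MeasurableSpace X] {Y : Ω → Z} (hY : Measurable[𝓖] Y)
    {ξ : Ω → X} (hξ : Measurable ξ) (hind : Indep 𝓖 (MeasurableSpace.comap ξ inferInstance) μ)
    {P : Measure X} [IsProbabilityMeasure P] (hP : μ.map ξ = P) {φ : Z × X → ℝ} (hφ : Measurable φ)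
    (h0 : ∀ z, 0 ≤ φ z) {ψ : Z → ℝ} (hψ : ∀ z, ExpLE P (fun x => φ (z, x)) (ψ z))
    (hb : ExpLE μ (fun ω => ψ (Y ω)) b) : ExpLE μ (fun ω => φ (Y ω, ξ ω)) b := by
  have hY' : Measurable Y := hY.mono h𝓖 le_rfl
  have hYξ : IndepFun Y ξ μ := (IndepFun_iff_Indep Y ξ μ).2 (indep_of_indep_of_le_left hind hY.comap_le)
  have hmap := (indepFun_iff_map_prod_eq_prod_map_map hY'.aemeasurable hξ.aemeasurable).1 hYξ
  have hψ0 : ∀ z, 0 ≤ ψ z := fun z => (hψ z).nonneg fun x => h0 _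
  -- Tonelli needs no integrability, so the nonnegative integral is bounded first; integrability of
  -- the composite then follows from its finiteness.
  have hkey : ∫⁻ ω, ENNReal.ofReal (φ (Y ω, ξ ω)) ∂μ ≤ ENNReal.ofReal b := by
    calc ∫⁻ ω, ENNReal.ofReal (φ (Y ω, ξ ω)) ∂μ
        = ∫⁻ p, ENNReal.ofReal (φ p) ∂(μ.map fun ω => (Y ω, ξ ω)) :=
          (lintegral_map hφ.ennreal_ofReal (hY'.prodMk hξ)).symm
      _ = ∫⁻ z, ∫⁻ x, ENNReal.ofReal (φ (z, x)) ∂P ∂(μ.map Y) := by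
          rw [hmap, hP, lintegral_prod _ hφ.ennreal_ofReal.aemeasurable]
      _ = ∫⁻ ω, ∫⁻ x, ENNReal.ofReal (φ (Y ω, x)) ∂P ∂μ :=
          lintegral_map hφ.ennreal_ofReal.lintegral_prod_right' hY'
      _ ≤ ∫⁻ ω, ENNReal.ofReal (ψ (Y ω)) ∂μ := by
          refine lintegral_mono fun ω => ?_
          rw [← ofReal_integral_eq_lintegral_ofReal (hψ (Y ω)).1
            (Filter.Eventually.of_forall fun x => h0 _)]
          exact ENNReal.ofReal_le_ofReal (hψ (Y ω)).2
      _ = ENNReal.ofReal (∫ ω, ψ (Y ω) ∂μ) :=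
          (ofReal_integral_eq_lintegral_ofReal hb.1
            (Filter.Eventually.of_forall fun ω => hψ0 _)).symm
      _ ≤ ENNReal.ofReal b := ENNReal.ofReal_le_ofReal hb.2
  have hm : Measurable fun ω => φ (Y ω, ξ ω) := hφ.comp (hY'.prodMk hξ)
  have hi : Integrable (fun ω => φ (Y ω, ξ ω)) μ := by
    refine ⟨hm.aestronglyMeasurable, ?_⟩
    rw [hasFiniteIntegral_iff_ofReal (Filter.Eventually.of_forall fun ω => h0 _)]
    exact hkey.trans_lt ENNReal.ofReal_lt_top
  refine ⟨hi, ?_⟩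
  rw [← ofReal_integral_eq_lintegral_ofReal hi (Filter.Eventually.of_forall fun ω => h0 _)] at hkey
  exact (ENNReal.ofReal_le_ofReal_iff (hb.nonneg fun ω => hψ0 _)).1 hkey

/-! ### The history of the samples -/

namespace StochasticProblem

variable {M : ℕ} {L σ : ℝ} (Q : StochasticProblem M L σ)

/-- The information contained in all samples drawn before sample `j` of the `s`-th call. -/
def past (s j : ℕ) : MeasurableSpace Q.Ω :=
  ⨆ i ∈ {i : ℕ × ℕ × Fin M | i.1 < s ∨ i.1 = s ∧ i.2.1 < j},
    MeasurableSpace.comap (Q.ξ i) (Q.measΞ i.2.2)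

theorem past_le (s j : ℕ) : Q.past s j ≤ Q.measΩ :=
  iSup₂_le fun i _ => (Q.measurable_ξ i).comap_le

theorem past_mono (s : ℕ) {j j' : ℕ} (h : j ≤ j') : Q.past s j ≤ Q.past s j' :=
  biSup_mono fun i hi => by
    simp only [Set.mem_ofPred_eq] at hi ⊢
    omega

/-- The indices `j` and `j'` are arbitrary: a call may use any number of samples, and all of them
are past for the next call. -/
theorem past_le_succ (s j j' : ℕ) : Q.past s j ≤ Q.past (s + 1) j' :=
  biSup_mono fun i hi => by
    simp only [Set.mem_ofPred_eq] at hi ⊢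
    omega

theorem measurable_sample (s j : ℕ) (m : Fin M) : Measurable[Q.past s (j + 1)] (Q.ξ (s, j, m)) :=
  Measurable.of_comap_le <| le_iSup₂_of_le (s, j, m) (by simp) le_rfl

theorem indep_past (s j : ℕ) (m : Fin M) :
    Indep (Q.past s j) (MeasurableSpace.comap (Q.ξ (s, j, m)) (Q.measΞ m)) Q.Pr := by
  have h := indep_iSup_of_disjoint (fun i => (Q.measurable_ξ i).comap_le) Q.indep_ξ
    (S := {i : ℕ × ℕ × Fin M | i.1 < s ∨ i.1 = s ∧ i.2.1 < j}) (T := {(s, j, m)})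
    (by simp)
  simpa [past] using h

theorem continuous_gradient (m : Fin M) : Continuous (gradient (Q.F m)) := by
  refine (LipschitzWith.of_dist_le_mul (K := L.toNNReal) fun x y => ?_).continuous
  rw [dist_eq_norm, dist_eq_norm]
  exact (Q.smooth m x y).trans (mul_le_mul_of_nonneg_right (Real.le_coe_toNNReal L) (norm_nonneg _))

/-- The deviation of the stochastic gradient from the gradient. -/
def noise (s j : ℕ) (m : Fin M) (x : Vec Q.n) (ω : Q.Ω) : Vec Q.n :=
  Q.g m x (Q.ξ (s, j, m) ω) - gradient (Q.F m) x

/-- Expanding the square, unbiasedness kills the cross term and the variance bound controls the last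
one. -/
theorem expLE_sub_noise_point (m : Fin M) (x a : Vec Q.n) (c : ℝ) :
    ExpLE (Q.P m) (fun z => ‖a - c • (Q.g m x z - gradient (Q.F m) x)‖ ^ 2)
      (‖a‖ ^ 2 + c ^ 2 * σ ^ 2) := by
  have hi : Integrable (fun z => Q.g m x z - gradient (Q.F m) x) (Q.P m) :=
    (Q.integrable_g m x).sub (integrable_const _)
  have he : ∀ z, ‖a - c • (Q.g m x z - gradient (Q.F m) x)‖ ^ 2
      = ‖a‖ ^ 2 - 2 * c * ⟪a, Q.g m x z - gradient (Q.F m) x⟫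
        + c ^ 2 * ‖Q.g m x z - gradient (Q.F m) x‖ ^ 2 := by
    intro z
    rw [norm_sub_sq_real, inner_smul_right, norm_smul, Real.norm_eq_abs, mul_pow, sq_abs]
    ring
  have h0 : ∫ z, ⟪a, Q.g m x z - gradient (Q.F m) x⟫ ∂(Q.P m) = 0 := by
    rw [integral_inner hi, integral_sub (Q.integrable_g m x) (integrable_const _), Q.unbiased]
    simp
  have hi1 : Integrable (fun z => ‖a‖ ^ 2 - 2 * c * ⟪a, Q.g m x z - gradient (Q.F m) x⟫) (Q.P m) :=
    (integrable_const _).sub ((hi.const_inner a).const_mul _)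
  simp only [he]
  refine ⟨hi1.add ((Q.integrable_sq m x).const_mul _), ?_⟩
  rw [integral_add hi1 ((Q.integrable_sq m x).const_mul _),
    integral_sub (integrable_const _) ((hi.const_inner a).const_mul _), integral_const_mul,
    integral_const_mul, h0]
  have := mul_le_mul_of_nonneg_left (Q.variance_le m x) (sq_nonneg c)
  simpa using this

theorem measurable_noise {s j : ℕ} {m : Fin M} {x : Q.Ω → Vec Q.n}
    (hx : Measurable[Q.past s (j + 1)] x) :
    Measurable[Q.past s (j + 1)] fun ω => Q.noise s j m (x ω) ω :=
  Measurable.sub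
    ((Q.measurable_g m).comp (Measurable.prodMk hx (Q.measurable_sample s j m)))
    ((Q.continuous_gradient m).measurable.comp hx)

/-- Both the query point and the vector `a` are functions of the past, while sample `j` is fresh;
conditionally on the past this is the estimate at a fixed point. -/
theorem expLE_sub_noise {s j : ℕ} {m : Fin M} {x a : Q.Ω → Vec Q.n}
    (hx : Measurable[Q.past s j] x) (ha : Measurable[Q.past s j] a) (c : ℝ) {b : ℝ}
    (hb : ExpLE Q.Pr (fun ω => ‖a ω‖ ^ 2) b) :
    ExpLE Q.Pr (fun ω => ‖a ω - c • Q.noise s j m (x ω) ω‖ ^ 2) (b + c ^ 2 * σ ^ 2) := by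
  refine ExpLE.of_indep (Q.past_le s j) (Y := fun ω => (x ω, a ω)) (Measurable.prodMk hx ha)
    (Q.measurable_ξ (s, j, m)) (Q.indep_past s j m) (Q.law_ξ (s, j, m))
    (φ := fun p => ‖p.1.2 - c • (Q.g m p.1.1 p.2 - gradient (Q.F m) p.1.1)‖ ^ 2)
    ?_ (fun _ => sq_nonneg _) (fun z => Q.expLE_sub_noise_point m z.1 z.2 c)
    (hb.add (ExpLE.const _))
  have h1 : Measurable fun p : (Vec Q.n × Vec Q.n) × Q.Ξ m => Q.g m p.1.1 p.2 :=
    (Q.measurable_g m).comp (measurable_fst.fst.prodMk measurable_snd)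
  have h2 : Measurable fun p : (Vec Q.n × Vec Q.n) × Q.Ξ m => gradient (Q.F m) p.1.1 :=
    (Q.continuous_gradient m).measurable.comp measurable_fst.fst
  exact ((measurable_fst.snd.sub ((h1.sub h2).const_smul c)).norm).pow_const 2

end StochasticProblem

/-- The noise bound for a weighted sum over the clients. -/
theorem StochasticProblem.expLE_sum_sub_noise {M : ℕ} {L σ : ℝ} (Q : StochasticProblem M L σ)
    {s j : ℕ} {x a : Fin M → Q.Ω → Vec Q.n}
    (hx : ∀ m, Measurable[Q.past s j] (x m)) (ha : ∀ m, Measurable[Q.past s j] (a m))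
    {wt c : Fin M → ℝ} (hwt : ∀ m, 0 < wt m) {b : ℝ}
    (hb : ExpLE Q.Pr (fun ω => ∑ m, wt m * ‖a m ω‖ ^ 2) b) :
    ExpLE Q.Pr (fun ω => ∑ m, wt m * ‖a m ω - c m • Q.noise s j m (x m ω) ω‖ ^ 2)
      (b + ∑ m, wt m * (c m ^ 2 * σ ^ 2)) := by
  -- Positive weights make every summand a minorant of a multiple of the integrable sum, so
  -- expectation and sum can be exchanged.
  have hi : ∀ m, Integrable (fun ω => ‖a m ω‖ ^ 2) Q.Pr := by
    intro m
    refine ((hb.const_mul (inv_nonneg.2 (hwt m).le)).of_le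
      ((((ha m).mono (Q.past_le s j) le_rfl).norm).pow_const 2) (fun _ => sq_nonneg _)
      fun ω => ?_).1
    rw [← div_eq_inv_mul, le_div_iff₀ (hwt m), mul_comm]
    exact Finset.single_le_sum (f := fun m => wt m * ‖a m ω‖ ^ 2)
      (fun i _ => mul_nonneg (hwt i).le (sq_nonneg _)) (Finset.mem_univ m)
  have h := ExpLE.sum (s := Finset.univ) fun m _ =>
    (Q.expLE_sub_noise (m := m) (hx m) (ha m) (c m) ⟨hi m, le_rfl⟩).const_mul (hwt m).le
  refine h.trans ?_
  simp only [mul_add, Finset.sum_add_distrib]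
  have h2 := hb.2
  rw [integral_finsetSum _ fun m _ => (hi m).const_mul _] at h2
  simp only [integral_const_mul] at h2
  linarith

/-! ### The operators of GA-MSGD -/

namespace StochasticProblem

variable {M : ℕ} {L σ : ℝ} (Q : StochasticProblem M L σ)

/-- The gradients of the local functions `Fₘ + L ‖· - y‖²` are `ν`-strongly monotone, and `ν` is
comparable with `L`. -/
structure ProxRegular (ν : ℝ) : Prop where
  L_pos : 0 < L
  le_modulus : L ≤ ν
  modulus_le : ν ≤ 3 * L
  monotone : ∀ m x y,
    (ν - 2 * L) * ‖x - y‖ ^ 2 ≤ ⟪gradient (Q.F m) x - gradient (Q.F m) y, x - y⟫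

variable [NeZero M]

omit [NeZero M] in
theorem hasGradientAt_obj (x : Vec Q.n) :
    HasGradientAt Q.obj ((1 / (M : ℝ)) • ∑ m, gradient (Q.F m) x) x := by
  have h : HasFDerivAt (fun x => (1 / (M : ℝ)) * ∑ m, Q.F m x)
      ((1 / (M : ℝ)) • ∑ m, fderiv ℝ (Q.F m) x) x :=
    (HasFDerivAt.fun_sum fun m _ => (Q.differentiable m x).hasFDerivAt).const_mul _
  rw [hasGradientAt_iff_hasFDerivAt]
  refine h.congr_fderiv ?_
  simp [gradient, map_sum]

omit [NeZero M] in
theorem gradient_obj (x : Vec Q.n) :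
    gradient Q.obj x = (1 / (M : ℝ)) • ∑ m, gradient (Q.F m) x :=
  (Q.hasGradientAt_obj x).gradient

omit [NeZero M] in
theorem differentiable_obj : Differentiable ℝ Q.obj :=
  fun x => (Q.hasGradientAt_obj x).differentiableAt

theorem smooth_obj (x y : Vec Q.n) :
    ‖gradient Q.obj x - gradient Q.obj y‖ ≤ L * ‖x - y‖ := by
  have hM : (0 : ℝ) < M := by exact_mod_cast Nat.pos_of_ne_zero (NeZero.ne M)
  rw [gradient_obj, gradient_obj, ← smul_sub, ← Finset.sum_sub_distrib, norm_smul,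
    Real.norm_of_nonneg (by positivity), one_div, inv_mul_le_iff₀ hM]
  refine (norm_sum_le _ _).trans ((Finset.sum_le_sum fun m _ => Q.smooth m x y).trans ?_)
  simp

variable {Q} in
theorem ProxRegular.monotone_obj {ν : ℝ} (h : Q.ProxRegular ν) (x y : Vec Q.n) :
    (ν - 2 * L) * ‖x - y‖ ^ 2 ≤ ⟪gradient Q.obj x - gradient Q.obj y, x - y⟫ := by
  have hM : (0 : ℝ) < M := by exact_mod_cast Nat.pos_of_ne_zero (NeZero.ne M)
  rw [gradient_obj, gradient_obj, ← smul_sub, ← Finset.sum_sub_distrib, real_inner_smul_left,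
    sum_inner, one_div, le_inv_mul_iff₀ hM]
  refine le_trans ?_ (Finset.sum_le_sum fun m _ => h.monotone m x y)
  simp

/-- The gradient of `F + L ‖· - y‖²`, up to the constant `2 L y`. -/
def proxOp (x : Vec Q.n) : Vec Q.n := gradient Q.obj x + (2 * L) • x

/-- The minimizer of `F + L ‖· - y‖²`. -/
def prox (y : Vec Q.n) : Vec Q.n := Function.invFun Q.proxOp ((2 * L) • y)

/-- The operator of client `m` in GA-MSGD (multiplied by `M` for the workers). -/
def clientOp (ν : ℝ) (m : Fin M) (x : Vec Q.n) : Vec Q.n :=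
  if m = 0 then
    (1 / (M : ℝ)) • gradient (Q.F m) x + (2 * L / M + ν * ((M : ℝ) - 1) / (2 * M)) • x
  else gradient (Q.F m) x + (2 * L - ν / 2) • x

/-- The value that the operator of client `m` takes at the target of the inner loop. -/
def clientRhs (y : Vec Q.n) (lam : Fin M → Vec Q.n) (m : Fin M) : Vec Q.n :=
  if m = 0 then (2 * L / (M : ℝ)) • y + ∑ i ∈ Finset.univ.erase (0 : Fin M), lam i
  else (2 * L) • y - (M : ℝ) • lam m

/-- The target of the inner loop. -/
def clientTarget (ν : ℝ) (y : Vec Q.n) (lam : Fin M → Vec Q.n) (m : Fin M) : Vec Q.n :=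
  Function.invFun (Q.clientOp ν m) (Q.clientRhs y lam m)

variable {Q} {ν : ℝ} (h : Q.ProxRegular ν)
include h

theorem ProxRegular.proxOp_monotone (x y : Vec Q.n) :
    ν * ‖x - y‖ ^ 2 ≤ ⟪Q.proxOp x - Q.proxOp y, x - y⟫ := by
  have h1 := h.monotone_obj x y
  have he : Q.proxOp x - Q.proxOp y
      = (gradient Q.obj x - gradient Q.obj y) + (2 * L) • (x - y) := by
    unfold proxOp; module
  rw [he, inner_add_left, real_inner_smul_left, real_inner_self_eq_norm_sq]
  linarith

theorem ProxRegular.proxOp_lipschitz (x y : Vec Q.n) :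
    ‖Q.proxOp x - Q.proxOp y‖ ≤ 3 * L * ‖x - y‖ := by
  have hL := h.L_pos
  have he : Q.proxOp x - Q.proxOp y
      = (gradient Q.obj x - gradient Q.obj y) + (2 * L) • (x - y) := by
    unfold proxOp; module
  rw [he]
  refine (norm_add_le _ _).trans ?_
  rw [norm_smul, Real.norm_of_nonneg (by positivity)]
  linarith [Q.smooth_obj x y]

theorem ProxRegular.proxOp_prox (y : Vec Q.n) : Q.proxOp (Q.prox y) = (2 * L) • y :=
  Function.rightInverse_invFun (surjective_of_strongly_monotone (h.L_pos.trans_le h.le_modulus)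
    h.proxOp_monotone h.proxOp_lipschitz) _

theorem ProxRegular.gradient_prox (y : Vec Q.n) :
    gradient Q.obj (Q.prox y) = (2 * L) • (y - Q.prox y) := by
  have h1 := h.proxOp_prox y
  rw [proxOp, ← eq_sub_iff_add_eq] at h1
  rw [h1, smul_sub]

/-- The constant is 2L/ν ≤ 2. Beyond distance estimates, continuity of `prox` is what makes the
random minimizers measurable. -/
theorem ProxRegular.norm_prox_sub_le (y y' : Vec Q.n) : ‖Q.prox y - Q.prox y'‖ ≤ 2 * ‖y - y'‖ := by
  have hL := h.L_pos
  have h1 := norm_sub_le_of_strongly_monotone h.proxOp_monotone (Q.prox y) (Q.prox y')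
  rw [h.proxOp_prox, h.proxOp_prox, ← smul_sub, norm_smul, Real.norm_of_nonneg (by positivity)] at h1
  have h2 := mul_le_mul_of_nonneg_right h.le_modulus (norm_nonneg (Q.prox y - Q.prox y'))
  refine le_of_mul_le_mul_left ?_ hL
  linarith

theorem ProxRegular.continuous_prox : Continuous Q.prox :=
  (LipschitzWith.of_dist_le_mul (K := 2) fun y y' => by
    rw [dist_eq_norm, dist_eq_norm]; exact h.norm_prox_sub_le y y').continuous

/-- After the shift a worker keeps modulus ν/2, and the coordinator, whose own share was only ν/M,
has ν/2 + ν/(2M). Since ν ≥ L, both exceed L/2 independently of M. -/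
theorem ProxRegular.clientOp_monotone (m : Fin M) (x y : Vec Q.n) :
    L / 2 * ‖x - y‖ ^ 2 ≤ ⟪Q.clientOp ν m x - Q.clientOp ν m y, x - y⟫ := by
  have hL := h.L_pos
  have hν := h.le_modulus
  have h1 := h.monotone m x y
  have hM : (0 : ℝ) < M := by exact_mod_cast Nat.pos_of_ne_zero (NeZero.ne M)
  unfold clientOp
  split_ifs
  · have he : ((1 / (M : ℝ)) • gradient (Q.F m) x + (2 * L / M + ν * ((M : ℝ) - 1) / (2 * M)) • x)
        - ((1 / (M : ℝ)) • gradient (Q.F m) y + (2 * L / M + ν * ((M : ℝ) - 1) / (2 * M)) • y)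
        = (1 / (M : ℝ)) • (gradient (Q.F m) x - gradient (Q.F m) y)
          + (2 * L / M + ν * ((M : ℝ) - 1) / (2 * M)) • (x - y) := by module
    rw [he, inner_add_left, real_inner_smul_left, real_inner_smul_left, real_inner_self_eq_norm_sq]
    have h2 := mul_le_mul_of_nonneg_left h1 (show 0 ≤ 1 / (M : ℝ) by positivity)
    have h3 : (1 / (M : ℝ)) * ((ν - 2 * L) * ‖x - y‖ ^ 2)
        + (2 * L / M + ν * ((M : ℝ) - 1) / (2 * M)) * ‖x - y‖ ^ 2
        = (ν / 2 + ν / (2 * M)) * ‖x - y‖ ^ 2 := by field_simp; ring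
    have h4 : L / 2 ≤ ν / 2 + ν / (2 * M) := by
      have : 0 ≤ ν / (2 * M) := by have := hL.trans_le hν; positivity
      linarith
    linarith [mul_le_mul_of_nonneg_right h4 (sq_nonneg ‖x - y‖)]
  · have he : (gradient (Q.F m) x + (2 * L - ν / 2) • x) - (gradient (Q.F m) y + (2 * L - ν / 2) • y)
        = (gradient (Q.F m) x - gradient (Q.F m) y) + (2 * L - ν / 2) • (x - y) := by module
    rw [he, inner_add_left, real_inner_smul_left, real_inner_self_eq_norm_sq]
    linarith [mul_le_mul_of_nonneg_right hν (sq_nonneg ‖x - y‖)]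

theorem ProxRegular.clientOp_lipschitz (m : Fin M) (x y : Vec Q.n) :
    ‖Q.clientOp ν m x - Q.clientOp ν m y‖ ≤ 3 * L * ‖x - y‖ := by
  have hL := h.L_pos
  have hν := h.le_modulus
  have hν' := h.modulus_le
  have h1 := Q.smooth m x y
  have hM : (1 : ℝ) ≤ M := by exact_mod_cast Nat.pos_of_ne_zero (NeZero.ne M)
  unfold clientOp
  split_ifs
  · have he : ((1 / (M : ℝ)) • gradient (Q.F m) x + (2 * L / M + ν * ((M : ℝ) - 1) / (2 * M)) • x)
        - ((1 / (M : ℝ)) • gradient (Q.F m) y + (2 * L / M + ν * ((M : ℝ) - 1) / (2 * M)) • y)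
        = (1 / (M : ℝ)) • (gradient (Q.F m) x - gradient (Q.F m) y)
          + (2 * L / M + ν * ((M : ℝ) - 1) / (2 * M)) • (x - y) := by module
    have hc : 0 ≤ 2 * L / M + ν * ((M : ℝ) - 1) / (2 * M) := by
      have h2 : 0 ≤ (M : ℝ) - 1 := by linarith
      have h3 : 0 ≤ ν := by linarith
      positivity
    rw [he]
    refine (norm_add_le _ _).trans ?_
    rw [norm_smul, norm_smul, Real.norm_of_nonneg hc, Real.norm_of_nonneg (by positivity)]
    have h2 := mul_le_mul_of_nonneg_left h1 (show 0 ≤ 1 / (M : ℝ) by positivity)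
    have h4 : (1 / (M : ℝ)) * L + (2 * L / M + ν * ((M : ℝ) - 1) / (2 * M)) ≤ 3 * L := by
      have : (1 / (M : ℝ)) * L + (2 * L / M + ν * ((M : ℝ) - 1) / (2 * M))
          = (6 * L + ν * (M - 1)) / (2 * M) := by field_simp; ring
      rw [this, div_le_iff₀ (by positivity)]
      nlinarith
    linarith [mul_le_mul_of_nonneg_right h4 (norm_nonneg (x - y))]
  · have he : (gradient (Q.F m) x + (2 * L - ν / 2) • x) - (gradient (Q.F m) y + (2 * L - ν / 2) • y)
        = (gradient (Q.F m) x - gradient (Q.F m) y) + (2 * L - ν / 2) • (x - y) := by module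
    rw [he]
    refine (norm_add_le _ _).trans ?_
    rw [norm_smul, Real.norm_of_nonneg (by linarith)]
    nlinarith [norm_nonneg (x - y)]

theorem ProxRegular.clientOp_invFun (m : Fin M) (b : Vec Q.n) :
    Q.clientOp ν m (Function.invFun (Q.clientOp ν m) b) = b :=
  Function.rightInverse_invFun (surjective_of_strongly_monotone (half_pos h.L_pos)
    (h.clientOp_monotone m) (h.clientOp_lipschitz m)) _

theorem ProxRegular.norm_sub_le_clientOp (m : Fin M) (x y : Vec Q.n) :
    ‖x - y‖ ≤ 2 / L * ‖Q.clientOp ν m x - Q.clientOp ν m y‖ := by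
  have hL := h.L_pos
  have h1 := norm_sub_le_of_strongly_monotone (h.clientOp_monotone m) x y
  rw [div_mul_eq_mul_div, le_div_iff₀ hL]
  linarith

theorem ProxRegular.continuous_clientOp (m : Fin M) : Continuous (Q.clientOp ν m) :=
  (LipschitzWith.of_dist_le_mul (K := (3 * L).toNNReal) fun y y' => by
    rw [dist_eq_norm, dist_eq_norm, Real.coe_toNNReal _ (by linarith [h.L_pos])]
    exact h.clientOp_lipschitz m y y').continuous

/-- Used for measurability: the targets of the inner loop depend on the random dual variables
through this inverse. -/
theorem ProxRegular.continuous_invFun_clientOp (m : Fin M) :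
    Continuous (Function.invFun (Q.clientOp ν m)) :=
  (LipschitzWith.of_dist_le_mul (K := (2 / L).toNNReal) fun y y' => by
    rw [dist_eq_norm, dist_eq_norm, Real.coe_toNNReal _ (by have := h.L_pos; positivity)]
    refine (h.norm_sub_le_clientOp m _ _).trans_eq ?_
    rw [h.clientOp_invFun, h.clientOp_invFun]).continuous

theorem ProxRegular.clientOp_target (y : Vec Q.n) (lam : Fin M → Vec Q.n) (m : Fin M) :
    Q.clientOp ν m (Q.clientTarget ν y lam m) = Q.clientRhs y lam m :=
  h.clientOp_invFun m _

omit h in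
theorem measurable_clientRhs {Ω : Type*} {mΩ : MeasurableSpace Ω} {y : Ω → Vec Q.n}
    {lam : Ω → Fin M → Vec Q.n} (hy : Measurable y) (hlam : Measurable lam) (m : Fin M) :
    Measurable fun ω => Q.clientRhs (y ω) (lam ω) m := by
  have hl : ∀ i, Measurable fun ω => lam ω i := fun i => (measurable_pi_apply i).comp hlam
  unfold clientRhs
  split_ifs
  · have h1 : Measurable fun ω => (2 * L / (M : ℝ)) • y ω := hy.const_smul (2 * L / (M : ℝ))
    have h2 : Measurable fun ω => ∑ i ∈ Finset.univ.erase (0 : Fin M), lam ω i :=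
      Finset.measurable_fun_sum _ fun i _ => hl i
    exact h1.add h2
  · have h1 : Measurable fun ω => (2 * L) • y ω := hy.const_smul (2 * L)
    have h2 : Measurable fun ω => (M : ℝ) • lam ω m := (hl m).const_smul (M : ℝ)
    exact h1.sub h2

theorem ProxRegular.measurable_clientTarget {Ω : Type*} {mΩ : MeasurableSpace Ω} {y : Ω → Vec Q.n}
    {lam : Ω → Fin M → Vec Q.n} (hy : Measurable y) (hlam : Measurable lam) (m : Fin M) :
    Measurable fun ω => Q.clientTarget ν (y ω) (lam ω) m :=
  (h.continuous_invFun_clientOp m).measurable.comp (measurable_clientRhs hy hlam m)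

/-- The optimality condition of the consensus formulation. -/
theorem ProxRegular.clientRhs_zero_sub (y : Vec Q.n) (lam : Fin M → Vec Q.n) :
    Q.clientRhs y lam 0 - Q.clientOp ν 0 (Q.prox y)
      = -((1 / (M : ℝ)) • ∑ m ∈ Finset.univ.erase (0 : Fin M),
          (Q.clientRhs y lam m - Q.clientOp ν m (Q.prox y))) := by
  have hM : (M : ℝ) ≠ 0 := by exact_mod_cast NeZero.ne M
  set p := Q.prox y with hp
  have h1 : ∑ m ∈ Finset.univ.erase (0 : Fin M), (Q.clientRhs y lam m - Q.clientOp ν m p)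
      = ∑ m ∈ Finset.univ.erase (0 : Fin M), ((2 * L) • y - (2 * L - ν / 2) • p
          - (M : ℝ) • lam m - gradient (Q.F m) p) := by
    refine Finset.sum_congr rfl fun m hm => ?_
    simp only [clientRhs, clientOp, if_neg (Finset.ne_of_mem_erase hm)]
    module
  have hcard : (((Finset.univ.erase (0 : Fin M)).card : ℕ) : ℝ) = M - 1 := by
    rw [Finset.card_erase_of_mem (Finset.mem_univ _), Finset.card_univ, Fintype.card_fin,
      Nat.cast_sub (Nat.pos_of_ne_zero (NeZero.ne M)), Nat.cast_one]
  have h2 : gradient Q.obj p = (1 / (M : ℝ)) • (gradient (Q.F 0) p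
      + ∑ m ∈ Finset.univ.erase (0 : Fin M), gradient (Q.F m) p) := by
    rw [gradient_obj, Finset.add_sum_erase _ (fun m => gradient (Q.F m) p) (Finset.mem_univ _)]
  have h3 := h.gradient_prox y
  rw [← hp, h2] at h3
  rw [h1]
  simp only [Finset.sum_sub_distrib, Finset.sum_const, ← Finset.smul_sum, ← Nat.cast_smul_eq_nsmul ℝ,
    hcard]
  simp only [clientRhs, clientOp, if_true]
  -- The stationarity condition of the proximal point eliminates the workers' gradients in favour of
  -- the coordinator's; the rest is bookkeeping of scalars.
  have h4 : ∑ m ∈ Finset.univ.erase (0 : Fin M), gradient (Q.F m) p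
      = (2 * L * M) • (y - p) - gradient (Q.F 0) p := by
    rw [eq_sub_iff_add_eq, add_comm]
    have h5 := congrArg (fun v => (M : ℝ) • v) h3
    simp only [smul_smul, mul_one_div_cancel hM, one_smul] at h5
    rw [h5]
    congr 1; ring
  rw [h4]
  match_scalars <;> field_simp <;> ring

end StochasticProblem

/-! ### Deterministic estimates for GA-MSGD -/

section Vector

variable {E : Type*} [NormedAddCommGroup E] [InnerProductSpace ℝ E]

omit [InnerProductSpace ℝ E] in
theorem norm_add_sq_le_two (x y : E) : ‖x + y‖ ^ 2 ≤ 2 * ‖x‖ ^ 2 + 2 * ‖y‖ ^ 2 := by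
  have h := pow_le_pow_left₀ (norm_nonneg _) (norm_add_le x y) 2
  nlinarith [sq_nonneg (‖x‖ - ‖y‖)]

omit [InnerProductSpace ℝ E] in
theorem norm_sub_sq_le_two (x y : E) : ‖x - y‖ ^ 2 ≤ 2 * ‖x‖ ^ 2 + 2 * ‖y‖ ^ 2 := by
  simpa [sub_eq_add_neg] using norm_add_sq_le_two x (-y)

omit [InnerProductSpace ℝ E] in
theorem norm_sum_sq_le_card {ι : Type*} (s : Finset ι) (f : ι → E) :
    ‖∑ i ∈ s, f i‖ ^ 2 ≤ s.card * ∑ i ∈ s, ‖f i‖ ^ 2 :=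
  (pow_le_pow_left₀ (norm_nonneg _) (norm_sum_le _ _) 2).trans sq_sum_le_card_mul_sum_sq

/-- One inexact step of dual gradient ascent. -/
theorem dual_ascent_step {ι : Type*} (s : Finset ι) {δ u w : ι → E} {u₀ w₀ : E} {L c : ℝ}
    (hL : 0 < L) (hc : (s.card : ℝ) ≤ c) (h1 : ∀ i ∈ s, L / 2 * ‖u i‖ ^ 2 ≤ ⟪δ i, u i⟫)
    (h2 : ∀ i ∈ s, ‖δ i‖ ≤ 3 * L * ‖u i‖)
    (h3 : ⟪∑ i ∈ s, δ i, u₀⟫ ≤ -(c * (L / 2 * ‖u₀‖ ^ 2))) :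
    ∑ i ∈ s, ‖δ i - (L / 4) • ((u i + w i) - (u₀ + w₀))‖ ^ 2
      ≤ 143 / 144 * ∑ i ∈ s, ‖δ i‖ ^ 2
        + 19 * L ^ 2 * (∑ i ∈ s, ‖w i‖ ^ 2 + c * ‖w₀‖ ^ 2) := by
  have hterm : ∀ i ∈ s, ‖δ i - (L / 4) • ((u i + w i) - (u₀ + w₀))‖ ^ 2
      ≤ 145 / 144 * (71 / 72 * ‖δ i‖ ^ 2 + L / 2 * ⟪δ i, u₀⟫ + L ^ 2 / 8 * ‖u₀‖ ^ 2)
        + 19 * L ^ 2 * (‖w i‖ ^ 2 + ‖w₀‖ ^ 2) := by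
    intro i hi
    set e := δ i - (L / 4) • (u i - u₀) with he
    set f := (L / 4) • (w i - w₀) with hf
    have h0 : δ i - (L / 4) • ((u i + w i) - (u₀ + w₀)) = e - f := by rw [he, hf]; module
    -- Here e is the exact dual step and f the effect of the inner-loop error. Young's inequality
    -- with weight 1/144 spends half of the contraction 1/72 obtained below for e.
    have hef : ‖e - f‖ ^ 2 ≤ 145 / 144 * ‖e‖ ^ 2 + 145 * ‖f‖ ^ 2 := by
      have h := pow_le_pow_left₀ (norm_nonneg _) (norm_sub_le e f) 2
      nlinarith [sq_nonneg (‖e‖ - 144 * ‖f‖)]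
    have hf2 : ‖f‖ ^ 2 ≤ L ^ 2 / 8 * (‖w i‖ ^ 2 + ‖w₀‖ ^ 2) := by
      rw [hf, norm_smul, mul_pow, Real.norm_eq_abs, sq_abs]
      nlinarith [norm_sub_sq_le_two (w i) w₀, mul_le_mul_of_nonneg_left
        (norm_sub_sq_le_two (w i) w₀) (sq_nonneg (L / 4))]
    -- Strong monotonicity gives -(L²/4)‖u i‖², of which the quadratic term consumes L²/8; the
    -- Lipschitz bound ‖δ i‖ ≤ 3L‖u i‖ converts the remaining L²/8 into ‖δ i‖²/72.
    have he2 : ‖e‖ ^ 2 ≤ 71 / 72 * ‖δ i‖ ^ 2 + L / 2 * ⟪δ i, u₀⟫ + L ^ 2 / 8 * ‖u₀‖ ^ 2 := by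
      have h4 : ‖e‖ ^ 2 = ‖δ i‖ ^ 2 - L / 2 * ⟪δ i, u i⟫ + L / 2 * ⟪δ i, u₀⟫
          + L ^ 2 / 16 * ‖u i - u₀‖ ^ 2 := by
        rw [he, norm_sub_sq_real, inner_smul_right, inner_sub_right, norm_smul, mul_pow,
          Real.norm_eq_abs, sq_abs]
        ring
      have h5 := mul_le_mul_of_nonneg_left (norm_sub_sq_le_two (u i) u₀)
        (show 0 ≤ L ^ 2 / 16 by positivity)
      have h6 := mul_le_mul_of_nonneg_left (h1 i hi) (show 0 ≤ L / 2 by positivity)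
      have h7 := pow_le_pow_left₀ (norm_nonneg _) (h2 i hi) 2
      rw [h4]
      nlinarith
    rw [h0]
    nlinarith [mul_nonneg (sq_nonneg L) (add_nonneg (sq_nonneg ‖w i‖) (sq_nonneg ‖w₀‖))]
  refine (Finset.sum_le_sum hterm).trans ?_
  simp only [Finset.sum_add_distrib, ← Finset.mul_sum, Finset.sum_const, nsmul_eq_mul, mul_add]
  rw [sum_inner] at h3
  have h8 := mul_le_mul_of_nonneg_right hc (sq_nonneg ‖u₀‖)
  have h9 := mul_le_mul_of_nonneg_right hc (sq_nonneg ‖w₀‖)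
  -- Only after summation do the terms in u₀ have a sign: the coordinator contributes -c L²/4 ‖u₀‖²,
  -- which dominates the c L²/8 ‖u₀‖² left over from the squares.
  have h10 := mul_le_mul_of_nonneg_left h3 (show 0 ≤ 145 / 144 * (L / 2) by positivity)
  have h11 := mul_le_mul_of_nonneg_left h8 (show 0 ≤ 145 / 144 * (L ^ 2 / 8) by positivity)
  have h12 := mul_le_mul_of_nonneg_left h9 (show 0 ≤ 19 * L ^ 2 by positivity)
  have h13 : 0 ≤ c * (L ^ 2 * ‖u₀‖ ^ 2) :=
    mul_nonneg ((Nat.cast_nonneg _).trans hc) (by positivity)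
  have h14 : 0 ≤ ∑ i ∈ s, ‖δ i‖ ^ 2 := Finset.sum_nonneg fun i _ => sq_nonneg _
  nlinarith

end Vector

/-! ### Weights balancing the coordinator against the workers -/

section Weights

variable {M : ℕ} [NeZero M]

/-- The weights of the clients in the Lyapunov function. -/
def clientWeight (m : Fin M) : ℝ := if m = 0 then M else 1

/-- The scaling of the noise in the local steps. -/
def noiseScale (m : Fin M) : ℝ := if m = 0 then 1 / (M : ℝ) else 1

theorem clientWeight_pos (m : Fin M) : 0 < clientWeight m := by
  unfold clientWeight
  split_ifs
  · exact_mod_cast Nat.pos_of_ne_zero (NeZero.ne M)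
  · exact one_pos

theorem one_le_clientWeight (m : Fin M) : 1 ≤ clientWeight m := by
  unfold clientWeight
  split_ifs
  · exact_mod_cast Nat.pos_of_ne_zero (NeZero.ne M)
  · exact le_rfl

theorem sum_clientWeight_mul (f : Fin M → ℝ) :
    ∑ m, clientWeight m * f m = M * f 0 + ∑ m ∈ Finset.univ.erase (0 : Fin M), f m := by
  rw [← Finset.add_sum_erase _ (fun m => clientWeight m * f m) (Finset.mem_univ (0 : Fin M))]
  refine congrArg₂ _ (by simp [clientWeight]) (Finset.sum_congr rfl fun m hm => ?_)
  rw [clientWeight, if_neg (Finset.ne_of_mem_erase hm), one_mul]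

/-- Weighting the coordinator by M is harmless because its noise is scaled down by 1/M. -/
theorem clientWeight_mul_noiseScale_sq_le (m : Fin M) : clientWeight m * noiseScale m ^ 2 ≤ 1 := by
  have hM : (1 : ℝ) ≤ M := by exact_mod_cast Nat.pos_of_ne_zero (NeZero.ne M)
  unfold clientWeight noiseScale
  split_ifs
  · have h : (M : ℝ) * (1 / (M : ℝ)) ^ 2 = 1 / M := by field_simp
    rw [h]
    exact (div_le_one (by positivity)).2 hM
  · norm_num

theorem card_erase_zero_le : (((Finset.univ.erase (0 : Fin M)).card : ℕ) : ℝ) ≤ M := by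
  have h := Finset.card_le_card (Finset.erase_subset (0 : Fin M) Finset.univ)
  rw [Finset.card_univ, Fintype.card_fin] at h
  exact_mod_cast h

theorem sum_clientWeight_le : ∑ m : Fin M, clientWeight m ≤ 2 * M := by
  have h := sum_clientWeight_mul (M := M) fun _ => 1
  simp only [mul_one, Finset.sum_const, nsmul_eq_mul] at h
  linarith [card_erase_zero_le (M := M)]

/-- By Cauchy–Schwarz, the relation for d₀ gives M‖d₀‖² ≤ ∑‖dₘ‖² over the workers, so the heavily
weighted coordinator at most doubles the sum. This is why the dual error need not include the
coordinator. -/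
theorem weighted_sum_le {E : Type*} [NormedAddCommGroup E] [InnerProductSpace ℝ E]
    {L : ℝ} {x d : Fin M → E} (hx : ∀ m, ‖x m‖ ≤ 2 / L * ‖d m‖)
    (hd : d 0 = -((1 / (M : ℝ)) • ∑ m ∈ Finset.univ.erase (0 : Fin M), d m)) :
    ∑ m, clientWeight m * ‖x m‖ ^ 2
      ≤ 8 / L ^ 2 * ∑ m ∈ Finset.univ.erase (0 : Fin M), ‖d m‖ ^ 2 := by
  have hM : (0 : ℝ) < M := by exact_mod_cast Nat.pos_of_ne_zero (NeZero.ne M)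
  have h1 : ∀ m, ‖x m‖ ^ 2 ≤ 4 / L ^ 2 * ‖d m‖ ^ 2 := by
    intro m
    refine (pow_le_pow_left₀ (norm_nonneg _) (hx m) 2).trans_eq ?_
    rw [mul_pow, div_pow]; norm_num
  have h2 : (M : ℝ) * ‖d 0‖ ^ 2 ≤ ∑ m ∈ Finset.univ.erase (0 : Fin M), ‖d m‖ ^ 2 := by
    rw [hd, norm_neg, norm_smul, mul_pow, Real.norm_of_nonneg (by positivity)]
    have h3 := norm_sum_sq_le_card (Finset.univ.erase (0 : Fin M)) d
    have h4 := mul_le_mul_of_nonneg_right (card_erase_zero_le (M := M))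
      (Finset.sum_nonneg fun m (_ : m ∈ Finset.univ.erase (0 : Fin M)) => sq_nonneg ‖d m‖)
    have h5 := h3.trans h4
    rw [← mul_assoc, show (M : ℝ) * (1 / (M : ℝ)) ^ 2 = 1 / M by field_simp, one_div,
      inv_mul_le_iff₀ hM]
    exact h5
  have h6 : ∑ m, clientWeight m * ‖x m‖ ^ 2
      ≤ 4 / L ^ 2 * ∑ m, clientWeight m * ‖d m‖ ^ 2 := by
    rw [Finset.mul_sum]
    refine Finset.sum_le_sum fun m _ => ?_
    calc clientWeight m * ‖x m‖ ^ 2 ≤ clientWeight m * (4 / L ^ 2 * ‖d m‖ ^ 2) :=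
          mul_le_mul_of_nonneg_left (h1 m) (clientWeight_pos m).le
      _ = _ := by ring
  rw [sum_clientWeight_mul fun m => ‖d m‖ ^ 2] at h6
  refine h6.trans ?_
  rw [show (8 : ℝ) / L ^ 2 = 4 / L ^ 2 * 2 by ring, mul_assoc]
  refine mul_le_mul_of_nonneg_left ?_ (by positivity)
  linarith

end Weights

namespace StochasticProblem

variable {M : ℕ} {L σ : ℝ} [NeZero M] (Q : StochasticProblem M L σ) (ν : ℝ)

/-- The distance of the dual variables to the optimal ones. -/
def dualErr (y : Vec Q.n) (lam : Fin M → Vec Q.n) : ℝ :=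
  ∑ m ∈ Finset.univ.erase (0 : Fin M), ‖Q.clientRhs y lam m - Q.clientOp ν m (Q.prox y)‖ ^ 2

/-- The distance of the primal variables to the targets of the inner loop. -/
def primalErr (y : Vec Q.n) (lam x : Fin M → Vec Q.n) : ℝ :=
  ∑ m, clientWeight m * ‖x m - Q.clientTarget ν y lam m‖ ^ 2

theorem dualErr_nonneg (y : Vec Q.n) (lam : Fin M → Vec Q.n) : 0 ≤ Q.dualErr ν y lam :=
  Finset.sum_nonneg fun _ _ => sq_nonneg _

theorem primalErr_nonneg (y : Vec Q.n) (lam x : Fin M → Vec Q.n) : 0 ≤ Q.primalErr ν y lam x :=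
  Finset.sum_nonneg fun m _ => mul_nonneg (clientWeight_pos m).le (sq_nonneg _)

variable {Q ν} (h : Q.ProxRegular ν)
include h

theorem ProxRegular.sum_target_sub_prox_le (y : Vec Q.n) (lam : Fin M → Vec Q.n) :
    ∑ m, clientWeight m * ‖Q.clientTarget ν y lam m - Q.prox y‖ ^ 2
      ≤ 8 / L ^ 2 * Q.dualErr ν y lam := by
  refine weighted_sum_le (d := fun m => Q.clientRhs y lam m - Q.clientOp ν m (Q.prox y)) (fun m => ?_)
    (h.clientRhs_zero_sub y lam)
  rw [← h.clientOp_target y lam m]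
  exact h.norm_sub_le_clientOp m _ _

/-- The difference of two right-hand sides satisfies the same optimality relation, so
`weighted_sum_le` applies to it as well. -/
theorem ProxRegular.sum_target_sub_target_le (y : Vec Q.n) (lam lam' : Fin M → Vec Q.n) :
    ∑ m, clientWeight m * ‖Q.clientTarget ν y lam m - Q.clientTarget ν y lam' m‖ ^ 2
      ≤ 16 / L ^ 2 * (Q.dualErr ν y lam + Q.dualErr ν y lam') := by
  have h1 := weighted_sum_le (L := L)
    (x := fun m => Q.clientTarget ν y lam m - Q.clientTarget ν y lam' m)
    (d := fun m => Q.clientRhs y lam m - Q.clientRhs y lam' m) (fun m => by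
      rw [← h.clientOp_target y lam m, ← h.clientOp_target y lam' m]
      exact h.norm_sub_le_clientOp m _ _) (by
      have h2 := h.clientRhs_zero_sub y lam
      have h3 := h.clientRhs_zero_sub y lam'
      rw [← sub_sub_sub_cancel_right _ _ (Q.clientOp ν 0 (Q.prox y)), h2, h3]
      simp only [Finset.sum_sub_distrib]
      module)
  refine h1.trans ?_
  rw [show (16 : ℝ) / L ^ 2 = 8 / L ^ 2 * 2 by ring, mul_assoc]
  refine mul_le_mul_of_nonneg_left ?_ (by positivity)
  unfold dualErr
  rw [mul_add, Finset.mul_sum, Finset.mul_sum, ← Finset.sum_add_distrib]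
  refine Finset.sum_le_sum fun m _ => ?_
  rw [← sub_sub_sub_cancel_right _ _ (Q.clientOp ν m (Q.prox y))]
  exact norm_sub_sq_le_two _ _

/-- The step L/(4M) on the dual variable is a step L/4 on the residual, which contains M λ. The
vectors u and w of `dual_ascent_step` are the offset of the target from the solution and the
inner-loop error. -/
theorem ProxRegular.dualErr_step (y : Vec Q.n) (lam x : Fin M → Vec Q.n) :
    Q.dualErr ν y (fun m => lam m + (L / (4 * M)) • (x m - x 0))
      ≤ 143 / 144 * Q.dualErr ν y lam + 19 * L ^ 2 * Q.primalErr ν y lam x := by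
  have hM : (0 : ℝ) < M := by exact_mod_cast Nat.pos_of_ne_zero (NeZero.ne M)
  set p := Q.prox y with hp
  have key := dual_ascent_step (Finset.univ.erase (0 : Fin M))
    (δ := fun m => Q.clientRhs y lam m - Q.clientOp ν m p)
    (u := fun m => Q.clientTarget ν y lam m - p) (w := fun m => x m - Q.clientTarget ν y lam m)
    (u₀ := Q.clientTarget ν y lam 0 - p) (w₀ := x 0 - Q.clientTarget ν y lam 0) h.L_pos
    card_erase_zero_le
    (fun m _ => by rw [← h.clientOp_target y lam m]; exact h.clientOp_monotone m _ _)
    (fun m _ => by rw [← h.clientOp_target y lam m]; exact h.clientOp_lipschitz m _ _)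
    (by
      have h1 := h.clientRhs_zero_sub y lam
      have h2 := h.clientOp_monotone 0 (Q.clientTarget ν y lam 0) p
      rw [h.clientOp_target, h1, inner_neg_left, real_inner_smul_left] at h2
      have h3 := mul_le_mul_of_nonneg_left h2 hM.le
      rw [mul_neg, ← mul_assoc (M : ℝ) (1 / (M : ℝ)), mul_one_div_cancel hM.ne', one_mul] at h3
      linarith)
  have hl : Q.dualErr ν y (fun m => lam m + (L / (4 * M)) • (x m - x 0))
      = ∑ m ∈ Finset.univ.erase (0 : Fin M), ‖(Q.clientRhs y lam m - Q.clientOp ν m p)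
        - (L / 4) • ((Q.clientTarget ν y lam m - p + (x m - Q.clientTarget ν y lam m))
          - (Q.clientTarget ν y lam 0 - p + (x 0 - Q.clientTarget ν y lam 0)))‖ ^ 2 := by
    refine Finset.sum_congr rfl fun m hm => ?_
    congr 2
    simp only [clientRhs, if_neg (Finset.ne_of_mem_erase hm)]
    match_scalars <;> field_simp <;> ring
  rw [hl]
  refine key.trans_eq ?_
  rw [primalErr, sum_clientWeight_mul, dualErr, add_comm (_ * _) (Finset.sum _ _)]

/-- A dual update moves the targets of the inner loop, so the primal error has to be measured anew.
The movement is at most 16/L² times the old and new dual errors, which gives 64 = 2·2·16 and 610 = 2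
+ 2·16·19. -/
theorem ProxRegular.primalErr_step (y : Vec Q.n) (lam x : Fin M → Vec Q.n) :
    Q.primalErr ν y (fun m => lam m + (L / (4 * M)) • (x m - x 0)) x
      ≤ 64 / L ^ 2 * Q.dualErr ν y lam + 610 * Q.primalErr ν y lam x := by
  have hL := h.L_pos
  set lam' : Fin M → Vec Q.n := fun m => lam m + (L / (4 * M)) • (x m - x 0) with hlam
  have h1 := h.sum_target_sub_target_le y lam lam'
  have h2 := h.dualErr_step y lam x
  rw [← hlam] at h2
  have h3 : Q.primalErr ν y lam' x ≤ 2 * Q.primalErr ν y lam x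
      + 2 * ∑ m, clientWeight m * ‖Q.clientTarget ν y lam m - Q.clientTarget ν y lam' m‖ ^ 2 := by
    unfold primalErr
    rw [Finset.mul_sum, Finset.mul_sum, ← Finset.sum_add_distrib]
    refine Finset.sum_le_sum fun m _ => ?_
    rw [← sub_add_sub_cancel (x m) (Q.clientTarget ν y lam m)]
    have h4 := mul_le_mul_of_nonneg_left (norm_add_sq_le_two (x m - Q.clientTarget ν y lam m)
      (Q.clientTarget ν y lam m - Q.clientTarget ν y lam' m)) (clientWeight_pos m).le
    linarith
  have h5 : 16 / L ^ 2 * (Q.dualErr ν y lam + Q.dualErr ν y lam')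
      ≤ 32 / L ^ 2 * Q.dualErr ν y lam + 304 * Q.primalErr ν y lam x := by
    have h6 : Q.dualErr ν y lam + Q.dualErr ν y lam'
        ≤ 2 * Q.dualErr ν y lam + 19 * L ^ 2 * Q.primalErr ν y lam x := by
      linarith [Q.dualErr_nonneg ν y lam]
    refine (mul_le_mul_of_nonneg_left h6 (by positivity)).trans_eq ?_
    field_simp
    ring
  have h7 : 64 / L ^ 2 * Q.dualErr ν y lam = 2 * (32 / L ^ 2 * Q.dualErr ν y lam) := by ring
  rw [h7]
  linarith

/-- The average of the clients is close to the solution of the subproblem. -/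
theorem ProxRegular.norm_average_sub_prox_le (y : Vec Q.n) (lam x : Fin M → Vec Q.n) :
    ‖(1 / (M : ℝ)) • ∑ m, x m - Q.prox y‖ ^ 2
      ≤ 2 / M * (Q.primalErr ν y lam x + 8 / L ^ 2 * Q.dualErr ν y lam) := by
  have hM : (0 : ℝ) < M := by exact_mod_cast Nat.pos_of_ne_zero (NeZero.ne M)
  set p := Q.prox y with hp
  have h1 : (1 / (M : ℝ)) • ∑ m, x m - p = (1 / (M : ℝ)) • ∑ m, (x m - p) := by
    rw [Finset.sum_sub_distrib, smul_sub, Finset.sum_const, Finset.card_univ, Fintype.card_fin,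
      ← Nat.cast_smul_eq_nsmul ℝ, smul_smul, one_div_mul_cancel hM.ne', one_smul]
  have h2 := norm_sum_sq_le_card Finset.univ fun m => x m - p
  rw [Finset.card_univ, Fintype.card_fin] at h2
  have h3 : ∑ m, ‖x m - p‖ ^ 2 ≤ 2 * Q.primalErr ν y lam x
      + 2 * ∑ m, clientWeight m * ‖Q.clientTarget ν y lam m - p‖ ^ 2 := by
    unfold primalErr
    rw [Finset.mul_sum, Finset.mul_sum, ← Finset.sum_add_distrib]
    refine Finset.sum_le_sum fun m _ => ?_
    rw [← sub_add_sub_cancel (x m) (Q.clientTarget ν y lam m) p]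
    have h4 := norm_add_sq_le_two (x m - Q.clientTarget ν y lam m) (Q.clientTarget ν y lam m - p)
    have h5 := mul_le_mul_of_nonneg_right (one_le_clientWeight m)
      (sq_nonneg ‖x m - Q.clientTarget ν y lam m‖)
    have h6 := mul_le_mul_of_nonneg_right (one_le_clientWeight m)
      (sq_nonneg ‖Q.clientTarget ν y lam m - p‖)
    linarith
  have h7 := h.sum_target_sub_prox_le y lam
  rw [h1, norm_smul, mul_pow, Real.norm_of_nonneg (by positivity)]
  calc (1 / (M : ℝ)) ^ 2 * ‖∑ m, (x m - p)‖ ^ 2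
      ≤ (1 / (M : ℝ)) ^ 2 * (M * ∑ m, ‖x m - p‖ ^ 2) := by gcongr
    _ = 1 / M * ∑ m, ‖x m - p‖ ^ 2 := by field_simp
    _ ≤ 1 / M * (2 * Q.primalErr ν y lam x + 2 * (8 / L ^ 2 * Q.dualErr ν y lam)) := by
        gcongr
        linarith
    _ = _ := by ring

end StochasticProblem

/-! ### Stochastic analysis of GA-MSGD -/

namespace StochasticProblem

variable {M : ℕ} {L σ : ℝ} [NeZero M] {Q : StochasticProblem M L σ} {ν : ℝ}

omit [NeZero M] in
theorem subGrad_eq (s : ℕ) (y : Vec Q.n) (ω : Q.Ω) (j : ℕ) (m : Fin M) (x : Vec Q.n) :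
    Q.subGrad s y ω j m x
      = gradient (Q.F m) x + Q.noise s j m x ω + (2 * L) • (x - y) := by
  simp [subGrad, noise]

/-- With worker step Mη and coordinator step η, all clients perform the same forward step of length
η on `clientOp`. The factor M absorbs the 1/M in front of the workers' gradients; the coordinator
keeps it, hence `noiseScale`. -/
theorem innerStep_eq {θ : GAParams} {η : ℝ} (h₁ : ∀ k, θ.τ₁ k = M * η) (h₂ : ∀ k, θ.τ₂ k = η)
    (s : ℕ) (y : Vec Q.n) (ω : Q.Ω) (j k : ℕ) (lam x : Fin M → Vec Q.n) (m : Fin M) :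
    innerStep ν θ (Q.subGrad s y ω j) lam k x m
      = x m - η • (Q.clientOp ν m (x m) - Q.clientRhs y lam m)
        - (η * noiseScale m) • Q.noise s j m (x m) ω := by
  have hM : (M : ℝ) ≠ 0 := by exact_mod_cast NeZero.ne M
  rcases eq_or_ne m 0 with rfl | hm
  · simp only [innerStep, if_true, h₂, subGrad_eq, clientOp, clientRhs, noiseScale]
    match_scalars <;> field_simp
  · simp only [innerStep, if_neg hm, h₁, subGrad_eq, clientOp, clientRhs, noiseScale]
    match_scalars <;> field_simp

omit [NeZero M] in
theorem measurable_of_apply {Ω : Type*} {mΩ : MeasurableSpace Ω} {n : ℕ} {x : Ω → Fin M → Vec n}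
    (hx : ∀ m, Measurable fun ω => x ω m) : Measurable x :=
  measurable_pi_iff.2 hx

omit [NeZero M] in
theorem measurable_apply {Ω : Type*} {mΩ : MeasurableSpace Ω} {n : ℕ} {x : Ω → Fin M → Vec n}
    (hx : Measurable x) (m : Fin M) : Measurable fun ω => x ω m :=
  (measurable_pi_apply m).comp hx

variable (h : Q.ProxRegular ν)
include h

theorem ProxRegular.measurable_primalErr {Ω : Type*} {mΩ : MeasurableSpace Ω} {y : Ω → Vec Q.n}
    {lam x : Ω → Fin M → Vec Q.n} (hy : Measurable y) (hlam : Measurable lam) (hx : Measurable x) :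
    Measurable fun ω => Q.primalErr ν (y ω) (lam ω) (x ω) :=
  Finset.measurable_fun_sum _ fun m _ => (((measurable_apply hx m).sub
    (h.measurable_clientTarget hy hlam m)).norm.pow_const 2).const_mul _

theorem ProxRegular.measurable_dualErr {Ω : Type*} {mΩ : MeasurableSpace Ω} {y : Ω → Vec Q.n}
    {lam : Ω → Fin M → Vec Q.n} (hy : Measurable y) (hlam : Measurable lam) :
    Measurable fun ω => Q.dualErr ν (y ω) (lam ω) :=
  Finset.measurable_fun_sum _ fun m _ => ((measurable_clientRhs hy hlam m).sub
    ((h.continuous_clientOp m).measurable.comp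
      (h.continuous_prox.measurable.comp hy))).norm.pow_const 2

/-- SGD for a strongly monotone operator: the deterministic part contracts and each fresh sample
adds at most Mη²σ². Measurability with respect to `past` is carried through the induction because it
licenses the use of the next sample. -/
theorem ProxRegular.innerLoop_bound {θ : GAParams} {η : ℝ} (h₁ : ∀ k, θ.τ₁ k = M * η)
    (h₂ : ∀ k, θ.τ₂ k = η) (hη : 0 ≤ η) (hηL : η * (18 * L) ≤ 1) {s t : ℕ}
    {y : Q.Ω → Vec Q.n} {lam x : Q.Ω → Fin M → Vec Q.n}
    (hy : Measurable[Q.past s (t * θ.K + 1)] y) (hlam : Measurable[Q.past s (t * θ.K + 1)] lam)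
    (hx : Measurable[Q.past s (t * θ.K + 1)] x) {w : ℝ}
    (hw : ExpLE Q.Pr (fun ω => Q.primalErr ν (y ω) (lam ω) (x ω)) w) (k : ℕ) :
    (Measurable[Q.past s (t * θ.K + k + 1)] fun ω =>
      innerLoop ν θ (Q.subGrad s (y ω) ω) (lam ω) t (x ω) k) ∧
    ExpLE Q.Pr (fun ω => Q.primalErr ν (y ω) (lam ω)
      (innerLoop ν θ (Q.subGrad s (y ω) ω) (lam ω) t (x ω) k))
      ((1 - η * L / 2) ^ k * w + 2 * η * M * σ ^ 2 / L) := by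
  have hL := h.L_pos
  induction k with
  | zero =>
    refine ⟨hx, hw.trans ?_⟩
    have : 0 ≤ 2 * η * M * σ ^ 2 / L := by positivity
    simpa [innerLoop] using this
  | succ k ih =>
    obtain ⟨hm, hb⟩ := ih
    set j := t * θ.K + k + 1 with hj
    set X : Q.Ω → Fin M → Vec Q.n :=
      fun ω => innerLoop ν θ (Q.subGrad s (y ω) ω) (lam ω) t (x ω) k with hX
    have hstep : ∀ ω m, innerLoop ν θ (Q.subGrad s (y ω) ω) (lam ω) t (x ω) (k + 1) m
        = X ω m - η • (Q.clientOp ν m (X ω m) - Q.clientRhs (y ω) (lam ω) m)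
          - (η * noiseScale m) • Q.noise s j m (X ω m) ω := fun ω m =>
      innerStep_eq h₁ h₂ s (y ω) ω j k (lam ω) (X ω) m
    have hle : Q.past s (t * θ.K + 1) ≤ Q.past s j := Q.past_mono s (by omega)
    have hyj : Measurable[Q.past s j] y := hy.mono hle le_rfl
    have hlj : Measurable[Q.past s j] lam := hlam.mono hle le_rfl
    have hXm : ∀ m, Measurable[Q.past s j] fun ω => X ω m := fun m => measurable_apply hm m
    have hg : ∀ m, Measurable[Q.past s j] fun ω =>
        η • (Q.clientOp ν m (X ω m) - Q.clientRhs (y ω) (lam ω) m) := fun m =>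
      Measurable.const_smul (((h.continuous_clientOp m).measurable.comp (hXm m)).sub
        (measurable_clientRhs hyj hlj m)) η
    constructor
    · refine measurable_of_apply fun m => ?_
      have hle' : Q.past s j ≤ Q.past s (j + 1) := Q.past_mono s (by omega)
      have hnoise := Q.measurable_noise (m := m) ((hXm m).mono hle' le_rfl)
      have h3 := (((hXm m).mono hle' le_rfl).sub ((hg m).mono hle' le_rfl)).sub
        (hnoise.const_smul (η * noiseScale m))
      have he : (fun ω => innerLoop ν θ (Q.subGrad s (y ω) ω) (lam ω) t (x ω) (k + 1) m)
        = fun ω => X ω m - η • (Q.clientOp ν m (X ω m) - Q.clientRhs (y ω) (lam ω) m)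
          - (η * noiseScale m) • Q.noise s j m (X ω m) ω := funext fun ω => hstep ω m
      rw [he]
      exact h3
    · set a : Fin M → Q.Ω → Vec Q.n := fun m ω => X ω m
        - η • (Q.clientOp ν m (X ω m) - Q.clientRhs (y ω) (lam ω) m)
        - Q.clientTarget ν (y ω) (lam ω) m with ha
      have ham : ∀ m, Measurable[Q.past s j] (a m) := fun m =>
        ((hXm m).sub (hg m)).sub (h.measurable_clientTarget hyj hlj m)
      have hab : ∀ ω, ∑ m, clientWeight m * ‖a m ω‖ ^ 2
          ≤ (1 - η * L / 2) * Q.primalErr ν (y ω) (lam ω) (X ω) := by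
        intro ω
        unfold primalErr
        rw [Finset.mul_sum]
        refine Finset.sum_le_sum fun m _ => ?_
        have h3 := forward_step_norm_sq_le hη
          (h.clientOp_monotone m (X ω m) (Q.clientTarget ν (y ω) (lam ω) m))
          (h.clientOp_lipschitz m (X ω m) (Q.clientTarget ν (y ω) (lam ω) m))
        rw [h.clientOp_target] at h3
        -- The condition η · 18L ≤ 1 says exactly that 9η²L² uses up at most half of ηL.
        have h4 : 1 - 2 * η * (L / 2) + η ^ 2 * (3 * L) ^ 2 ≤ 1 - η * L / 2 := by
          nlinarith [mul_le_mul_of_nonneg_left hηL (mul_nonneg hη hL.le)]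
        have h5 : a m ω = X ω m - Q.clientTarget ν (y ω) (lam ω) m
            - η • (Q.clientOp ν m (X ω m) - Q.clientRhs (y ω) (lam ω) m) := by
          rw [ha]; module
        rw [h5]
        have h6 := h3.trans (mul_le_mul_of_nonneg_right h4 (sq_nonneg _))
        have h7 := mul_le_mul_of_nonneg_left h6 (clientWeight_pos m).le
        linarith
      have hρ : 0 ≤ 1 - η * L / 2 := by nlinarith
      have hb' := (hb.const_mul hρ).of_le
        (f := fun ω => ∑ m, clientWeight m * ‖a m ω‖ ^ 2)
        (Finset.measurable_fun_sum _ fun m _ =>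
          ((((ham m).mono (Q.past_le s j) le_rfl).norm).pow_const 2).const_mul _)
        (fun ω => Finset.sum_nonneg fun m _ => mul_nonneg (clientWeight_pos m).le (sq_nonneg _)) hab
      have hc := Q.expLE_sum_sub_noise hXm ham clientWeight_pos hb'
        (c := fun m => η * noiseScale m)
      have he : (fun ω => Q.primalErr ν (y ω) (lam ω)
          (innerLoop ν θ (Q.subGrad s (y ω) ω) (lam ω) t (x ω) (k + 1)))
          = fun ω => ∑ m, clientWeight m
            * ‖a m ω - (η * noiseScale m) • Q.noise s j m (X ω m) ω‖ ^ 2 := by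
        funext ω
        unfold primalErr
        refine Finset.sum_congr rfl fun m _ => ?_
        rw [hstep]
        congr 3
        rw [ha]; module
      rw [he]
      refine hc.trans ?_
      have hs : ∑ m : Fin M, clientWeight m * ((η * noiseScale m) ^ 2 * σ ^ 2)
          ≤ M * (η ^ 2 * σ ^ 2) := by
        have h8 : ∀ m ∈ (Finset.univ : Finset (Fin M)),
            clientWeight m * ((η * noiseScale m) ^ 2 * σ ^ 2) ≤ η ^ 2 * σ ^ 2 := by
          intro m _
          have := mul_le_mul_of_nonneg_right (clientWeight_mul_noiseScale_sq_le m)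
            (show 0 ≤ η ^ 2 * σ ^ 2 by positivity)
          linarith
        refine (Finset.sum_le_sum h8).trans_eq ?_
        simp
      -- The noise level 2ηMσ²/L is the fixed point of the recursion.
      have h9 : (1 - η * L / 2) * (2 * η * M * σ ^ 2 / L) + M * (η ^ 2 * σ ^ 2)
          = 2 * η * M * σ ^ 2 / L := by field_simp; ring
      have h10 : (1 - η * L / 2) ^ (k + 1) * w = (1 - η * L / 2) * ((1 - η * L / 2) ^ k * w) := by
        ring
      rw [mul_add, h10]
      linarith

/-- The dual initialization makes each worker's right-hand side equal to `clientOp` at x0 plus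
noise. The initial dual error is therefore a Lipschitz multiple of the distance of x0 from the
solution, plus the variance of one sample. -/
theorem ProxRegular.initial_bound {s : ℕ} {y x0 : Q.Ω → Vec Q.n}
    (hy : Measurable[Q.past s 0] y) (hx : Measurable[Q.past s 0] x0) {B : ℝ}
    (hB : ExpLE Q.Pr (fun ω => ‖x0 ω - Q.prox (y ω)‖ ^ 2) B) :
    (Measurable[Q.past s 1] fun ω => initialDual ν (Q.subGrad s (y ω) ω) (x0 ω)) ∧
    ExpLE Q.Pr (fun ω => Q.dualErr ν (y ω) (initialDual ν (Q.subGrad s (y ω) ω) (x0 ω)))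
      (M * (9 * L ^ 2 * B + σ ^ 2)) ∧
    ExpLE Q.Pr (fun ω => Q.primalErr ν (y ω) (initialDual ν (Q.subGrad s (y ω) ω) (x0 ω))
      fun _ => x0 ω) (4 * M * B + 16 / L ^ 2 * (M * (9 * L ^ 2 * B + σ ^ 2))) := by
  have hL := h.L_pos
  have hM : (0 : ℝ) < M := by exact_mod_cast Nat.pos_of_ne_zero (NeZero.ne M)
  have hle : Q.past s 0 ≤ Q.past s 1 := Q.past_mono s zero_le_one
  have hx1 : Measurable[Q.past s 1] x0 := hx.mono hle le_rfl
  have hy1 : Measurable[Q.past s 1] y := hy.mono hle le_rfl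
  have hmeas : Measurable[Q.past s 1] fun ω => initialDual ν (Q.subGrad s (y ω) ω) (x0 ω) := by
    refine measurable_of_apply fun m => ?_
    have h1 : Measurable[Q.past s 1] fun ω => gradient (Q.F m) (x0 ω) :=
      (Q.continuous_gradient m).measurable.comp hx1
    have h2 : Measurable[Q.past s 1] fun ω => Q.noise s 0 m (x0 ω) ω := Q.measurable_noise hx1
    have h3 : Measurable[Q.past s 1] fun ω => (2 * L) • (x0 ω - y ω) :=
      (hx1.sub hy1).const_smul (2 * L)
    have h4 := (((h1.add h2).add h3).const_smul (1 / (M : ℝ))).neg.add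
      (hx1.const_smul (ν / (2 * (M : ℝ))))
    have he : (fun ω => initialDual ν (Q.subGrad s (y ω) ω) (x0 ω) m)
        = fun ω => -((1 / (M : ℝ)) • (gradient (Q.F m) (x0 ω) + Q.noise s 0 m (x0 ω) ω
          + (2 * L) • (x0 ω - y ω))) + (ν / (2 * (M : ℝ))) • x0 ω := by
      funext ω
      rw [initialDual, subGrad_eq]
    rw [he]
    exact h4
  have hdual : ExpLE Q.Pr
      (fun ω => Q.dualErr ν (y ω) (initialDual ν (Q.subGrad s (y ω) ω) (x0 ω)))
      (M * (9 * L ^ 2 * B + σ ^ 2)) := by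
    set a : Fin M → Q.Ω → Vec Q.n :=
      fun m ω => Q.clientOp ν m (x0 ω) - Q.clientOp ν m (Q.prox (y ω)) with ha
    have ham : ∀ m, Measurable[Q.past s 0] (a m) := fun m =>
      ((h.continuous_clientOp m).measurable.comp hx).sub
        ((h.continuous_clientOp m).measurable.comp (h.continuous_prox.measurable.comp hy))
    have hab : ∀ m, ExpLE Q.Pr (fun ω => ‖a m ω‖ ^ 2) (9 * L ^ 2 * B) := fun m =>
      (hB.const_mul (by positivity)).of_le
        ((((ham m).mono (Q.past_le s 0) le_rfl).norm).pow_const 2) (fun _ => sq_nonneg _)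
        fun ω => by
          refine (pow_le_pow_left₀ (norm_nonneg _) (h.clientOp_lipschitz m _ _) 2).trans_eq ?_
          ring
    have he : (fun ω => Q.dualErr ν (y ω) (initialDual ν (Q.subGrad s (y ω) ω) (x0 ω)))
        = fun ω => ∑ m ∈ Finset.univ.erase (0 : Fin M),
          ‖a m ω - (-1 : ℝ) • Q.noise s 0 m (x0 ω) ω‖ ^ 2 := by
      funext ω
      unfold dualErr
      refine Finset.sum_congr rfl fun m hm => ?_
      congr 2
      simp only [ha, clientRhs, if_neg (Finset.ne_of_mem_erase hm), initialDual, subGrad_eq,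
        clientOp]
      match_scalars <;> field_simp <;> ring
    rw [he]
    refine (ExpLE.sum fun m _ => Q.expLE_sub_noise (m := m) hx (ham m) (-1) (hab m)).trans ?_
    rw [Finset.sum_const, nsmul_eq_mul]
    have hB0 : 0 ≤ B := hB.nonneg fun _ => sq_nonneg _
    refine (mul_le_mul_of_nonneg_right card_erase_zero_le (by positivity)).trans_eq ?_
    ring
  refine ⟨hmeas, hdual, ?_⟩
  refine ((hB.const_mul (show (0 : ℝ) ≤ 4 * M by positivity)).add
    (hdual.const_mul (show (0 : ℝ) ≤ 16 / L ^ 2 by positivity))).of_le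
    (h.measurable_primalErr (hy.mono (Q.past_le s 0) le_rfl) (hmeas.mono (Q.past_le s 1) le_rfl)
      (measurable_of_apply fun _ => hx.mono (Q.past_le s 0) le_rfl))
    (fun ω => Q.primalErr_nonneg ν _ _ _) fun ω => ?_
  set lam := initialDual ν (Q.subGrad s (y ω) ω) (x0 ω)
  have h1 := h.sum_target_sub_prox_le (y ω) lam
  have h2 : Q.primalErr ν (y ω) lam (fun _ => x0 ω)
      ≤ 2 * ((∑ m : Fin M, clientWeight m) * ‖x0 ω - Q.prox (y ω)‖ ^ 2)
        + 2 * ∑ m, clientWeight m * ‖Q.clientTarget ν (y ω) lam m - Q.prox (y ω)‖ ^ 2 := by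
    unfold primalErr
    rw [Finset.sum_mul, Finset.mul_sum, Finset.mul_sum, ← Finset.sum_add_distrib]
    refine Finset.sum_le_sum fun m _ => ?_
    rw [← sub_sub_sub_cancel_right (x0 ω) _ (Q.prox (y ω))]
    have := mul_le_mul_of_nonneg_left (norm_sub_sq_le_two (x0 ω - Q.prox (y ω))
      (Q.clientTarget ν (y ω) lam m - Q.prox (y ω))) (clientWeight_pos m).le
    linarith
  have h3 := mul_le_mul_of_nonneg_right (sum_clientWeight_le (M := M))
    (sq_nonneg ‖x0 ω - Q.prox (y ω)‖)
  have h4 : 16 / L ^ 2 * Q.dualErr ν (y ω) lam = 2 * (8 / L ^ 2 * Q.dualErr ν (y ω) lam) := by ring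
  rw [h4]
  linarith

/-- Dual and primal errors are combined in one Lyapunov quantity. The weight 1/18432 = 1/(64·288)
makes the primal restart cost 64/L² consume only 1/288 of the dual contraction 1/144. The index `t *
K + 1` counts the initialization sample and the K samples of each completed round. -/
theorem ProxRegular.outerLoop_bound {θ : GAParams} {η : ℝ} (h₁ : ∀ k, θ.τ₁ k = M * η)
    (h₂ : ∀ k, θ.τ₂ k = η) (h₃ : θ.τ₃ = L / (4 * M)) (hη : 0 ≤ η) (hηL : η * (18 * L) ≤ 1)
    (hK : (1 - η * L / 2) ^ θ.K ≤ 1 / 737280) {s : ℕ} {y x0 : Q.Ω → Vec Q.n}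
    (hy : Measurable[Q.past s 0] y) (hx : Measurable[Q.past s 0] x0) {B : ℝ}
    (hB : ExpLE Q.Pr (fun ω => ‖x0 ω - Q.prox (y ω)‖ ^ 2) B) (t : ℕ) :
    (Measurable[Q.past s (t * θ.K + 1)] fun ω =>
      (outerLoop ν θ (Q.subGrad s (y ω) ω) (x0 ω) t).1) ∧
    (Measurable[Q.past s (t * θ.K + 1)] fun ω =>
      (outerLoop ν θ (Q.subGrad s (y ω) ω) (x0 ω) t).2) ∧
    ∃ d w : ℝ,
      ExpLE Q.Pr (fun ω => Q.dualErr ν (y ω)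
        (outerLoop ν θ (Q.subGrad s (y ω) ω) (x0 ω) t).2) d ∧
      ExpLE Q.Pr (fun ω => Q.primalErr ν (y ω)
        (outerLoop ν θ (Q.subGrad s (y ω) ω) (x0 ω) t).2
        (outerLoop ν θ (Q.subGrad s (y ω) ω) (x0 ω) t).1) w ∧
      d / L ^ 2 + w / 18432 ≤ (287 / 288) ^ t * (M * (19 * B + 2 * σ ^ 2 / L ^ 2))
        + 5760 * (2 * η * M * σ ^ 2 / L) := by
  have hL := h.L_pos
  have hM : (0 : ℝ) < M := by exact_mod_cast Nat.pos_of_ne_zero (NeZero.ne M)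
  have hB0 : 0 ≤ B := hB.nonneg fun _ => sq_nonneg _
  induction t with
  | zero =>
    obtain ⟨hm, hd, hp⟩ := h.initial_bound hy hx hB
    rw [show 0 * θ.K + 1 = 1 by simp]
    simp only [outerLoop]
    refine ⟨measurable_of_apply fun _ => hx.mono (Q.past_mono s zero_le_one) le_rfl, hm, _, _, hd,
      hp, ?_⟩
    have h1 : M * (9 * L ^ 2 * B + σ ^ 2) / L ^ 2
        + (4 * M * B + 16 / L ^ 2 * (M * (9 * L ^ 2 * B + σ ^ 2))) / 18432
        = M * ((9 + 4 / 18432 + 16 * 9 / 18432) * B + (1 + 16 / 18432) * (σ ^ 2 / L ^ 2)) := by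
      field_simp
      ring
    have h2 : 0 ≤ 5760 * (2 * η * M * σ ^ 2 / L) := by positivity
    have h3 : (9 + 4 / 18432 + 16 * 9 / 18432) * B + (1 + 16 / 18432) * (σ ^ 2 / L ^ 2)
        ≤ 19 * B + 2 * σ ^ 2 / L ^ 2 := by
      have : 0 ≤ σ ^ 2 / L ^ 2 := by positivity
      have h4 : 2 * σ ^ 2 / L ^ 2 = 2 * (σ ^ 2 / L ^ 2) := by ring
      rw [h4]
      linarith
    rw [h1, pow_zero, one_mul]
    linarith [mul_le_mul_of_nonneg_left h3 hM.le]
  | succ t ih =>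
    obtain ⟨hm1, hm2, d, w, hd, hw, hdw⟩ := ih
    set lam : Q.Ω → Fin M → Vec Q.n :=
      fun ω => (outerLoop ν θ (Q.subGrad s (y ω) ω) (x0 ω) t).2 with hlam
    set x : Q.Ω → Fin M → Vec Q.n :=
      fun ω => (outerLoop ν θ (Q.subGrad s (y ω) ω) (x0 ω) t).1 with hxd
    have hyt : Measurable[Q.past s (t * θ.K + 1)] y := hy.mono (Q.past_mono s (Nat.zero_le _)) le_rfl
    obtain ⟨hXm, hXb⟩ := h.innerLoop_bound h₁ h₂ hη hηL hyt hm2 hm1 hw θ.K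
    set X : Q.Ω → Fin M → Vec Q.n :=
      fun ω => innerLoop ν θ (Q.subGrad s (y ω) ω) (lam ω) t (x ω) θ.K with hX
    have hidx : t * θ.K + θ.K + 1 = (t + 1) * θ.K + 1 := by ring
    rw [hidx] at hXm
    set lam' : Q.Ω → Fin M → Vec Q.n :=
      fun ω m => lam ω m + (L / (4 * M)) • (X ω m - X ω 0) with hlam'
    have hle : Q.past s (t * θ.K + 1) ≤ Q.past s ((t + 1) * θ.K + 1) :=
      Q.past_mono s (by rw [← hidx]; omega)
    have hlm' : Measurable[Q.past s ((t + 1) * θ.K + 1)] lam' :=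
      measurable_of_apply fun m => ((measurable_apply hm2 m).mono hle le_rfl).add
        (((measurable_apply hXm m).sub (measurable_apply hXm 0)).const_smul (L / (4 * (M : ℝ))))
    have hout : ∀ ω, outerLoop ν θ (Q.subGrad s (y ω) ω) (x0 ω) (t + 1) = (X ω, lam' ω) := by
      intro ω
      simp only [outerLoop, h₃, hlam', hX, hlam, hxd]
    simp only [hout]
    have hmy : Measurable y := hy.mono (Q.past_le s 0) le_rfl
    have hml : Measurable lam' := hlm'.mono (Q.past_le s _) le_rfl
    have hmX : Measurable X := hXm.mono (Q.past_le s _) le_rfl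
    refine ⟨hXm, hlm', _, _,
      ((hd.const_mul (show (0 : ℝ) ≤ 143 / 144 by norm_num)).add
        (hXb.const_mul (show (0 : ℝ) ≤ 19 * L ^ 2 by positivity))).of_le
        (h.measurable_dualErr hmy hml) (fun ω => Q.dualErr_nonneg ν _ _)
        (fun ω => h.dualErr_step (y ω) (lam ω) (X ω)),
      ((hd.const_mul (show (0 : ℝ) ≤ 64 / L ^ 2 by positivity)).add
        (hXb.const_mul (show (0 : ℝ) ≤ 610 by norm_num))).of_le
        (h.measurable_primalErr hmy hml hmX) (fun ω => Q.primalErr_nonneg ν _ _ _)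
        (fun ω => h.primalErr_step (y ω) (lam ω) (X ω)), ?_⟩
    have hw0 : 0 ≤ w := hw.nonneg fun ω => Q.primalErr_nonneg ν _ _ _
    set N := 2 * η * M * σ ^ 2 / L with hN
    have hN0 : 0 ≤ N := by positivity
    set f := (1 - η * L / 2) ^ θ.K * w + N with hf
    -- As 737280 = 40·18432 and the coefficient of f below is at most 20, the old primal error is at
    -- least halved.
    have hfle : f ≤ 1 / 737280 * w + N := by
      have := mul_le_mul_of_nonneg_right hK hw0
      linarith
    -- The noise enters with coefficient at most 20, and 20/(1 - 287/288) = 5760 is the constant in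
    -- the stationary term.
    have h4 : (143 / 144 * d + 19 * L ^ 2 * f) / L ^ 2 + (64 / L ^ 2 * d + 610 * f) / 18432
        = 287 / 288 * (d / L ^ 2) + (19 + 610 / 18432) * f := by
      field_simp
      ring
    rw [h4, pow_succ' (287 / 288 : ℝ), mul_assoc (287 / 288 : ℝ)]
    linarith

/-- The expected squared distance of the output of GA-MSGD to the solution of the subproblem. -/
theorem ProxRegular.gaMSGD_bound {θ : GAParams} {η : ℝ} (h₁ : ∀ k, θ.τ₁ k = M * η)
    (h₂ : ∀ k, θ.τ₂ k = η) (h₃ : θ.τ₃ = L / (4 * M)) (hη : 0 ≤ η) (hηL : η * (18 * L) ≤ 1)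
    (hK : (1 - η * L / 2) ^ θ.K ≤ 1 / 737280) {s : ℕ} {y x0 : Q.Ω → Vec Q.n}
    (hy : Measurable[Q.past s 0] y) (hx : Measurable[Q.past s 0] x0) {B : ℝ}
    (hB : ExpLE Q.Pr (fun ω => ‖x0 ω - Q.prox (y ω)‖ ^ 2) B) :
    (Measurable[Q.past (s + 1) 0] fun ω => gaMSGD ν θ (Q.subGrad s (y ω) ω) (x0 ω)) ∧
    ExpLE Q.Pr (fun ω => ‖gaMSGD ν θ (Q.subGrad s (y ω) ω) (x0 ω) - Q.prox (y ω)‖ ^ 2)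
      (36864 * ((287 / 288) ^ (θ.T + 1) * (19 * B + 2 * σ ^ 2 / L ^ 2)
        + 11520 * (η * σ ^ 2 / L))) := by
  have hL := h.L_pos
  have hM : (0 : ℝ) < M := by exact_mod_cast Nat.pos_of_ne_zero (NeZero.ne M)
  obtain ⟨hm1, -, d, w, hd, hw, hdw⟩ := h.outerLoop_bound h₁ h₂ h₃ hη hηL hK hy hx hB (θ.T + 1)
  have hm : Measurable[Q.past (s + 1) 0] fun ω => gaMSGD ν θ (Q.subGrad s (y ω) ω) (x0 ω) := by
    have h4 : Measurable[Q.past (s + 1) 0] fun ω =>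
        ∑ m, (outerLoop ν θ (Q.subGrad s (y ω) ω) (x0 ω) (θ.T + 1)).1 m :=
      Finset.measurable_fun_sum _ fun m _ =>
        (measurable_apply hm1 m).mono (Q.past_le_succ s _ 0) le_rfl
    exact h4.const_smul (1 / (M : ℝ))
  refine ⟨hm, ?_⟩
  refine (((hw.add (hd.const_mul (show 0 ≤ 8 / L ^ 2 by positivity))).const_mul
    (show 0 ≤ 2 / (M : ℝ) by positivity)).of_le
    (((hm.mono (Q.past_le _ _) le_rfl).sub (h.continuous_prox.measurable.comp
      (hy.mono (Q.past_le _ _) le_rfl))).norm.pow_const 2) (fun _ => sq_nonneg _)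
    fun ω => h.norm_average_sub_prox_le (y ω) _ _).trans ?_
  have hd0 : 0 ≤ d := hd.nonneg fun ω => Q.dualErr_nonneg ν _ _
  have h5 : w + 8 / L ^ 2 * d ≤ 18432 * (d / L ^ 2 + w / 18432) := by
    have : 0 ≤ d / L ^ 2 := by positivity
    have h6 : 8 / L ^ 2 * d = 8 * (d / L ^ 2) := by ring
    rw [h6]
    linarith
  calc 2 / (M : ℝ) * (w + 8 / L ^ 2 * d)
      ≤ 2 / (M : ℝ) * (18432 * ((287 / 288) ^ (θ.T + 1) * (M * (19 * B + 2 * σ ^ 2 / L ^ 2))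
        + 5760 * (2 * η * M * σ ^ 2 / L))) := by
        gcongr
        linarith
    _ = _ := by field_simp; ring

end StochasticProblem

/-! ### The parameters of GA-MSGD -/

theorem one_le_logFactor {r : ℝ} (hr : 0 ≤ r) : 1 ≤ logFactor r := by
  rw [logFactor, Real.le_log_iff_exp_le (by positivity)]
  linarith

/-- The inverse relative step size for the accuracy `a`. -/
def stepRatio (L σ a : ℝ) : ℝ := 18 + 1274019840 * (σ ^ 2 / (L * a))

theorem le_stepRatio {L a : ℝ} (hL : 0 < L) (ha : 0 < a) (σ : ℝ) : 18 ≤ stepRatio L σ a := by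
  have : 0 ≤ σ ^ 2 / (L * a) := by positivity
  unfold stepRatio
  linarith

/-- The parameters of GA-MSGD for the accuracy `a`, when the initial error and the variance are at
most `r` in relation to `a`. -/
def gaParams (M : ℕ) [NeZero M] {L a : ℝ} (hL : 0 < L) (ha : 0 < a) (σ r : ℝ) : GAParams where
  T := ⌈288 * Real.log (2101248 * (Real.exp 1 + r))⌉₊
  K := ⌈28 * stepRatio L σ a⌉₊
  τ₁ := fun _ => M * (1 / (L * stepRatio L σ a))
  τ₂ := fun _ => 1 / (L * stepRatio L σ a)
  τ₃ := L / (4 * M)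
  τ₁_pos := fun _ => by
    have hM : (0 : ℝ) < M := by exact_mod_cast Nat.pos_of_ne_zero (NeZero.ne M)
    have := le_stepRatio hL ha σ
    positivity
  τ₂_pos := fun _ => by
    have := le_stepRatio hL ha σ
    positivity
  τ₃_pos := by
    have hM : (0 : ℝ) < M := by exact_mod_cast Nat.pos_of_ne_zero (NeZero.ne M)
    positivity

/-! ### Costs and contraction factors for the chosen parameters -/

section Cost

variable (M : ℕ) [NeZero M] {L a : ℝ} (hL : 0 < L) (ha : 0 < a) (σ : ℝ) {r : ℝ}

theorem gaParams_rounds_le (hr : 0 ≤ r) :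
    ((gaParams M hL ha σ r).rounds : ℝ) ≤ 5000 * logFactor r := by
  have h1 := one_le_logFactor hr
  have h2 : Real.log (2101248 * (Real.exp 1 + r)) ≤ 15 + logFactor r := by
    rw [Real.log_mul (by norm_num) (by positivity), logFactor]
    have h3 : Real.log 2101248 ≤ 15 := by
      rw [Real.log_le_iff_le_exp (by norm_num), show (15 : ℝ) = (15 : ℕ) * 1 by norm_num,
        Real.exp_nat_mul]
      refine le_trans ?_ (pow_le_pow_left₀ (by norm_num) Real.exp_one_gt_d9.le 15)
      norm_num
    linarith
  have h4 : 0 ≤ 288 * Real.log (2101248 * (Real.exp 1 + r)) := by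
    refine mul_nonneg (by norm_num) (Real.log_nonneg ?_)
    have := Real.add_one_le_exp (1 : ℝ)
    linarith
  have h5 := (Nat.ceil_lt_add_one h4).le
  simp only [GAParams.rounds, gaParams]
  push_cast
  linarith

theorem gaParams_samples_le (hr : 0 ≤ r) :
    ((gaParams M hL ha σ r).samples : ℝ)
      ≤ 2 * 10 ^ 14 * (1 + σ ^ 2 / (L * a)) * logFactor r := by
  have h1 := one_le_logFactor hr
  have h2 := gaParams_rounds_le M hL ha σ hr
  have h3 := le_stepRatio hL ha σ
  have hv : 0 ≤ σ ^ 2 / (L * a) := by positivity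
  have h4 : ((gaParams M hL ha σ r).K : ℝ) ≤ 28 * stepRatio L σ a + 1 :=
    (Nat.ceil_lt_add_one (by positivity)).le
  have h5 : (1 : ℝ) ≤ (gaParams M hL ha σ r).K :=
    le_trans (by linarith) (Nat.le_ceil (28 * stepRatio L σ a))
  have h6 : 28 * stepRatio L σ a + 1 ≤ 4 * 10 ^ 10 * (1 + σ ^ 2 / (L * a)) := by
    unfold stepRatio
    linarith
  have h7 : ((gaParams M hL ha σ r).samples : ℝ)
      ≤ (gaParams M hL ha σ r).rounds * (gaParams M hL ha σ r).K := by
    simp only [GAParams.samples, GAParams.rounds]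
    push_cast
    linarith
  refine h7.trans ((mul_le_mul h2 (h4.trans h6) (by positivity) (by positivity)).trans_eq ?_)
  ring

/-- K ≥ 28J steps with factor 1 - 1/(2J) give at most e^{-14}, which is below the threshold required
by `outerLoop_bound`. -/
theorem gaParams_contraction :
    (1 - 1 / (L * stepRatio L σ a) * L / 2) ^ (gaParams M hL ha σ r).K ≤ 1 / 737280 := by
  have h3 := le_stepRatio hL ha σ
  set J := stepRatio L σ a with hJ
  have h1 : 1 - 1 / (L * J) * L / 2 = 1 - 1 / (2 * J) := by field_simp
  have h2 : 0 ≤ 1 - 1 / (2 * J) := by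
    rw [sub_nonneg, div_le_one (by positivity)]
    linarith
  have h4 : 28 * J ≤ (gaParams M hL ha σ r).K := Nat.le_ceil _
  rw [h1]
  calc (1 - 1 / (2 * J)) ^ (gaParams M hL ha σ r).K
      ≤ (Real.exp (-(1 / (2 * J)))) ^ (gaParams M hL ha σ r).K :=
        pow_le_pow_left₀ h2 (Real.one_sub_le_exp_neg _) _
    _ = Real.exp (-((gaParams M hL ha σ r).K * (1 / (2 * J)))) := by
        rw [← Real.exp_nat_mul, mul_neg]
    _ ≤ Real.exp (-14) := by
        refine Real.exp_le_exp.2 (neg_le_neg ?_)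
        rw [mul_one_div, le_div_iff₀ (by positivity)]
        linarith
    _ ≤ 1 / 737280 := by
        rw [Real.exp_neg, one_div]
        refine inv_anti₀ (by norm_num) ?_
        rw [show (14 : ℝ) = (14 : ℕ) * 1 by norm_num, Real.exp_nat_mul]
        refine le_trans ?_ (pow_le_pow_left₀ (by norm_num) Real.exp_one_gt_d9.le 14)
        norm_num

theorem gaParams_outer_contraction (hr : 0 ≤ r) :
    (287 / 288 : ℝ) ^ ((gaParams M hL ha σ r).T + 1) * (2101248 * r) ≤ 1 := by
  have hpos : 0 < 2101248 * (Real.exp 1 + r) := by positivity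
  have h1 : 288 * Real.log (2101248 * (Real.exp 1 + r)) ≤ (gaParams M hL ha σ r).T := Nat.le_ceil _
  have h2 : (287 / 288 : ℝ) ^ ((gaParams M hL ha σ r).T + 1)
      ≤ (2101248 * (Real.exp 1 + r))⁻¹ := by
    calc (287 / 288 : ℝ) ^ ((gaParams M hL ha σ r).T + 1)
        ≤ (Real.exp (-(1 / 288))) ^ ((gaParams M hL ha σ r).T + 1) := by
          refine pow_le_pow_left₀ (by norm_num) ?_ _
          have := Real.one_sub_le_exp_neg (1 / 288 : ℝ)
          linarith
      _ = Real.exp (-(((gaParams M hL ha σ r).T + 1 : ℕ) * (1 / 288 : ℝ))) := by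
          rw [← Real.exp_nat_mul, mul_neg]
      _ ≤ Real.exp (-Real.log (2101248 * (Real.exp 1 + r))) := by
          refine Real.exp_le_exp.2 (neg_le_neg ?_)
          push_cast
          linarith
      _ = _ := by rw [Real.exp_neg, Real.exp_log hpos]
  refine (mul_le_mul_of_nonneg_right h2 (by positivity)).trans ?_
  rw [inv_mul_le_iff₀ hpos]
  linarith [Real.exp_pos 1]

end Cost

/-! ### The subproblems -/

namespace StochasticProblem

variable {M : ℕ} {L σ : ℝ} [NeZero M] {Q : StochasticProblem M L σ} {ν : ℝ}

/-- The subproblem is 3L-smooth and its gradient vanishes at the proximal point; completing the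
square around that point removes the linear terms. -/
theorem subObj_sub_prox_le (h : Q.ProxRegular ν) (y x : Vec Q.n) :
    Q.subObj y x - Q.subObj y (Q.prox y) ≤ 3 / 2 * L * ‖x - Q.prox y‖ ^ 2 := by
  have h1 := quadratic_upper_bound Q.differentiable_obj Q.smooth_obj x (Q.prox y)
  rw [h.gradient_prox, real_inner_smul_left] at h1
  have h2 : ‖x - y‖ ^ 2 = ‖x - Q.prox y‖ ^ 2 - 2 * ⟪y - Q.prox y, x - Q.prox y⟫
      + ‖Q.prox y - y‖ ^ 2 := by
    rw [← sub_sub_sub_cancel_right x y (Q.prox y), norm_sub_sq_real, real_inner_comm,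
      norm_sub_rev y]
  unfold subObj
  rw [h2]
  linarith

theorem le_subObj_sub_prox (h : Q.ProxRegular ν) (y x : Vec Q.n) :
    ν / 2 * ‖x - Q.prox y‖ ^ 2 ≤ Q.subObj y x - Q.subObj y (Q.prox y) := by
  have h1 := quadratic_lower_bound Q.differentiable_obj h.monotone_obj x (Q.prox y)
  rw [h.gradient_prox, real_inner_smul_left] at h1
  have h2 : ‖x - y‖ ^ 2 = ‖x - Q.prox y‖ ^ 2 - 2 * ⟪y - Q.prox y, x - Q.prox y⟫
      + ‖Q.prox y - y‖ ^ 2 := by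
    rw [← sub_sub_sub_cancel_right x y (Q.prox y), norm_sub_sq_real, real_inner_comm,
      norm_sub_rev y]
  unfold subObj
  rw [h2]
  linarith

theorem subObj_prox_le (h : Q.ProxRegular ν) (y x : Vec Q.n) :
    Q.subObj y (Q.prox y) ≤ Q.subObj y x := by
  have h1 := le_subObj_sub_prox h y x
  have h2 : 0 ≤ ν := h.L_pos.le.trans h.le_modulus
  have : 0 ≤ ν / 2 * ‖x - Q.prox y‖ ^ 2 := by positivity
  linarith

theorem iInf_subObj (h : Q.ProxRegular ν) (y : Vec Q.n) :
    ⨅ z, Q.subObj y z = Q.subObj y (Q.prox y) :=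
  le_antisymm (ciInf_le ⟨Q.subObj y (Q.prox y), by rintro _ ⟨z, rfl⟩; exact subObj_prox_le h y z⟩ _)
    (le_ciInf fun z => subObj_prox_le h y z)

variable (Q) in
omit [NeZero M] in
theorem continuous_obj : Continuous Q.obj := Q.differentiable_obj.continuous

omit [NeZero M] in
theorem measurable_subObj {Ω : Type*} {mΩ : MeasurableSpace Ω} {y x : Ω → Vec Q.n}
    (hy : Measurable y) (hx : Measurable x) : Measurable fun ω => Q.subObj (y ω) (x ω) :=
  (Q.continuous_obj.measurable.comp hx).add (((hx.sub hy).norm.pow_const 2).const_mul L)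

/-- GA-MSGD solves the subproblems to the prescribed accuracy. -/
theorem gaMSGD_solves (h : Q.ProxRegular ν) {a r : ℝ} (hL : 0 < L) (ha : 0 < a) {s : ℕ}
    {y x0 : Q.Ω → Vec Q.n} (hy : Measurable[Q.past s 0] y) (hx : Measurable[Q.past s 0] x0) {B : ℝ}
    (hB : ExpLE Q.Pr (fun ω => ‖x0 ω - Q.prox (y ω)‖ ^ 2) B)
    (hr : L * B / a + σ ^ 2 / (L * a) ≤ r) :
    (Measurable[Q.past (s + 1) 0] fun ω =>
      gaMSGD ν (gaParams M hL ha σ r) (Q.subGrad s (y ω) ω) (x0 ω)) ∧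
    ExpLE Q.Pr (fun ω => Q.subObj (y ω)
        (gaMSGD ν (gaParams M hL ha σ r) (Q.subGrad s (y ω) ω) (x0 ω))
      - Q.subObj (y ω) (Q.prox (y ω))) a := by
  have h3 := le_stepRatio hL ha σ
  have hB0 : 0 ≤ B := hB.nonneg fun _ => sq_nonneg _
  set J := stepRatio L σ a with hJ
  obtain ⟨hm, hb⟩ := h.gaMSGD_bound (θ := gaParams M hL ha σ r) (η := 1 / (L * J))
    (fun _ => rfl) (fun _ => rfl) rfl (by positivity)
    (by rw [one_div, inv_mul_le_iff₀ (by positivity)]; nlinarith)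
    (gaParams_contraction M hL ha σ) hy hx hB
  refine ⟨hm, ?_⟩
  have hy' : Measurable y := hy.mono (Q.past_le _ _) le_rfl
  refine ((hb.const_mul (show 0 ≤ 3 / 2 * L by positivity)).of_le
    ((measurable_subObj hy' (hm.mono (Q.past_le _ _) le_rfl)).sub
      (measurable_subObj hy' (h.continuous_prox.measurable.comp hy')))
    (fun ω => sub_nonneg.2 (subObj_prox_le h _ _))
    (fun ω => subObj_sub_prox_le h _ _)).trans ?_
  have hr0 : 0 ≤ r := le_trans (by positivity) hr
  set A := (287 / 288 : ℝ) ^ ((gaParams M hL ha σ r).T + 1) with hA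
  have hA0 : 0 ≤ A := by positivity
  have h4 : A * (2101248 * r) ≤ 1 := gaParams_outer_contraction M hL ha σ hr0
  -- The bias takes half of the accuracy: 2101248 = 2·(3/2)·36864·19 is the factor inside the
  -- logarithm that defines T.
  have h5 : 3 / 2 * L * (36864 * (A * (19 * B + 2 * σ ^ 2 / L ^ 2))) ≤ a / 2 := by
    have h6 : L * (19 * B + 2 * σ ^ 2 / L ^ 2) ≤ 19 * (a * r) := by
      have h7 := mul_le_mul_of_nonneg_left hr ha.le
      have h8 : a * (L * B / a + σ ^ 2 / (L * a)) = L * B + σ ^ 2 / L := by field_simp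
      have h9 : L * (19 * B + 2 * σ ^ 2 / L ^ 2) = 19 * (L * B) + 2 * (σ ^ 2 / L) := by field_simp
      have h10 : 0 ≤ σ ^ 2 / L := by positivity
      linarith
    have h11 := mul_le_mul_of_nonneg_left h6 hA0
    have h12 := mul_le_mul_of_nonneg_left h4 ha.le
    linarith
  -- The noise takes the other half: 1274019840 = 2·(3/2)·36864·11520 is the constant in
  -- `stepRatio`.
  have h6 : 3 / 2 * L * (36864 * (11520 * (1 / (L * J) * σ ^ 2 / L))) ≤ a / 2 := by
    have h7 : 1274019840 * σ ^ 2 ≤ L * a * J := by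
      have h8 : L * a * J = 18 * (L * a) + 1274019840 * σ ^ 2 := by
        rw [hJ, stepRatio]; field_simp
      have : 0 < L * a := by positivity
      linarith
    have h8 : 3 / 2 * L * (36864 * (11520 * (1 / (L * J) * σ ^ 2 / L)))
        = 637009920 * σ ^ 2 / (L * J) := by field_simp; ring
    rw [h8, div_le_iff₀ (by positivity)]
    linarith
  linarith

/-! ### The iterates of Catalyst -/

variable (Q) (sch : Scheme) (θ : ℕ → GAParams) (x0 : Vec Q.n)

theorem catX_zero (ω : Q.Ω) : Q.catX sch θ x0 0 ω = x0 := rfl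

theorem catY_one (ω : Q.Ω) : Q.catY sch θ x0 1 ω = x0 := rfl

theorem catY_add_two (s : ℕ) (ω : Q.Ω) :
    Q.catY sch θ x0 (s + 2) ω = Q.catX sch θ x0 (s + 1) ω
      + sch.β (s + 1) • (Q.catX sch θ x0 (s + 1) ω - Q.catX sch θ x0 s ω) := rfl

theorem catX_succ (s : ℕ) (ω : Q.Ω) :
    Q.catX sch θ x0 (s + 1) ω = gaMSGD sch.ν (θ (s + 1))
      (Q.subGrad (s + 1) (Q.catY sch θ x0 (s + 1) ω) ω)
      (Q.catX sch θ x0 s ω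
        + sch.c • (Q.catY sch θ x0 (s + 1) ω - Q.catY sch θ x0 s ω)) := rfl

theorem subGap_eq (h : Q.ProxRegular ν) (s : ℕ) (ω : Q.Ω) :
    Q.subGap sch θ x0 s ω = Q.subObj (Q.catY sch θ x0 s ω) (Q.catX sch θ x0 s ω)
      - Q.subObj (Q.catY sch θ x0 s ω) (Q.prox (Q.catY sch θ x0 s ω)) := by
  rw [subGap, iInf_subObj h]

theorem subGap_nonneg (h : Q.ProxRegular ν) (s : ℕ) (ω : Q.Ω) : 0 ≤ Q.subGap sch θ x0 s ω := by
  rw [subGap_eq Q sch θ x0 h]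
  exact sub_nonneg.2 (subObj_prox_le h _ _)

end StochasticProblem

namespace StochasticProblem

variable {M : ℕ} {L σ : ℝ} [NeZero M] {Q : StochasticProblem M L σ} {ν : ℝ}

/-! ### Inexact proximal steps -/

/-- For the exact minimizer p this is strong convexity of the subproblem. Young's inequality
replaces ‖z - p‖² by (1 - θ)‖z - x‖² minus ‖x - p‖²/θ, and (ν/2)‖x - p‖² is at most the gap at x. -/
theorem inexact_prox_le (h : Q.ProxRegular ν) (y x z : Vec Q.n) {θ : ℝ} (hθ : 0 < θ) :
    Q.obj x + (1 - θ) * (ν / 2) * ‖z - x‖ ^ 2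
      ≤ Q.obj z + L * ‖z - y‖ ^ 2
        + (1 + 1 / θ) * (Q.subObj y x - Q.subObj y (Q.prox y)) := by
  have hν : 0 ≤ ν := h.L_pos.le.trans h.le_modulus
  set p := Q.prox y with hp
  have h1 := le_subObj_sub_prox h y z
  have h2 := le_subObj_sub_prox h y x
  rw [← hp] at h1 h2
  have h3 : (1 - θ) * ‖z - x‖ ^ 2 - 1 / θ * ‖x - p‖ ^ 2 ≤ ‖z - p‖ ^ 2 := by
    rw [← sub_add_sub_cancel z x p, norm_add_sq_real]
    have h4 := (abs_le.1 (abs_real_inner_le_norm (z - x) (x - p))).1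
    have h5 : 2 * (‖z - x‖ * ‖x - p‖) ≤ θ * ‖z - x‖ ^ 2 + 1 / θ * ‖x - p‖ ^ 2 := by
      have h6 : θ * ‖z - x‖ ^ 2 + 1 / θ * ‖x - p‖ ^ 2 - 2 * (‖z - x‖ * ‖x - p‖)
          = 1 / θ * (θ * ‖z - x‖ - ‖x - p‖) ^ 2 := by field_simp; ring
      have : 0 ≤ 1 / θ * (θ * ‖z - x‖ - ‖x - p‖) ^ 2 := by positivity
      linarith
    nlinarith [sq_nonneg ‖x - p‖]
  have h7 := mul_le_mul_of_nonneg_left h3 (half_pos (h.L_pos.trans_le h.le_modulus)).le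
  have h8 := mul_le_mul_of_nonneg_left h2 (one_div_pos.2 hθ).le
  have h9 : 0 ≤ L * ‖x - y‖ ^ 2 := mul_nonneg h.L_pos.le (sq_nonneg _)
  have h10 : Q.subObj y z = Q.obj z + L * ‖z - y‖ ^ 2 := rfl
  have h11 : Q.subObj y x = Q.obj x + L * ‖x - y‖ ^ 2 := rfl
  rw [h10] at h1
  have h12 : (1 + 1 / θ) * (Q.subObj y x - Q.subObj y p)
      = Q.obj x + L * ‖x - y‖ ^ 2 - Q.subObj y p
        + 1 / θ * (Q.subObj y x - Q.subObj y p) := by rw [← h11]; ring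
  rw [h12]
  linarith

theorem obj_convexCombination_le (h : Q.ProxRegular ν) (u w : Vec Q.n) {α : ℝ} (h0 : 0 ≤ α)
    (h1 : α ≤ 1) :
    Q.obj (α • u + (1 - α) • w) ≤ α * Q.obj u + (1 - α) * Q.obj w
      - (ν - 2 * L) / 2 * (α * (1 - α)) * ‖u - w‖ ^ 2 := by
  set z := α • u + (1 - α) • w with hz
  have hu := quadratic_lower_bound Q.differentiable_obj h.monotone_obj u z
  have hw := quadratic_lower_bound Q.differentiable_obj h.monotone_obj w z
  have e1 : u - z = (1 - α) • (u - w) := by rw [hz]; module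
  have e2 : w - z = (-α) • (u - w) := by rw [hz]; module
  rw [e1, inner_smul_right, norm_smul, mul_pow, Real.norm_eq_abs, sq_abs] at hu
  rw [e2, inner_smul_right, norm_smul, mul_pow, Real.norm_eq_abs, sq_abs] at hw
  have h2 := mul_le_mul_of_nonneg_left hu h0
  have h3 := mul_le_mul_of_nonneg_left hw (sub_nonneg.2 h1)
  linarith

/-- One step of Catalyst for strongly convex functions. -/
theorem strongly_convex_step (h : Q.ProxRegular ν) {α θ : ℝ} (hα : 0 < α) (hα1 : α ≤ 1)
    (hαν : α ^ 2 * ν = ν - 2 * L) (hθ : 0 < θ) {x' v' y x v xs : Vec Q.n}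
    (hy : (1 + α) • y = x' + α • v') (hx : x = α • v + (1 - α) • x') :
    Q.obj x - Q.obj xs + (1 - θ) * ((ν - 2 * L) / 2) * ‖v - xs‖ ^ 2
      ≤ (1 - α) * (Q.obj x' - Q.obj xs + (ν - 2 * L) / 2 * ‖v' - xs‖ ^ 2)
        + (1 + 1 / θ) * (Q.subObj y x - Q.subObj y (Q.prox y)) := by
  -- Testing at this point makes z - x a multiple of v - xs and relates z - y to v' - xs, so the
  -- estimate closes in terms of v.
  set z := α • xs + (1 - α) • x' with hz
  have h1 := inexact_prox_le h y x z hθ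
  have h2 := obj_convexCombination_le h xs x' hα.le hα1
  rw [← hz] at h2
  have e1 : z - x = (-α) • (v - xs) := by rw [hz, hx]; module
  have e2 : (1 + α) • (z - y) = (-α) • ((v' - xs) + (-α) • (xs - x')) := by
    rw [smul_sub, hy, hz]; module
  have h3 : (1 + α) ^ 2 * ‖z - y‖ ^ 2
      ≤ α ^ 2 * ((1 + α) * (‖v' - xs‖ ^ 2 + α * ‖xs - x'‖ ^ 2)) := by
    have h4 := congrArg (fun u => ‖u‖ ^ 2) e2
    simp only [norm_smul, mul_pow, Real.norm_eq_abs, sq_abs, neg_sq] at h4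
    rw [h4]
    refine mul_le_mul_of_nonneg_left ?_ (sq_nonneg α)
    have h5 := pow_le_pow_left₀ (norm_nonneg _) (norm_add_le (v' - xs) ((-α) • (xs - x'))) 2
    rw [norm_smul, Real.norm_eq_abs, abs_neg, abs_of_pos hα] at h5
    refine h5.trans ?_
    nlinarith [mul_nonneg hα.le (sq_nonneg (‖v' - xs‖ - ‖xs - x'‖))]
  have h4 : (1 + α) * ‖z - y‖ ^ 2 ≤ α ^ 2 * (‖v' - xs‖ ^ 2 + α * ‖xs - x'‖ ^ 2) := by
    refine le_of_mul_le_mul_left ?_ (show 0 < 1 + α by linarith)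
    linarith
  have hLν : L = (1 - α) * (1 + α) * ν / 2 := by linarith
  have hν : 0 < ν := h.L_pos.trans_le h.le_modulus
  -- Here 2L = (1 - α²)ν enters. The term in ‖xs - x'‖² is cancelled exactly by the strong convexity
  -- gain in `h2`.
  have h5 : L * ‖z - y‖ ^ 2
      ≤ (1 - α) * ((ν - 2 * L) / 2) * (‖v' - xs‖ ^ 2 + α * ‖xs - x'‖ ^ 2) := by
    have h6 := mul_le_mul_of_nonneg_left h4
      (show 0 ≤ (1 - α) * ν / 2 by have := sub_nonneg.2 hα1; positivity)
    rw [← hαν]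
    calc L * ‖z - y‖ ^ 2 = (1 - α) * ν / 2 * ((1 + α) * ‖z - y‖ ^ 2) := by
          linear_combination ‖z - y‖ ^ 2 * hLν
      _ ≤ _ := h6
      _ = _ := by ring
  have h6 : (1 - θ) * (ν / 2) * ‖z - x‖ ^ 2 = (1 - θ) * ((ν - 2 * L) / 2) * ‖v - xs‖ ^ 2 := by
    rw [e1, norm_smul, mul_pow, Real.norm_eq_abs, sq_abs, neg_sq, ← hαν]; ring
  rw [h6] at h1
  linarith

/-- One step of Catalyst for convex functions. -/
theorem convex_step (h : Q.ProxRegular (2 * L)) {α θ : ℝ} (hα : 0 < α) (hα1 : α ≤ 1)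
    (hθ : 0 < θ) {x' v' y x v xs : Vec Q.n}
    (hy : y = α • v' + (1 - α) • x') (hx : x = α • v + (1 - α) • x') :
    Q.obj x - Q.obj xs + (1 - θ) * (L * α ^ 2) * ‖v - xs‖ ^ 2
      ≤ (1 - α) * (Q.obj x' - Q.obj xs) + L * α ^ 2 * ‖v' - xs‖ ^ 2
        + (1 + 1 / θ) * (Q.subObj y x - Q.subObj y (Q.prox y)) := by
  set z := α • xs + (1 - α) • x' with hz
  have h1 := inexact_prox_le h y x z hθ
  have h2 := obj_convexCombination_le h xs x' hα.le hα1
  rw [← hz] at h2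
  have e1 : z - x = (-α) • (v - xs) := by rw [hz, hx]; module
  have e2 : z - y = (-α) • (v' - xs) := by rw [hz, hy]; module
  rw [e1, e2, norm_smul, norm_smul, mul_pow, mul_pow, Real.norm_eq_abs, sq_abs, neg_sq] at h1
  linarith

/-! ### The run of Catalyst -/

theorem prox_eq_self (h : Q.ProxRegular ν) {xs : Vec Q.n} (hxs : gradient Q.obj xs = 0) :
    Q.prox xs = xs := by
  have h1 := h.proxOp_prox xs
  have h2 : Q.proxOp xs = (2 * L) • xs := by rw [proxOp, hxs, zero_add]
  have h3 := h.proxOp_monotone (Q.prox xs) xs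
  rw [h1, h2, sub_self, inner_zero_left] at h3
  have hν : 0 < ν := h.L_pos.trans_le h.le_modulus
  have h4 : ‖Q.prox xs - xs‖ ^ 2 = 0 :=
    le_antisymm (by by_contra hc; push Not at hc; nlinarith [mul_pos hν hc]) (sq_nonneg _)
  exact sub_eq_zero.1 (norm_eq_zero.1 (pow_eq_zero_iff two_ne_zero |>.1 h4))

theorem norm_prox_sub_sq_le (h : Q.ProxRegular ν) {xs : Vec Q.n} (hxs : gradient Q.obj xs = 0)
    (y : Vec Q.n) : ‖Q.prox y - xs‖ ^ 2 ≤ 4 * ‖y - xs‖ ^ 2 := by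
  have h1 := h.norm_prox_sub_le y xs
  rw [prox_eq_self h hxs] at h1
  refine (pow_le_pow_left₀ (norm_nonneg _) h1 2).trans_eq ?_
  ring

theorem norm_extrapolation_sq_le {n : ℕ} {b : ℝ} (h0 : 0 ≤ b) (h1 : b ≤ 1) (x x' xs : Vec n) :
    ‖x + b • (x - x') - xs‖ ^ 2 ≤ 8 * ‖x - xs‖ ^ 2 + 2 * ‖x' - xs‖ ^ 2 := by
  have e : x + b • (x - x') - xs = (1 + b) • (x - xs) - b • (x' - xs) := by module
  rw [e]
  refine (norm_sub_sq_le_two _ _).trans ?_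
  rw [norm_smul, norm_smul, mul_pow, mul_pow, Real.norm_eq_abs, sq_abs, Real.norm_eq_abs, sq_abs]
  have h2 : (1 + b) ^ 2 ≤ 4 := by nlinarith
  have h3 : b ^ 2 ≤ 1 := by nlinarith
  nlinarith [mul_le_mul_of_nonneg_right h2 (sq_nonneg ‖x - xs‖),
    mul_le_mul_of_nonneg_right h3 (sq_nonneg ‖x' - xs‖)]

/-- A deliberately crude bound: from c only 0 ≤ c ≤ 1 is needed, because the initial error of a call
affects its cost logarithmically. -/
theorem norm_start_sub_prox_sq_le (h : Q.ProxRegular ν) {xs : Vec Q.n}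
    (hxs : gradient Q.obj xs = 0) {c : ℝ} (h0 : 0 ≤ c) (h1 : c ≤ 1) (x y y' : Vec Q.n) :
    ‖x + c • (y - y') - Q.prox y‖ ^ 2
      ≤ 4 * ‖x - xs‖ ^ 2 + 20 * ‖y - xs‖ ^ 2 + 4 * ‖y' - xs‖ ^ 2 := by
  have e : x + c • (y - y') - Q.prox y
      = ((x - xs) + c • (y - xs)) - (c • (y' - xs) + (Q.prox y - xs)) := by module
  rw [e]
  have h2 := norm_sub_sq_le_two ((x - xs) + c • (y - xs)) (c • (y' - xs) + (Q.prox y - xs))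
  have h3 := norm_add_sq_le_two (x - xs) (c • (y - xs))
  have h4 := norm_add_sq_le_two (c • (y' - xs)) (Q.prox y - xs)
  rw [norm_smul, mul_pow, Real.norm_eq_abs, sq_abs] at h3 h4
  have h5 : c ^ 2 ≤ 1 := by nlinarith
  have h6 := norm_prox_sub_sq_le h hxs y
  have h7 := mul_le_mul_of_nonneg_right h5 (sq_nonneg ‖y - xs‖)
  have h8 := mul_le_mul_of_nonneg_right h5 (sq_nonneg ‖y' - xs‖)
  linarith

variable (Q) (sch : Scheme) (θ : ℕ → GAParams) (x0 : Vec Q.n)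

/-- The iterates that enter step `s + 1` depend on the samples of the first `s` calls only. -/
def Adapted (s : ℕ) : Prop :=
  Measurable[Q.past (s + 1) 0] (Q.catX sch θ x0 s) ∧
  Measurable[Q.past (s + 1) 0] (Q.catY sch θ x0 (s + 1)) ∧
  Measurable[Q.past (s + 1) 0] (Q.catY sch θ x0 s)

variable {Q sch θ x0}

theorem adapted_zero : Q.Adapted sch θ x0 0 :=
  ⟨measurable_const, measurable_const, measurable_const⟩

theorem Adapted.measurable_catX {s : ℕ} (hs : Q.Adapted sch θ x0 s) :
    Measurable (Q.catX sch θ x0 s) := hs.1.mono (Q.past_le _ _) le_rfl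

theorem Adapted.measurable_catY {s : ℕ} (hs : Q.Adapted sch θ x0 s) :
    Measurable (Q.catY sch θ x0 s) := hs.2.2.mono (Q.past_le _ _) le_rfl

theorem Adapted.measurable_catY_succ {s : ℕ} (hs : Q.Adapted sch θ x0 s) :
    Measurable (Q.catY sch θ x0 (s + 1)) := hs.2.1.mono (Q.past_le _ _) le_rfl

theorem catalyst_step (h : Q.ProxRegular sch.ν) {a r : ℝ} (hL : 0 < L) (ha : 0 < a) {s : ℕ}
    (hθ : θ (s + 1) = gaParams M hL ha σ r) (hs : Q.Adapted sch θ x0 s) {B : ℝ}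
    (hB : ExpLE Q.Pr (fun ω => ‖Q.catX sch θ x0 s ω
      + sch.c • (Q.catY sch θ x0 (s + 1) ω - Q.catY sch θ x0 s ω)
      - Q.prox (Q.catY sch θ x0 (s + 1) ω)‖ ^ 2) B)
    (hr : L * B / a + σ ^ 2 / (L * a) ≤ r) :
    Q.Adapted sch θ x0 (s + 1) ∧ ExpLE Q.Pr (Q.subGap sch θ x0 (s + 1)) a := by
  obtain ⟨hX, hY, hY'⟩ := hs
  have hstart : Measurable[Q.past (s + 1) 0] fun ω => Q.catX sch θ x0 s ω
      + sch.c • (Q.catY sch θ x0 (s + 1) ω - Q.catY sch θ x0 s ω) :=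
    hX.add ((hY.sub hY').const_smul sch.c)
  obtain ⟨hm, hb⟩ := gaMSGD_solves h hL ha hY hstart hB hr
  rw [← hθ] at hm hb
  have hle : Q.past (s + 1) 0 ≤ Q.past (s + 1 + 1) 0 := Q.past_le_succ _ _ _
  have hm' : Measurable[Q.past (s + 1 + 1) 0] (Q.catX sch θ x0 (s + 1)) := hm
  refine ⟨⟨hm', ?_, hY.mono hle le_rfl⟩, ?_⟩
  · exact hm'.add ((hm'.sub (hX.mono hle le_rfl)).const_smul (sch.β (s + 1)))
  · have he : Q.subGap sch θ x0 (s + 1) = fun ω => Q.subObj (Q.catY sch θ x0 (s + 1) ω)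
        (gaMSGD sch.ν (θ (s + 1)) (Q.subGrad (s + 1) (Q.catY sch θ x0 (s + 1) ω) ω)
          (Q.catX sch θ x0 s ω
            + sch.c • (Q.catY sch θ x0 (s + 1) ω - Q.catY sch θ x0 s ω)))
        - Q.subObj (Q.catY sch θ x0 (s + 1) ω) (Q.prox (Q.catY sch θ x0 (s + 1) ω)) := by
      funext ω
      rw [subGap_eq Q sch θ x0 h, catX_succ]
    rw [he]
    exact hb

/-- The accelerated runs: a Lyapunov bound `P` and a bound on the second moments of the iterates
are propagated from step to step. -/
theorem accelerated_run (h : Q.ProxRegular sch.ν) (hL : 0 < L) {acc : ℕ → ℝ} (hacc : ∀ s, 0 < acc s)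
    {r : ℝ} (hθ : ∀ s, θ s = gaParams M hL (hacc s) σ r) (hc0 : 0 ≤ sch.c) (hc1 : sch.c ≤ 1)
    (hβ : ∀ s, 0 ≤ sch.β (s + 1) ∧ sch.β (s + 1) ≤ 1) {S : ℕ} {xs : Vec Q.n}
    (hxs : gradient Q.obj xs = 0) {B : ℝ} (hx0 : ‖x0 - xs‖ ^ 2 ≤ B)
    (hr : ∀ s < S, L * (244 * B) / acc (s + 1) + σ ^ 2 / (L * acc (s + 1)) ≤ r)
    {P : ℕ → Prop} (hP0 : P 0)
    (hP : ∀ s < S, Q.Adapted sch θ x0 s → Q.Adapted sch θ x0 (s + 1) → P s →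
      ExpLE Q.Pr (fun ω => ‖Q.catX sch θ x0 s ω - xs‖ ^ 2) B →
      ExpLE Q.Pr (Q.subGap sch θ x0 (s + 1)) (acc (s + 1)) →
      P (s + 1) ∧ ExpLE Q.Pr (fun ω => ‖Q.catX sch θ x0 (s + 1) ω - xs‖ ^ 2) B) :
    (∀ s ≤ S, Q.Adapted sch θ x0 s ∧ P s) ∧
    ∀ s < S, ExpLE Q.Pr (Q.subGap sch θ x0 (s + 1)) (acc (s + 1)) := by
  have hB0 : 0 ≤ B := (sq_nonneg _).trans hx0
  have key : ∀ s ≤ S, (Q.Adapted sch θ x0 s ∧ P s) ∧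
      ExpLE Q.Pr (fun ω => ‖Q.catX sch θ x0 s ω - xs‖ ^ 2) B ∧
      ExpLE Q.Pr (fun ω => ‖Q.catY sch θ x0 (s + 1) ω - xs‖ ^ 2) (10 * B) ∧
      ExpLE Q.Pr (fun ω => ‖Q.catY sch θ x0 s ω - xs‖ ^ 2) (10 * B) ∧
      (s < S → ExpLE Q.Pr (Q.subGap sch θ x0 (s + 1)) (acc (s + 1)) ∧
        Q.Adapted sch θ x0 (s + 1)) := by
    have next : ∀ s, Q.Adapted sch θ x0 s →
        ExpLE Q.Pr (fun ω => ‖Q.catX sch θ x0 s ω - xs‖ ^ 2) B →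
        ExpLE Q.Pr (fun ω => ‖Q.catY sch θ x0 (s + 1) ω - xs‖ ^ 2) (10 * B) →
        ExpLE Q.Pr (fun ω => ‖Q.catY sch θ x0 s ω - xs‖ ^ 2) (10 * B) →
        s < S → ExpLE Q.Pr (Q.subGap sch θ x0 (s + 1)) (acc (s + 1)) ∧
          Q.Adapted sch θ x0 (s + 1) := by
      intro s hA hX hY hY' hs
      -- 244 = 4 + 20·10 + 4·10, from second moments B for x and 10B for both proximal centers.
      have hstart : ExpLE Q.Pr (fun ω => ‖Q.catX sch θ x0 s ω
          + sch.c • (Q.catY sch θ x0 (s + 1) ω - Q.catY sch θ x0 s ω)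
          - Q.prox (Q.catY sch θ x0 (s + 1) ω)‖ ^ 2) (244 * B) := by
        refine ((((hX.const_mul (show (0 : ℝ) ≤ 4 by norm_num)).add
          (hY.const_mul (show (0 : ℝ) ≤ 20 by norm_num))).add
          (hY'.const_mul (show (0 : ℝ) ≤ 4 by norm_num))).of_le ?_ (fun _ => sq_nonneg _)
          (fun ω => norm_start_sub_prox_sq_le h hxs hc0 hc1 _ _ _)).trans (by linarith)
        exact (((hA.measurable_catX.add
          ((hA.measurable_catY_succ.sub hA.measurable_catY).const_smul sch.c)).sub
          (h.continuous_prox.measurable.comp hA.measurable_catY_succ)).norm).pow_const 2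
      exact (catalyst_step h hL (hacc (s + 1)) (hθ (s + 1)) hA hstart (hr s hs)).symm
    intro s
    induction s with
    | zero =>
      intro _
      have h1 : ExpLE Q.Pr (fun _ => ‖x0 - xs‖ ^ 2) B := (ExpLE.const _).trans hx0
      have h2 := h1.trans (show B ≤ 10 * B by linarith)
      exact ⟨⟨adapted_zero, hP0⟩, h1, h2, h2, next 0 adapted_zero h1 h2 h2⟩
    | succ s ih =>
      intro hs
      obtain ⟨⟨hA, hPs⟩, hX, hY, hY', hn⟩ := ih (by omega)
      obtain ⟨hgap, hA'⟩ := hn (by omega)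
      obtain ⟨hP', hX'⟩ := hP s (by omega) hA hA' hPs hX hgap
      -- Extrapolation with momentum in [0, 1] costs 8 + 2 = 10.
      have hY2 : ExpLE Q.Pr (fun ω => ‖Q.catY sch θ x0 (s + 1 + 1) ω - xs‖ ^ 2) (10 * B) :=
        (((hX'.const_mul (show (0 : ℝ) ≤ 8 by norm_num)).add
          (hX.const_mul (show (0 : ℝ) ≤ 2 by norm_num))).of_le
          ((hA'.measurable_catY_succ.sub_const xs).norm.pow_const 2) (fun _ => sq_nonneg _)
          (fun ω => by
            rw [catY_add_two]
            exact norm_extrapolation_sq_le (hβ s).1 (hβ s).2 _ _ _)).trans (by linarith)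
      exact ⟨⟨hA', hP'⟩, hX', hY2, hY, next (s + 1) hA' hX' hY2 hY⟩
  exact ⟨fun s hs => (key s hs).1, fun s hs => ((key s hs.le).2.2.2.2 hs).1⟩

theorem meetsCriterion_of_expLE {acc : ℕ → ℝ} {S : ℕ}
    (hg : ∀ s < S, ExpLE Q.Pr (Q.subGap sch θ x0 (s + 1)) (acc (s + 1))) :
    Q.MeetsCriterion sch S θ x0 acc := by
  intro s hs
  obtain ⟨h1, h2⟩ := Finset.mem_Icc.1 hs
  obtain ⟨s, rfl⟩ := Nat.exists_eq_add_of_le' h1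
  exact hg s h2

end StochasticProblem

/-! ### Costs -/

/-- Polynomial bounds on the ratio `r` are enough for the hidden logarithms; this is why the
estimates of `r` in the three cases can be wasteful. -/
theorem logFactor_le_of_le_poly {r X c : ℝ} (hr : 0 ≤ r) (hX : 0 ≤ X) (hc : 0 ≤ c) {k : ℕ}
    (h : r ≤ c * (1 + X) ^ k) : logFactor r ≤ (Real.log (1 + c) + (k + 1)) * logFactor X := by
  have he : 1 ≤ Real.exp 1 := Real.one_le_exp zero_le_one
  have h1 : 1 + X ≤ Real.exp 1 + X := by linarith
  have h2 : 1 ≤ Real.exp 1 + X := by linarith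
  have h3 : Real.exp 1 + r ≤ (1 + c) * (Real.exp 1 + X) ^ (k + 1) := by
    have h4 : (1 + X) ^ k ≤ (Real.exp 1 + X) ^ (k + 1) :=
      (pow_le_pow_left₀ (by linarith) h1 k).trans (pow_le_pow_right₀ h2 (Nat.le_succ k))
    have h5 : Real.exp 1 + X ≤ (Real.exp 1 + X) ^ (k + 1) := le_self_pow₀ h2 (Nat.succ_ne_zero k)
    have h6 := mul_le_mul_of_nonneg_left h4 hc
    linarith
  have h7 : logFactor r ≤ Real.log (1 + c) + (k + 1) * logFactor X := by
    refine (Real.log_le_log (by positivity) h3).trans_eq ?_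
    rw [Real.log_mul (by positivity) (by positivity), Real.log_pow, logFactor]
    push_cast
    ring
  have h8 := mul_le_mul_of_nonneg_left (one_le_logFactor hX)
    (Real.log_nonneg (by linarith : 1 ≤ 1 + c))
  linarith

section Cost

variable {M : ℕ} [NeZero M] {L σ r : ℝ} (hL : 0 < L) {acc : ℕ → ℝ} (hacc : ∀ s, 0 < acc s)
  {θ : ℕ → GAParams} (hθ : ∀ s, θ s = gaParams M hL (hacc s) σ r) (hr : 0 ≤ r) {S : ℕ}
include hθ hr

theorem commRounds_le : (commRounds S θ : ℝ) ≤ S * (5000 * logFactor r) := by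
  unfold commRounds
  push_cast
  refine (Finset.sum_le_card_nsmul _ _ (5000 * logFactor r) fun s _ => ?_).trans_eq ?_
  · rw [hθ]; exact gaParams_rounds_le M hL (hacc s) σ hr
  · simp

theorem sampleCount_le {V : ℝ} (hV : ∀ s, 1 ≤ s → s ≤ S → σ ^ 2 / (L * acc s) ≤ V) :
    (sampleCount S θ : ℝ) ≤ S * (2 * 10 ^ 14 * (1 + V) * logFactor r) := by
  have h1 := one_le_logFactor hr
  unfold sampleCount
  push_cast
  refine (Finset.sum_le_card_nsmul _ _ (2 * 10 ^ 14 * (1 + V) * logFactor r) fun s hs => ?_).trans_eq ?_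
  · rw [hθ]
    obtain ⟨h2, h3⟩ := Finset.mem_Icc.1 hs
    refine (gaParams_samples_le M hL (hacc s) σ hr).trans ?_
    gcongr
    exact hV s h2 h3
  · simp

end Cost

namespace StochasticProblem

variable {M : ℕ} {L σ : ℝ} [NeZero M] {Q : StochasticProblem M L σ}

omit [NeZero M] in
theorem optVal_le (hb : BddBelow (Set.range Q.obj)) (x : Vec Q.n) : Q.optVal ≤ Q.obj x :=
  ciInf_le hb x

/-! ### The nonconvex case -/

omit [NeZero M] in
theorem proxRegular_nonconvex (hL : 0 < L) : Q.ProxRegular L where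
  L_pos := hL
  le_modulus := le_rfl
  modulus_le := by linarith
  monotone := fun m x y => by
    have := monotone_of_lipschitz (Q.smooth m) x y
    rwa [show L - 2 * L = -L by ring]

/-- The gradient of F is the gradient of the subproblem, which vanishes at the proximal point and is
3L-Lipschitz, minus 2L(x - y). Strong convexity bounds the first part by the gap. -/
theorem gradient_obj_sq_le (h : Q.ProxRegular L) (y x : Vec Q.n) :
    ‖gradient Q.obj x‖ ^ 2
      ≤ 36 * L * (Q.subObj y x - Q.subObj y (Q.prox y)) + 8 * L ^ 2 * ‖x - y‖ ^ 2 := by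
  have hL := h.L_pos
  have e : gradient Q.obj x = (Q.proxOp x - Q.proxOp (Q.prox y)) - (2 * L) • (x - y) := by
    rw [h.proxOp_prox, proxOp]; module
  have h1 := norm_sub_sq_le_two (Q.proxOp x - Q.proxOp (Q.prox y)) ((2 * L) • (x - y))
  rw [← e, norm_smul, mul_pow, Real.norm_eq_abs, sq_abs] at h1
  have h2 := pow_le_pow_left₀ (norm_nonneg _) (h.proxOp_lipschitz x (Q.prox y)) 2
  have h3 := mul_le_mul_of_nonneg_left (le_subObj_sub_prox h y x)
    (show 0 ≤ 36 * L by positivity)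
  nlinarith

/-- Without momentum the center is the previous iterate, so each step decreases F by L times the
squared step, up to the gap. With total error S·Δ/S = Δ the expected suboptimality stays below 2Δ,
which also bounds the starting error of every call. -/
theorem nonconvex_run (hL : 0 < L) {S : ℕ} {Δ r : ℝ} (hΔ : 0 < Δ)
    (hS : 0 < S) {acc : ℕ → ℝ} (hacc : ∀ s, 0 < acc s) (hacc' : ∀ s, acc s = Δ / S)
    {θ : ℕ → GAParams} (hθ : ∀ s, θ s = gaParams M hL (hacc s) σ r)
    (hr : 8 * S + σ ^ 2 / (L * (Δ / S)) ≤ r) {x0 : Vec Q.n} (hb : BddBelow (Set.range Q.obj))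
    (hx0 : Q.obj x0 - Q.optVal ≤ Δ) :
    (∀ s < S, ExpLE Q.Pr (Q.subGap (nonconvexScheme L) θ x0 (s + 1)) (acc (s + 1))) ∧
    ExpLE Q.Pr (fun ω => ∑ s ∈ Finset.Icc 1 S,
      ‖gradient Q.obj (Q.catX (nonconvexScheme L) θ x0 s ω)‖ ^ 2) (52 * L * Δ) ∧
    ∀ s ≤ S, Measurable (Q.catX (nonconvexScheme L) θ x0 s) := by
  have h : Q.ProxRegular L := proxRegular_nonconvex hL
  have hSR : (0 : ℝ) < S := by exact_mod_cast hS
  set sch := nonconvexScheme L with hsch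
  have h' : Q.ProxRegular sch.ν := h
  have hY : ∀ s ω, Q.catY sch θ x0 (s + 1) ω = Q.catX sch θ x0 s ω := by
    intro s ω
    cases s with
    | zero => rfl
    | succ s => rw [catY_add_two]; simp [hsch, nonconvexScheme]
  have hgap : ∀ s ω, Q.obj (Q.catX sch θ x0 (s + 1) ω)
      + L * ‖Q.catX sch θ x0 (s + 1) ω - Q.catX sch θ x0 s ω‖ ^ 2
      ≤ Q.obj (Q.catX sch θ x0 s ω) + Q.subGap sch θ x0 (s + 1) ω := by
    intro s ω
    rw [subGap_eq Q sch θ x0 h', hY]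
    have h1 := subObj_prox_le h (Q.catX sch θ x0 s ω) (Q.catX sch θ x0 s ω)
    have h2 : Q.subObj (Q.catX sch θ x0 s ω) (Q.catX sch θ x0 s ω)
        = Q.obj (Q.catX sch θ x0 s ω) := by simp [subObj]
    rw [h2] at h1
    have h3 : Q.subObj (Q.catX sch θ x0 s ω) (Q.catX sch θ x0 (s + 1) ω)
      = Q.obj (Q.catX sch θ x0 (s + 1) ω)
        + L * ‖Q.catX sch θ x0 (s + 1) ω - Q.catX sch θ x0 s ω‖ ^ 2 := rfl
    linarith
  -- At x = y the subproblem value is F(x), and its minimum is at least F*; strong convexity with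
  -- modulus L turns the difference into a distance.
  have hstart : ∀ s ω, ‖Q.catX sch θ x0 s ω
      + sch.c • (Q.catY sch θ x0 (s + 1) ω - Q.catY sch θ x0 s ω)
      - Q.prox (Q.catY sch θ x0 (s + 1) ω)‖ ^ 2
      ≤ 2 / L * (Q.obj (Q.catX sch θ x0 s ω) - Q.optVal) := by
    intro s ω
    rw [hY, show sch.c = 0 from rfl, zero_smul, add_zero]
    set x := Q.catX sch θ x0 s ω
    have h1 := le_subObj_sub_prox h x x
    have h2 : Q.subObj x x = Q.obj x := by simp [subObj]
    have h3 : Q.optVal ≤ Q.subObj x (Q.prox x) :=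
      (optVal_le hb _).trans (le_add_of_nonneg_right (by positivity))
    rw [div_mul_eq_mul_div, le_div_iff₀ hL]
    linarith
  have key : ∀ s ≤ S, Q.Adapted sch θ x0 s ∧
      ExpLE Q.Pr (fun ω => Q.obj (Q.catX sch θ x0 s ω) - Q.optVal) (Δ + s * (Δ / S)) ∧
      (s < S → Q.Adapted sch θ x0 (s + 1) ∧
        ExpLE Q.Pr (Q.subGap sch θ x0 (s + 1)) (acc (s + 1))) := by
    have next : ∀ s, Q.Adapted sch θ x0 s →
        ExpLE Q.Pr (fun ω => Q.obj (Q.catX sch θ x0 s ω) - Q.optVal) (Δ + s * (Δ / S)) →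
        s < S → Q.Adapted sch θ x0 (s + 1) ∧
          ExpLE Q.Pr (Q.subGap sch θ x0 (s + 1)) (acc (s + 1)) := by
      intro s hA hF hs
      have h1 : Δ + s * (Δ / S) ≤ 2 * Δ := by
        have h2 : (s : ℝ) ≤ S := by exact_mod_cast hs.le
        have h3 : (s : ℝ) * (Δ / S) ≤ S * (Δ / S) := by gcongr
        rw [mul_div_cancel₀ _ hSR.ne'] at h3
        linarith
      refine catalyst_step h' hL (hacc (s + 1)) (hθ (s + 1)) hA
        (((hF.trans h1).const_mul (show 0 ≤ 2 / L by positivity)).of_le ?_ (fun _ => sq_nonneg _)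
          (hstart s)) ?_
      · exact (((hA.measurable_catX.add
          ((hA.measurable_catY_succ.sub hA.measurable_catY).const_smul sch.c)).sub
          (h.continuous_prox.measurable.comp hA.measurable_catY_succ)).norm).pow_const 2
      · rw [hacc']
        refine le_trans (add_le_add_left ?_ _) hr
        refine le_of_eq_of_le (b := (4 : ℝ) * S) ?_ (by linarith)
        field_simp
        ring
    intro s
    induction s with
    | zero =>
      intro _
      have h1 : ExpLE Q.Pr (fun ω => Q.obj (Q.catX sch θ x0 0 ω) - Q.optVal)
          (Δ + (0 : ℕ) * (Δ / S)) := (ExpLE.const (Q.obj x0 - Q.optVal)).trans (by simpa using hx0)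
      exact ⟨adapted_zero, h1, next 0 adapted_zero h1⟩
    | succ s ih =>
      intro hs
      obtain ⟨hA, hF, hn⟩ := ih (by omega)
      obtain ⟨hA', hg⟩ := hn (by omega)
      have h1 : ExpLE Q.Pr (fun ω => Q.obj (Q.catX sch θ x0 (s + 1) ω) - Q.optVal)
          (Δ + (s + 1 : ℕ) * (Δ / S)) := by
        refine ((hF.add hg).of_le (f := fun ω => Q.obj (Q.catX sch θ x0 (s + 1) ω) - Q.optVal)
          ((Q.continuous_obj.measurable.comp hA'.measurable_catX).sub_const _)
          (fun ω => sub_nonneg.2 (optVal_le hb _)) fun ω => ?_).trans (le_of_eq ?_)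
        · have := hgap s ω
          have h2 : 0 ≤ L * ‖Q.catX sch θ x0 (s + 1) ω - Q.catX sch θ x0 s ω‖ ^ 2 := by positivity
          linarith
        · rw [hacc']; push_cast; ring
      exact ⟨hA', h1, next (s + 1) hA' h1⟩
  have hgaps : ∀ s < S, ExpLE Q.Pr (Q.subGap sch θ x0 (s + 1)) (acc (s + 1)) :=
    fun s hs => ((key s hs.le).2.2 hs).2
  have hmeas : ∀ s ≤ S, Measurable (Q.catX sch θ x0 s) := fun s hs => (key s hs).1.measurable_catX
  have hgradc : Continuous (gradient Q.obj) :=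
    (LipschitzWith.of_dist_le_mul (K := L.toNNReal) fun x y => by
      rw [dist_eq_norm, dist_eq_norm, Real.coe_toNNReal _ hL.le]
      exact Q.smooth_obj x y).continuous
  refine ⟨hgaps, ?_, hmeas⟩
  -- The term 8L²‖x - y‖² is 8L times the squared-step term in the descent inequality, so it
  -- telescopes at the price of 8L further gaps: 44 = 36 + 8. In expectation the total is 44LΔ + 8LΔ
  -- = 52LΔ.
  have hsum : ∀ ω, ∀ k ≤ S, ∑ s ∈ Finset.range k, ‖gradient Q.obj (Q.catX sch θ x0 (s + 1) ω)‖ ^ 2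
      ≤ 44 * L * ∑ s ∈ Finset.range k, Q.subGap sch θ x0 (s + 1) ω
        + 8 * L * (Q.obj x0 - Q.obj (Q.catX sch θ x0 k ω)) := by
    intro ω k
    induction k with
    | zero => intro _; simp [catX_zero]
    | succ k ih =>
      intro hk
      rw [Finset.sum_range_succ, Finset.sum_range_succ]
      have h1 := ih (by omega)
      have h2 := gradient_obj_sq_le h (Q.catY sch θ x0 (k + 1) ω) (Q.catX sch θ x0 (k + 1) ω)
      rw [← subGap_eq Q sch θ x0 h', hY] at h2
      have h3 := mul_le_mul_of_nonneg_left (hgap k ω) (show 0 ≤ 8 * L by positivity)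
      linarith
  have hreindex : ∀ f : ℕ → ℝ, ∑ s ∈ Finset.Icc 1 S, f s = ∑ s ∈ Finset.range S, f (s + 1) := by
    intro f
    rw [Finset.range_eq_Ico, Finset.sum_Ico_add' f 0 S 1]
    rfl
  simp only [hreindex]
  have h1 := ((ExpLE.sum (s := Finset.range S) fun s hs => hgaps s (Finset.mem_range.1 hs)).const_mul
    (show 0 ≤ 44 * L by positivity)).add (ExpLE.const (μ := Q.Pr) (8 * L * Δ))
  refine (h1.of_le
    (f := fun ω => ∑ s ∈ Finset.range S, ‖gradient Q.obj (Q.catX sch θ x0 (s + 1) ω)‖ ^ 2) (Finset.measurable_fun_sum _ fun s hs =>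
    ((hgradc.measurable.comp (hmeas (s + 1) (Finset.mem_range.1 hs))).norm.pow_const 2))
    (fun ω => Finset.sum_nonneg fun _ _ => sq_nonneg _) fun ω => ?_).trans ?_
  · have h2 := hsum ω S le_rfl
    have h3 : Q.obj x0 - Q.obj (Q.catX sch θ x0 S ω) ≤ Δ := by
      linarith [optVal_le hb (Q.catX sch θ x0 S ω)]
    have h4 := mul_le_mul_of_nonneg_left h3 (show 0 ≤ 8 * L by positivity)
    linarith
  · simp only [hacc', Finset.sum_const, Finset.card_range, nsmul_eq_mul]
    rw [mul_div_cancel₀ _ hSR.ne']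
    linarith

end StochasticProblem

theorem nonconvex_case : ∃ C : ℝ, 0 < C ∧ ∃ p : ℕ,
    ∀ (M : ℕ) [NeZero M] (L σ Δ ε : ℝ), 0 < L → 0 ≤ σ → 0 < ε → ε ^ 2 ≤ L * Δ →
    ∃ (S : ℕ) (θ : ℕ → GAParams), 1 ≤ S ∧
      (commRounds S θ : ℝ) ≤
        C * (L * Δ / ε ^ 2) * logFactor (L * Δ / ε ^ 2 + M * σ ^ 2 / ε ^ 2) ^ p ∧
      (sampleCount S θ : ℝ) ≤
        C * (L * Δ / ε ^ 2 + L * Δ * σ ^ 2 / ε ^ 4)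
          * logFactor (L * Δ / ε ^ 2 + M * σ ^ 2 / ε ^ 2) ^ p ∧
      ∀ (Q : StochasticProblem.{u, v} M L σ) (x0 : Vec Q.n),
        BddBelow (Set.range Q.obj) →
        Q.obj x0 - Q.optVal ≤ Δ →
        Q.MeetsCriterion (nonconvexScheme L) S θ x0 (fun _ => Δ / S) ∧
        (∀ s ∈ Finset.Icc 1 S,
          Integrable (fun ω => ‖gradient Q.obj (Q.catX (nonconvexScheme L) θ x0 s ω)‖ ^ 2)
            Q.Pr) ∧
        (1 / (S : ℝ)) * ∑ s ∈ Finset.Icc 1 S,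
          (∫ ω, ‖gradient Q.obj (Q.catX (nonconvexScheme L) θ x0 s ω)‖ ^ 2 ∂Q.Pr) ≤ ε ^ 2 := by
  set c := Real.log (1 + 500) + ((1 : ℕ) + 1) with hc
  have hcpos : 0 < c := by
    have := Real.log_nonneg (show (1 : ℝ) ≤ 1 + 500 by norm_num)
    rw [hc]; positivity
  refine ⟨10 ^ 20 * c, by positivity, 1, ?_⟩
  intro M _ L σ Δ ε hL hσ hε hεΔ
  have hM : (1 : ℝ) ≤ M := by exact_mod_cast Nat.pos_of_ne_zero (NeZero.ne M)
  have hε2 : 0 < ε ^ 2 := by positivity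
  have hΔ : 0 < Δ := by
    by_contra hcon
    push Not at hcon
    nlinarith
  set Y := L * Δ / ε ^ 2 with hY
  have hY1 : 1 ≤ Y := (one_le_div hε2).2 hεΔ
  set X := Y + M * σ ^ 2 / ε ^ 2 with hX
  have hv0 : 0 ≤ σ ^ 2 / ε ^ 2 := by positivity
  have hvX : σ ^ 2 / ε ^ 2 ≤ M * σ ^ 2 / ε ^ 2 := by
    rw [mul_div_assoc]
    exact le_mul_of_one_le_left hv0 hM
  have hX0 : 0 ≤ X := by linarith
  -- The sum of squared gradients is at most 52LΔ = 52Yε² in expectation, so the average over S ≥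
  -- 52Y iterates is at most ε².
  obtain ⟨S, hS⟩ : ∃ S : ℕ, S = ⌈52 * Y⌉₊ := ⟨_, rfl⟩
  have hS1 : 52 * Y ≤ S := by rw [hS]; exact Nat.le_ceil _
  have hS2 : (S : ℝ) ≤ 53 * Y := by
    have := (Nat.ceil_lt_add_one (show 0 ≤ 52 * Y by positivity)).le
    rw [← hS] at this
    linarith
  have hSR : (0 : ℝ) < S := by linarith
  have hSN : 0 < S := by exact_mod_cast hSR
  have hacc : ∀ _ : ℕ, 0 < Δ / S := fun _ => by positivity
  have hV : σ ^ 2 / (L * (Δ / S)) ≤ 53 * (σ ^ 2 / ε ^ 2) := by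
    have h1 : σ ^ 2 / (L * (Δ / S)) = σ ^ 2 * S / (L * Δ) := by field_simp
    rw [h1, div_le_iff₀ (by positivity)]
    have h2 : 53 * (σ ^ 2 / ε ^ 2) * (L * Δ) = σ ^ 2 * (53 * Y) := by rw [hY]; field_simp
    rw [h2]
    gcongr
  set r := 500 * X with hr
  have hr0 : 0 ≤ r := by positivity
  have hrS : 8 * S + σ ^ 2 / (L * (Δ / S)) ≤ r := by linarith
  have hlog : logFactor r ≤ c * logFactor X := by
    refine logFactor_le_of_le_poly hr0 hX0 (by norm_num) ?_
    rw [hr, pow_one]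
    linarith
  have hlX : 0 ≤ logFactor X := zero_le_one.trans (one_le_logFactor hX0)
  have hlr : 0 ≤ logFactor r := zero_le_one.trans (one_le_logFactor hr0)
  set θ : ℕ → GAParams := fun s => gaParams M hL (hacc s) σ r with hθ
  refine ⟨S, θ, hSN, ?_, ?_, ?_⟩
  · refine (commRounds_le hL hacc (fun _ => rfl) hr0).trans ?_
    rw [pow_one]
    calc (S : ℝ) * (5000 * logFactor r) ≤ (53 * Y) * (5000 * (c * logFactor X)) := by gcongr
      _ = 265000 * (c * Y * logFactor X) := by ring
      _ ≤ 10 ^ 20 * (c * Y * logFactor X) := by gcongr; norm_num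
      _ = _ := by ring
  · refine (sampleCount_le hL hacc (fun _ => rfl) hr0 fun _ _ _ => hV).trans ?_
    rw [pow_one]
    have h1 : L * Δ * σ ^ 2 / ε ^ 4 = Y * (σ ^ 2 / ε ^ 2) := by rw [hY]; field_simp
    rw [h1]
    calc (S : ℝ) * (2 * 10 ^ 14 * (1 + 53 * (σ ^ 2 / ε ^ 2)) * logFactor r)
        ≤ (53 * Y) * (2 * 10 ^ 14 * (53 * (1 + (σ ^ 2 / ε ^ 2))) * (c * logFactor X)) := by
          gcongr
          linarith
      _ = 5618 * 10 ^ 14 * (c * (Y + Y * (σ ^ 2 / ε ^ 2)) * logFactor X) := by ring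
      _ ≤ 10 ^ 20 * (c * (Y + Y * (σ ^ 2 / ε ^ 2)) * logFactor X) := by gcongr; norm_num
      _ = _ := by ring
  · intro Q x0 hb hx0
    obtain ⟨hg, hsum, hmeas⟩ := StochasticProblem.nonconvex_run hL hΔ hSN hacc (fun _ => rfl)
      (θ := θ) (fun _ => rfl) hrS hb hx0
    have hgradc : Continuous (gradient Q.obj) :=
      (LipschitzWith.of_dist_le_mul (K := L.toNNReal) fun x y => by
        rw [dist_eq_norm, dist_eq_norm, Real.coe_toNNReal _ hL.le]
        exact Q.smooth_obj x y).continuous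
    have hint : ∀ s ∈ Finset.Icc 1 S,
        Integrable (fun ω => ‖gradient Q.obj (Q.catX (nonconvexScheme L) θ x0 s ω)‖ ^ 2) Q.Pr :=
      fun s hs => (hsum.of_le
        ((hgradc.measurable.comp (hmeas s (Finset.mem_Icc.1 hs).2)).norm.pow_const 2)
        (fun _ => sq_nonneg _) fun ω => Finset.single_le_sum
          (f := fun s => ‖gradient Q.obj (Q.catX (nonconvexScheme L) θ x0 s ω)‖ ^ 2)
          (fun _ _ => sq_nonneg _) hs).1
    refine ⟨StochasticProblem.meetsCriterion_of_expLE hg, hint, ?_⟩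
    rw [← integral_finsetSum _ hint, one_div, inv_mul_le_iff₀ hSR]
    refine hsum.2.trans ?_
    have h1 : 52 * L * Δ = 52 * Y * ε ^ 2 := by rw [hY]; field_simp
    rw [h1]
    gcongr

namespace StochasticProblem

variable {M : ℕ} {L σ : ℝ} [NeZero M] {Q : StochasticProblem M L σ}

/-! ### The auxiliary sequence of the accelerated schemes -/

variable (Q) in
/-- The points `v^s` with `x^s = a_{s-1} v^s + (1 - a_{s-1}) x^{s-1}`. -/
def catV (sch : Scheme) (θ : ℕ → GAParams) (x0 : Vec Q.n) (a : ℕ → ℝ) : ℕ → Q.Ω → Vec Q.n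
  | 0 => fun _ => x0
  | s + 1 => fun ω => Q.catX sch θ x0 s ω
      + (1 / a s) • (Q.catX sch θ x0 (s + 1) ω - Q.catX sch θ x0 s ω)

variable {sch : Scheme} {θ : ℕ → GAParams} {x0 : Vec Q.n} {a : ℕ → ℝ}

theorem catX_succ_eq_catV (ha : ∀ s, a s ≠ 0) (s : ℕ) (ω : Q.Ω) :
    Q.catX sch θ x0 (s + 1) ω
      = a s • Q.catV sch θ x0 a (s + 1) ω + (1 - a s) • Q.catX sch θ x0 s ω := by
  have := ha s
  simp only [catV]
  match_scalars <;> field_simp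
  ring

/-- Since v - x is (1/a - 1) times the last displacement, momentum of this product form means that y
lies on the line through x and v. Both accelerated schemes have it: b = α/(1 + α) in the strongly
convex case and b = α in the convex one. -/
theorem catY_succ_eq_catV (ha : ∀ s, a s ≠ 0) {b : ℕ → ℝ}
    (hβ : ∀ s, sch.β (s + 1) = b (s + 1) * (1 / a s - 1)) (s : ℕ) (ω : Q.Ω) :
    Q.catY sch θ x0 (s + 1) ω
      = Q.catX sch θ x0 s ω + b s • (Q.catV sch θ x0 a s ω - Q.catX sch θ x0 s ω) := by
  cases s with
  | zero => simp [catY_one, catX_zero, catV]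
  | succ s =>
    have := ha s
    rw [catY_add_two, hβ]
    simp only [catV]
    module

theorem measurable_catV {s : ℕ} (hs : Measurable (Q.catX sch θ x0 s))
    (hs' : Measurable (Q.catX sch θ x0 (s + 1))) : Measurable (Q.catV sch θ x0 a (s + 1)) :=
  hs.add ((hs'.sub hs).const_smul (1 / a s))

/-! ### The strongly convex case -/

omit [NeZero M] in
theorem optVal_eq {xs : Vec Q.n} (hxs : ∀ x, Q.obj xs ≤ Q.obj x) : Q.optVal = Q.obj xs :=
  le_antisymm (ciInf_le ⟨Q.obj xs, by rintro _ ⟨x, rfl⟩; exact hxs x⟩ xs) (le_ciInf hxs)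

omit [NeZero M] in
theorem proxRegular_stronglyConvex {μ : ℝ} (hL : 0 < L) (hμ : 0 ≤ μ) (hμL : μ ≤ L)
    (hQ : ∀ m, StrongConvexOn Set.univ μ (Q.F m)) : Q.ProxRegular (μ + 2 * L) where
  L_pos := hL
  le_modulus := by linarith
  modulus_le := by linarith
  monotone := fun m x y => by
    have := StrongConvexOn.gradient_monotone (Q.differentiable m) (hQ m) x y
    rwa [add_sub_cancel_right]

end StochasticProblem

/-! ### The stationary momentum of the strongly convex scheme -/

theorem alphaSeq_sqrt {q : ℝ} (hq : 0 ≤ q) (s : ℕ) : alphaSeq q (√q) s = √q := by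
  induction s with
  | zero => rfl
  | succ s ih =>
    rw [alphaSeq, ih, nextAlpha, Real.sq_sqrt hq, sub_self]
    rw [show (0 : ℝ) ^ 2 + 4 * q = 2 ^ 2 * q by ring, Real.sqrt_mul (by norm_num),
      Real.sqrt_sq (by norm_num)]
    ring

theorem momentum_sqrt {q : ℝ} (hq : 0 < q) (s : ℕ) :
    momentum q (√q) s = (1 - √q) / (1 + √q) := by
  have h : 0 < √q := Real.sqrt_pos.2 hq
  rw [momentum, alphaSeq_sqrt hq.le, alphaSeq_sqrt hq.le]
  field_simp
  ring

namespace StochasticProblem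

variable {M : ℕ} {L σ : ℝ} [NeZero M] {Q : StochasticProblem M L σ}

/-- The Lyapunov function decays like A ρ^s with ρ = 1 - 0.9α, the rate of the accuracies. The large
prefactor A = 100Δ/α² leaves room for the gaps, which are amplified by about 20/α in every step. -/
theorem stronglyConvex_run {μ α Δ r : ℝ} (hL : 0 < L) (hμ : 0 < μ) (hμL : μ ≤ L)
    (hα : α = √(μ / (μ + 2 * L))) (hΔ : 0 < Δ) {S : ℕ} {acc : ℕ → ℝ} (hacc : ∀ s, 0 < acc s)
    (hacc' : ∀ s, acc s = 2 * (1 - 0.9 * α) ^ s * Δ / 9)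
    {θ : ℕ → GAParams} (hθ : ∀ s, θ s = gaParams M hL (hacc s) σ r)
    (hr : ∀ s < S, L * (244 * (2 / μ * (100 * Δ / α ^ 2))) / acc (s + 1)
      + σ ^ 2 / (L * acc (s + 1)) ≤ r)
    (hQ : ∀ m, StrongConvexOn Set.univ μ (Q.F m)) {x0 : Vec Q.n} (hx0 : Q.obj x0 - Q.optVal ≤ Δ) :
    (∀ s < S, ExpLE Q.Pr (Q.subGap (scScheme L μ) θ x0 (s + 1)) (acc (s + 1))) ∧
    ExpLE Q.Pr (fun ω => Q.obj (Q.catX (scScheme L μ) θ x0 S ω) - Q.optVal)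
      (100 * Δ / α ^ 2 * (1 - 0.9 * α) ^ S) := by
  have h : Q.ProxRegular (μ + 2 * L) := proxRegular_stronglyConvex hL hμ.le hμL hQ
  set sch := scScheme L μ with hsch
  have h' : Q.ProxRegular sch.ν := h
  have hq : 0 < μ / (μ + 2 * L) := by positivity
  have hα0 : 0 < α := by rw [hα]; exact Real.sqrt_pos.2 hq
  have hα2 : α ^ 2 = μ / (μ + 2 * L) := by rw [hα]; exact Real.sq_sqrt hq.le
  have hα2' : α ^ 2 ≤ 1 / 3 := by
    rw [hα2, div_le_iff₀ (by positivity)]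
    linarith
  have hα1 : α ≤ 0.6 := by
    refine le_of_sq_le_sq ?_ (by norm_num)
    norm_num
    linarith
  have hαν : α ^ 2 * (μ + 2 * L) = μ + 2 * L - 2 * L := by
    rw [hα2]; field_simp; ring
  have hβ : ∀ s, sch.β (s + 1) = (1 - α) / (1 + α) := fun s => by
    rw [hα]; exact momentum_sqrt hq (s + 1)
  obtain ⟨xs, hxs⟩ := surjective_of_strongly_monotone (H := gradient Q.obj) hμ (fun x y => by
    have := h.monotone_obj x y
    rwa [add_sub_cancel_right] at this) Q.smooth_obj 0
  have hmin : ∀ x, Q.obj xs + μ / 2 * ‖x - xs‖ ^ 2 ≤ Q.obj x := by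
    intro x
    have := quadratic_lower_bound Q.differentiable_obj h.monotone_obj x xs
    rwa [hxs, inner_zero_left, add_zero, add_sub_cancel_right] at this
  have hopt : Q.optVal = Q.obj xs :=
    optVal_eq fun x => le_trans (le_add_of_nonneg_right (by positivity)) (hmin x)
  rw [hopt] at hx0 ⊢
  set ρ := 1 - 0.9 * α with hρ
  have hρ0 : 0 < ρ := by rw [hρ]; linarith
  have hρ1 : ρ ≤ 1 := by rw [hρ]; linarith
  set A := 100 * Δ / α ^ 2 with hA
  have hAΔ : 300 * Δ ≤ A := by
    rw [hA, le_div_iff₀ (by positivity)]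
    nlinarith
  set V := Q.catV sch θ x0 (fun _ => α) with hV
  set H : ℕ → Q.Ω → ℝ := fun s ω =>
    Q.obj (Q.catX sch θ x0 s ω) - Q.obj xs + μ / 2 * ‖V s ω - xs‖ ^ 2 with hH
  have hHobj : ∀ s ω, Q.obj (Q.catX sch θ x0 s ω) - Q.obj xs ≤ H s ω := fun s ω =>
    le_add_of_nonneg_right (by positivity)
  have hobj0 : ∀ s ω, 0 ≤ Q.obj (Q.catX sch θ x0 s ω) - Q.obj xs := fun s ω => by
    have h1 := hmin (Q.catX sch θ x0 s ω)
    have : 0 ≤ μ / 2 * ‖Q.catX sch θ x0 s ω - xs‖ ^ 2 := by positivity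
    linarith
  have hH0 : ∀ s ω, 0 ≤ H s ω := fun s ω => (hobj0 s ω).trans (hHobj s ω)
  have hx0' : μ / 2 * ‖x0 - xs‖ ^ 2 ≤ Δ := by linarith [hmin x0]
  obtain ⟨hAP, hgaps⟩ := accelerated_run h' hL hacc hθ
    (show 0 ≤ 2 * L / (2 * L + μ) by positivity)
    (show 2 * L / (2 * L + μ) ≤ 1 by rw [div_le_one (by positivity)]; linarith)
    (fun s => by
      rw [hβ]
      constructor
      · exact div_nonneg (by linarith) (by linarith)
      · rw [div_le_one (by linarith)]; linarith) hxs (B := 2 / μ * A)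
    (by
      rw [div_mul_eq_mul_div, le_div_iff₀ hμ]
      linarith) hr
    (P := fun s => ExpLE Q.Pr (H s) (A * ρ ^ s))
    (by
      have h1 : H 0 = fun _ => Q.obj x0 - Q.obj xs + μ / 2 * ‖x0 - xs‖ ^ 2 := rfl
      rw [h1, pow_zero, mul_one]
      exact (ExpLE.const _).trans (by linarith))
    (by
      intro s _ hAs hAs' hPs _ hgap
      have hXm' := hAs'.measurable_catX
      have hVm : Measurable (V (s + 1)) := measurable_catV hAs.measurable_catX hXm'
      have hP' : ExpLE Q.Pr (H (s + 1)) (A * ρ ^ (s + 1)) := by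
        -- The Young parameter is α/20: it worsens the factor 1 - α only slightly, and the gap is
        -- multiplied by 1 + 20/α.
        have hθ0 : 0 < 1 - α / 20 := by linarith
        have hb := (((hPs.const_mul (show 0 ≤ 1 - α by linarith)).add
          (hgap.const_mul (show 0 ≤ 1 + 1 / (α / 20) by positivity))).const_mul
          (inv_nonneg.2 hθ0.le)).of_le (f := H (s + 1))
          (((Q.continuous_obj.measurable.comp hXm').sub_const _).add
            (((hVm.sub_const xs).norm.pow_const 2).const_mul _)) (hH0 (s + 1)) (fun ω => by
            rw [← div_eq_inv_mul, le_div_iff₀ hθ0, subGap_eq Q sch θ x0 h']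
            have hstep := strongly_convex_step h hα0 (by linarith : α ≤ 1) hαν
              (show 0 < α / 20 by positivity) (x' := Q.catX sch θ x0 s ω) (v' := V s ω)
              (y := Q.catY sch θ x0 (s + 1) ω) (x := Q.catX sch θ x0 (s + 1) ω) (v := V (s + 1) ω)
              (xs := xs) (by
                rw [catY_succ_eq_catV (a := fun _ => α) (b := fun _ => α / (1 + α))
                  (fun _ => hα0.ne') (fun s => by rw [hβ]; field_simp)]
                match_scalars <;> field_simp
                ring)
              (catX_succ_eq_catV (a := fun _ => α) (fun _ => hα0.ne') s ω)
            rw [add_sub_cancel_right] at hstep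
            have h1 := hobj0 (s + 1) ω
            have h2 := mul_nonneg (show 0 ≤ α / 20 by positivity) h1
            simp only [hH]
            linarith)
        refine hb.trans ?_
        rw [← div_eq_inv_mul, div_le_iff₀ hθ0, hacc']
        -- After this common factor is removed, a polynomial inequality in α remains. To first order
        -- it compares -100α + (40/9)α with -95α.
        have hD : 0 < Δ * ρ ^ s / α ^ 2 := by positivity
        have e1 : (1 - α) * (A * ρ ^ s) + (1 + 1 / (α / 20)) * (2 * ρ ^ (s + 1) * Δ / 9)
            = Δ * ρ ^ s / α ^ 2 * (100 * (1 - α) + (α ^ 2 + 20 * α) * (2 * ρ / 9)) := by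
          rw [hA, pow_succ]; field_simp; ring
        have e2 : A * ρ ^ (s + 1) * (1 - α / 20)
            = Δ * ρ ^ s / α ^ 2 * (100 * (1 - α / 20) * ρ) := by
          rw [hA, pow_succ]; field_simp; ring
        rw [e1, e2]
        refine mul_le_mul_of_nonneg_left ?_ hD.le
        rw [hρ]
        nlinarith [mul_pos hα0 hα0, mul_pos (mul_pos hα0 hα0) hα0]
      refine ⟨hP', ((hP'.const_mul (show 0 ≤ 2 / μ by positivity)).of_le
        ((hXm'.sub_const xs).norm.pow_const 2) (fun _ => sq_nonneg _) fun ω => ?_).trans ?_⟩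
      · rw [div_mul_eq_mul_div, le_div_iff₀ hμ]
        linarith [hmin (Q.catX sch θ x0 (s + 1) ω), hHobj (s + 1) ω]
      · refine mul_le_mul_of_nonneg_left ?_ (by positivity)
        exact mul_le_of_le_one_right (by positivity) (pow_le_one₀ hρ0.le hρ1))
  refine ⟨hgaps, ?_⟩
  obtain ⟨hAS, hPS⟩ := hAP S le_rfl
  exact hPS.of_le ((Q.continuous_obj.measurable.comp hAS.measurable_catX).sub_const _) (hobj0 S)
    (hHobj S)

end StochasticProblem

theorem stronglyConvex_case : ∃ C : ℝ, 0 < C ∧ ∃ p : ℕ,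
    ∀ (M : ℕ) [NeZero M] (L μ σ Δ ε : ℝ), 0 < μ → μ ≤ L → 0 ≤ σ → 0 < ε → ε ≤ Δ →
    ∃ (S : ℕ) (θ : ℕ → GAParams), 1 ≤ S ∧
      (commRounds S θ : ℝ) ≤
        C * √(L / μ) * logFactor (L / μ + Δ / ε + M * σ ^ 2 / (μ * ε)) ^ p ∧
      (sampleCount S θ : ℝ) ≤
        C * (√(L / μ) + √(L / μ) * σ ^ 2 / (μ * ε))
          * logFactor (L / μ + Δ / ε + M * σ ^ 2 / (μ * ε)) ^ p ∧
      ∀ (Q : StochasticProblem.{u, v} M L σ) (x0 : Vec Q.n),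
        (∀ m, StrongConvexOn Set.univ μ (Q.F m)) →
        Q.obj x0 - Q.optVal ≤ Δ →
        Q.MeetsCriterion (scScheme L μ) S θ x0
          (fun s => 2 * (1 - 0.9 * √(μ / (μ + 2 * L))) ^ s * Δ / 9) ∧
        Integrable (fun ω => Q.obj (Q.catX (scScheme L μ) θ x0 S ω)) Q.Pr ∧
        (∫ ω, Q.obj (Q.catX (scScheme L μ) θ x0 S ω) ∂Q.Pr) - Q.optVal ≤ ε := by
  set c₁ := Real.log (1 + 300) + ((2 : ℕ) + 1) with hc₁
  set c₂ := Real.log (1 + 10 ^ 9) + ((4 : ℕ) + 1) with hc₂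
  have hc₁0 : 0 < c₁ := by
    have := Real.log_nonneg (show (1 : ℝ) ≤ 1 + 300 by norm_num)
    rw [hc₁]; positivity
  have hc₂0 : 0 < c₂ := by
    have := Real.log_nonneg (show (1 : ℝ) ≤ 1 + 10 ^ 9 by norm_num)
    rw [hc₂]; positivity
  refine ⟨10 ^ 20 * ((1 + 3 * c₁) * c₂), by positivity, 2, ?_⟩
  intro M _ L μ σ Δ ε hμ hμL hσ hε hεΔ
  have hL : 0 < L := hμ.trans_le hμL
  have hΔ : 0 < Δ := hε.trans_le hεΔ
  have hM : (1 : ℝ) ≤ M := by exact_mod_cast Nat.pos_of_ne_zero (NeZero.ne M)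
  set κ := L / μ with hκ
  have hκ1 : 1 ≤ κ := (one_le_div hμ).2 hμL
  have hδ1 : 1 ≤ Δ / ε := (one_le_div hε).2 hεΔ
  set w := σ ^ 2 / (μ * ε) with hw
  have hw0 : 0 ≤ w := by positivity
  set X := κ + Δ / ε + M * σ ^ 2 / (μ * ε) with hX
  have hwX : w ≤ M * σ ^ 2 / (μ * ε) := by
    rw [hw, mul_div_assoc]
    exact le_mul_of_one_le_left hw0 hM
  have hX0 : 0 ≤ X := by linarith
  have hκX : κ ≤ 1 + X := by linarith
  have hδX : Δ / ε ≤ 1 + X := by linarith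
  have hX1 : 1 ≤ 1 + X := by linarith
  obtain ⟨α, hα⟩ : ∃ α : ℝ, α = √(μ / (μ + 2 * L)) := ⟨_, rfl⟩
  have hq : 0 < μ / (μ + 2 * L) := by positivity
  have hα0 : 0 < α := by rw [hα]; exact Real.sqrt_pos.2 hq
  have hα2 : α ^ 2 = μ / (μ + 2 * L) := by rw [hα]; exact Real.sq_sqrt hq.le
  have hα2' : α ^ 2 ≤ 1 / 3 := by
    rw [hα2, div_le_iff₀ (by positivity)]
    linarith
  have hα1 : α ≤ 0.6 := by
    refine le_of_sq_le_sq ?_ (by norm_num)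
    norm_num
    linarith
  have hακ : 1 / α ^ 2 ≤ 3 * κ := by
    rw [hα2, one_div_div, hκ, ← mul_div_assoc]
    gcongr
    linarith
  have hακ' : 1 / α ≤ 2 * √κ := by
    refine le_of_sq_le_sq ?_ (by positivity)
    rw [mul_pow, Real.sq_sqrt (by linarith), div_pow, one_pow]
    linarith
  set ρ := 1 - 0.9 * α with hρ
  have hρ0 : 0.46 ≤ ρ := by rw [hρ]; linarith
  have hρ1 : ρ < 1 := by rw [hρ]; linarith
  -- The final error 100Δ/α² · ρ^S is at most ε once ρ^S ≤ x. The exponent n is chosen with ρ^(n+1)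
  -- < x ≤ ρ^n, and S = n + 1.
  set x := ε * α ^ 2 / (100 * Δ) with hx
  have hx0 : 0 < x := by positivity
  have hx1 : x ≤ 1 := by
    rw [hx, div_le_one (by positivity)]
    nlinarith
  obtain ⟨n, hn1, hn2⟩ := exists_nat_pow_near_of_lt_one hx0 hx1 (by linarith : 0 < ρ) hρ1
  have hacc : ∀ s : ℕ, 0 < 2 * ρ ^ s * Δ / 9 := fun s => by positivity
  -- Stopping at the first sufficient power loses one factor ρ ≥ 0.46, so no accuracy in use is much
  -- smaller than εα².
  have hacclb : ∀ s ≤ n + 1, ε * α ^ 2 / 1000 ≤ 2 * ρ ^ s * Δ / 9 := by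
    intro s hs
    have h1 : 0.46 * x ≤ ρ ^ s := by
      refine le_trans ?_ (pow_le_pow_of_le_one (by linarith) hρ1.le hs)
      rw [pow_succ']
      gcongr
    have h2 : x * Δ = ε * α ^ 2 / 100 := by rw [hx]; field_simp
    have h3 := mul_le_mul_of_nonneg_right h1 hΔ.le
    have h4 : 0 < ε * α ^ 2 := by positivity
    linarith
  -- Here 1/α² ≤ 3κ turns 1/(Lεα²) into a multiple of 1/(με), the relative noise in the claim.
  have hV : ∀ s ≤ n + 1, σ ^ 2 / (L * (2 * ρ ^ s * Δ / 9)) ≤ 3000 * w := by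
    intro s hs
    calc σ ^ 2 / (L * (2 * ρ ^ s * Δ / 9)) ≤ σ ^ 2 / (L * (ε * α ^ 2 / 1000)) := by
          gcongr σ ^ 2 / (L * ?_)
          exact hacclb s hs
      _ = 1000 * (σ ^ 2 / (L * ε)) * (1 / α ^ 2) := by field_simp
      _ ≤ 1000 * (σ ^ 2 / (L * ε)) * (3 * κ) := by gcongr
      _ = 3000 * w := by rw [hw, hκ]; field_simp; ring
  set r := 10 ^ 9 * (1 + X) ^ 4 with hr
  have hr0 : 0 ≤ r := by positivity
  have hrle : ∀ s < n + 1, L * (244 * (2 / μ * (100 * Δ / α ^ 2))) / (2 * ρ ^ (s + 1) * Δ / 9)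
      + σ ^ 2 / (L * (2 * ρ ^ (s + 1) * Δ / 9)) ≤ r := by
    intro s hs
    have h1 := hV (s + 1) hs
    have h2 : L * (244 * (2 / μ * (100 * Δ / α ^ 2))) / (2 * ρ ^ (s + 1) * Δ / 9)
        ≤ 48800 * 9000 * (1 + X) ^ 4 := by
      calc L * (244 * (2 / μ * (100 * Δ / α ^ 2))) / (2 * ρ ^ (s + 1) * Δ / 9)
          ≤ L * (244 * (2 / μ * (100 * Δ / α ^ 2))) / (ε * α ^ 2 / 1000) := by
            gcongr L * (244 * (2 / μ * (100 * Δ / α ^ 2))) / ?_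
            exact hacclb (s + 1) hs
        _ = 48800 * 1000 * (κ * (1 / α ^ 2) * (1 / α ^ 2) * (Δ / ε)) := by
            rw [hκ]; field_simp; ring
        _ ≤ 48800 * 1000 * (κ * (3 * κ) * (3 * κ) * (Δ / ε)) := by gcongr
        _ = 48800 * 9000 * (κ * κ * κ * (Δ / ε)) := by ring
        _ ≤ 48800 * 9000 * ((1 + X) * (1 + X) * (1 + X) * (1 + X)) := by gcongr
        _ = _ := by ring
    have h3 : 3000 * w ≤ 3000 * (1 + X) ^ 4 := by
      have h4 : 1 + X ≤ (1 + X) ^ 4 := le_self_pow₀ hX1 (by norm_num)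
      linarith
    have h4 : 0 ≤ (1 + X) ^ 4 := by positivity
    linarith
  have hlX1 : 1 ≤ logFactor X := one_le_logFactor hX0
  have hlX : 0 ≤ logFactor X := zero_le_one.trans hlX1
  have hlr : 0 ≤ logFactor r := zero_le_one.trans (one_le_logFactor hr0)
  have hlog : logFactor r ≤ c₂ * logFactor X :=
    logFactor_le_of_le_poly hr0 hX0 (by norm_num) le_rfl
  have hxinv : logFactor (1 / x) ≤ c₁ * logFactor X := by
    refine logFactor_le_of_le_poly (by positivity) hX0 (by norm_num) ?_
    calc 1 / x = 100 * (Δ / ε) * (1 / α ^ 2) := by rw [hx]; field_simp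
      _ ≤ 100 * (1 + X) * (3 * (1 + X)) := by
          gcongr
          linarith
      _ = 300 * (1 + X) ^ 2 := by ring
  have hSle : ((n + 1 : ℕ) : ℝ) ≤ (1 + 3 * c₁) * √κ * logFactor X := by
    have h1 : x ≤ Real.exp (-(0.9 * α * n)) := by
      refine hn2.trans ((pow_le_pow_left₀ (by linarith)
        (Real.one_sub_le_exp_neg (0.9 * α)) n).trans_eq ?_)
      rw [← Real.exp_nat_mul]
      congr 1
      ring
    have h2 : 0.9 * α * n ≤ logFactor (1 / x) := by
      rw [logFactor, Real.le_log_iff_exp_le (by positivity)]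
      refine le_trans ?_ (le_add_of_nonneg_left (Real.exp_pos 1).le)
      rw [Real.exp_neg] at h1
      rw [one_div]
      exact (le_inv_comm₀ hx0 (Real.exp_pos _)).1 h1
    have h3 : (n : ℝ) ≤ 3 * √κ * (c₁ * logFactor X) := by
      have h4 : (n : ℝ) = 1 / 0.9 * (1 / α) * (0.9 * α * n) := by field_simp
      have h6 : 0 ≤ 0.9 * α * n := by positivity
      rw [h4]
      generalize 0.9 * α * n = N at h2 h6 ⊢
      calc 1 / 0.9 * (1 / α) * N ≤ 1 / 0.9 * (2 * √κ) * (c₁ * logFactor X) := by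
            gcongr
            exact h2.trans hxinv
        _ = 2 / 0.9 * (√κ * (c₁ * logFactor X)) := by ring
        _ ≤ 3 * (√κ * (c₁ * logFactor X)) := by gcongr; norm_num
        _ = _ := by ring
    have h5 : 1 ≤ √κ * logFactor X :=
      one_le_mul_of_one_le_of_one_le (Real.one_le_sqrt.2 hκ1) hlX1
    push_cast
    linarith
  set θ : ℕ → GAParams := fun s => gaParams M hL (hacc s) σ r with hθ
  refine ⟨n + 1, θ, by omega, ?_, ?_, ?_⟩
  · refine (commRounds_le hL hacc (fun _ => rfl) hr0).trans ?_
    calc ((n + 1 : ℕ) : ℝ) * (5000 * logFactor r)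
        ≤ ((1 + 3 * c₁) * √κ * logFactor X) * (5000 * (c₂ * logFactor X)) := by gcongr
      _ = 5000 * ((1 + 3 * c₁) * c₂ * √κ * logFactor X ^ 2) := by ring
      _ ≤ 10 ^ 20 * ((1 + 3 * c₁) * c₂ * √κ * logFactor X ^ 2) := by gcongr; norm_num
      _ = _ := by ring
  · refine (sampleCount_le hL hacc (fun _ => rfl) hr0 fun s _ hs => hV s hs).trans ?_
    have h1 : √κ * σ ^ 2 / (μ * ε) = √κ * w := by rw [hw, mul_div_assoc]
    rw [h1]
    calc ((n + 1 : ℕ) : ℝ) * (2 * 10 ^ 14 * (1 + 3000 * w) * logFactor r)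
        ≤ ((1 + 3 * c₁) * √κ * logFactor X)
          * (2 * 10 ^ 14 * (3000 * (1 + w)) * (c₂ * logFactor X)) := by
          gcongr
          linarith
      _ = 6000 * 10 ^ 14 * ((1 + 3 * c₁) * c₂ * (√κ + √κ * w) * logFactor X ^ 2) := by ring
      _ ≤ 10 ^ 20 * ((1 + 3 * c₁) * c₂ * (√κ + √κ * w) * logFactor X ^ 2) := by gcongr; norm_num
      _ = _ := by ring
  · intro Q x0 hQ hx0'
    obtain ⟨hg, hS⟩ := StochasticProblem.stronglyConvex_run hL hμ hμL hα hΔ hacc (fun _ => rfl)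
      (θ := θ) (fun _ => rfl) hrle hQ hx0'
    rw [← hα]
    have hint : Integrable (fun ω => Q.obj (Q.catX (scScheme L μ) θ x0 (n + 1) ω)) Q.Pr :=
      (hS.1.add (integrable_const Q.optVal)).congr
        (Filter.Eventually.of_forall fun ω => sub_add_cancel _ _)
    refine ⟨StochasticProblem.meetsCriterion_of_expLE hg, hint, ?_⟩
    have h1 := hS.2
    rw [integral_sub hint (integrable_const _)] at h1
    have h2 : 100 * Δ / α ^ 2 * ρ ^ (n + 1) ≤ ε := by
      have h3 := mul_le_mul_of_nonneg_left hn1.le (show 0 ≤ 100 * Δ / α ^ 2 by positivity)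
      refine h3.trans_eq ?_
      rw [hx]; field_simp
    simp only [integral_const, probReal_univ, one_smul] at h1
    exact h1.trans h2

/-! ### The step sizes of the convex case -/

theorem alphaSeq_zero_one_mem (s : ℕ) : 0 < alphaSeq 0 1 s ∧ alphaSeq 0 1 s ≤ 1 := by
  induction s with
  | zero => simp [alphaSeq]
  | succ s ih =>
    have := nextAlpha_mem zero_lt_one ih.1
    exact ⟨this.1, this.2.le⟩

theorem alphaSeq_zero_one_sq (s : ℕ) :
    alphaSeq 0 1 (s + 1) ^ 2 = (1 - alphaSeq 0 1 (s + 1)) * alphaSeq 0 1 s ^ 2 := by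
  have := nextAlpha_sq 0 (alphaSeq 0 1 s)
  rwa [zero_mul, add_zero] at this

/-- The recursion reads (1/b - 1/2)² = (1/a)² + 1/4 in the reciprocals, so each step increases 1/α
by between 1/2 and 1. -/
theorem inv_alphaSeq_succ (s : ℕ) :
    1 / alphaSeq 0 1 s + 1 / 2 ≤ 1 / alphaSeq 0 1 (s + 1) ∧
      1 / alphaSeq 0 1 (s + 1) ≤ 1 / alphaSeq 0 1 s + 1 := by
  obtain ⟨h0, h1⟩ := alphaSeq_zero_one_mem s
  obtain ⟨h0', h1'⟩ := alphaSeq_zero_one_mem (s + 1)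
  have h2 := alphaSeq_zero_one_sq s
  set a := alphaSeq 0 1 s
  set b := alphaSeq 0 1 (s + 1)
  have ht : 1 ≤ 1 / b := (one_le_div h0').2 h1'
  have ht0 : 1 ≤ 1 / a := (one_le_div h0).2 h1
  have h3 : (1 / b - 1 / 2) ^ 2 = (1 / a) ^ 2 + 1 / 4 := by
    field_simp
    linear_combination (-16) * h2
  constructor
  · have : 1 / a ≤ 1 / b - 1 / 2 := le_of_sq_le_sq (by rw [h3]; linarith) (by linarith)
    linarith
  · have : 1 / b - 1 / 2 ≤ 1 / a + 1 / 2 :=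
      le_of_sq_le_sq (by rw [h3]; nlinarith) (by linarith)
    linarith

theorem inv_alphaSeq_bounds (s : ℕ) :
    ((s : ℝ) + 2) / 2 ≤ 1 / alphaSeq 0 1 s ∧ 1 / alphaSeq 0 1 s ≤ s + 1 := by
  induction s with
  | zero => simp [alphaSeq]
  | succ s ih =>
    have := inv_alphaSeq_succ s
    push_cast
    constructor <;> linarith [ih.1, ih.2, this.1, this.2]

theorem momentum_zero_one (s : ℕ) :
    momentum 0 1 (s + 1) = alphaSeq 0 1 (s + 1) * (1 / alphaSeq 0 1 s - 1) := by
  obtain ⟨h0, -⟩ := alphaSeq_zero_one_mem s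
  obtain ⟨h0', -⟩ := alphaSeq_zero_one_mem (s + 1)
  have h2 := alphaSeq_zero_one_sq s
  rw [momentum, Nat.add_sub_cancel, div_eq_iff (by positivity)]
  field_simp
  linear_combination (-(1 - alphaSeq 0 1 s)) * h2

theorem momentum_zero_one_mem (s : ℕ) : 0 ≤ momentum 0 1 (s + 1) ∧ momentum 0 1 (s + 1) ≤ 1 := by
  obtain ⟨h0, h1⟩ := alphaSeq_zero_one_mem s
  obtain ⟨h0', h1'⟩ := alphaSeq_zero_one_mem (s + 1)
  have ht0 : 1 ≤ 1 / alphaSeq 0 1 s := (one_le_div h0).2 h1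
  have h2 := (inv_alphaSeq_succ s).1
  rw [momentum_zero_one]
  refine ⟨mul_nonneg h0'.le (by linarith), ?_⟩
  calc alphaSeq 0 1 (s + 1) * (1 / alphaSeq 0 1 s - 1)
      ≤ alphaSeq 0 1 (s + 1) * (1 / alphaSeq 0 1 (s + 1)) := by gcongr; linarith
    _ = 1 := mul_one_div_cancel h0'.ne'

/-- The relaxation parameters in the analysis of the convex case. -/
def relaxation (γ : ℝ) (s : ℕ) : ℝ := 1 / 2 * (1 / ((s : ℝ) + 2) ^ (1 + γ / 2))

theorem relaxation_pos (γ : ℝ) (s : ℕ) : 0 < relaxation γ s := by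
  unfold relaxation
  positivity

theorem relaxation_le {γ : ℝ} (hγ : 0 < γ) (s : ℕ) : relaxation γ s ≤ 1 / 4 := by
  have h1 : (2 : ℝ) ≤ ((s : ℝ) + 2) ^ (1 + γ / 2) := by
    have h2 : (1 : ℝ) ≤ (s : ℝ) + 2 := by linarith [Nat.cast_nonneg (α := ℝ) s]
    calc (2 : ℝ) ≤ ((s : ℝ) + 2) ^ (1 : ℝ) := by
          rw [Real.rpow_one]; linarith [Nat.cast_nonneg (α := ℝ) s]
      _ ≤ _ := Real.rpow_le_rpow_of_exponent_le h2 (by linarith)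
  have h3 : 1 / ((s : ℝ) + 2) ^ (1 + γ / 2) ≤ 1 / 2 := by gcongr
  unfold relaxation
  linarith

/-- The exponent 1 + γ/2 exceeds 1, so the product of all losses stays bounded by a constant W
depending on γ only. This is where the constants of the convex case acquire their dependence on γ.
-/
theorem exists_sum_relaxation_le {γ : ℝ} (hγ : 0 < γ) :
    ∃ W : ℝ, 1 ≤ W ∧ ∀ s : ℕ, Real.exp (2 * ∑ i ∈ Finset.range s, relaxation γ i) ≤ W := by
  have h1 : Summable (relaxation γ) := by
    have h2 := (summable_nat_add_iff 2).2
      (Real.summable_one_div_nat_rpow.2 (show 1 < 1 + γ / 2 by linarith))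
    have h3 := h2.mul_left (1 / 2)
    refine h3.congr fun i => ?_
    simp [relaxation]
  have h0 : ∀ i, 0 ≤ relaxation γ i := fun i => (relaxation_pos γ i).le
  refine ⟨Real.exp (2 * ∑' i, relaxation γ i), Real.one_le_exp ?_, fun s => ?_⟩
  · exact mul_nonneg zero_le_two (tsum_nonneg h0)
  · refine Real.exp_le_exp.2 (mul_le_mul_of_nonneg_left ?_ zero_le_two)
    exact h1.sum_le_tsum _ fun i _ => h0 i

/-- The accumulated error of one step of the convex case. -/
theorem relaxation_error_le {γ Δ : ℝ} (hγ : 0 < γ) (hΔ : 0 ≤ Δ) (s : ℕ) :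
    (1 + 1 / relaxation γ s) * ((s : ℝ) + 1) ^ 2 * (2 * Δ / (9 * ((s : ℝ) + 1 + 1) ^ (4 + γ)))
      ≤ 4 / 3 * Δ * relaxation γ s := by
  have hs : (0 : ℝ) ≤ s := Nat.cast_nonneg s
  set b := (s : ℝ) + 2 with hb
  have hb1 : 1 ≤ b := by linarith
  set u := b ^ (1 + γ / 2) with hu
  have hu1 : 1 ≤ u := Real.one_le_rpow hb1 (by linarith)
  -- This explains the accuracies: one factor u pays for 1/τ, one makes the result summable, and b²
  -- pays for the weight (s + 1)².
  have h1 : b ^ (4 + γ) = u ^ 2 * b ^ 2 := by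
    rw [hu, ← Real.rpow_natCast (b ^ (1 + γ / 2)), ← Real.rpow_mul (by linarith),
      ← Real.rpow_natCast b 2, ← Real.rpow_add (by linarith)]
    congr 1
    push_cast
    ring
  have h2 : relaxation γ s = 1 / 2 * (1 / u) := rfl
  have h3 : (s : ℝ) + 1 + 1 = b := by rw [hb]; ring
  have h4 : 1 + 1 / relaxation γ s ≤ 3 * u := by
    rw [h2, one_div_mul_one_div, one_div_one_div]
    linarith
  have h5 : ((s : ℝ) + 1) ^ 2 ≤ b ^ 2 := by gcongr; linarith
  rw [h3, h1, h2]
  calc (1 + 1 / (1 / 2 * (1 / u))) * ((s : ℝ) + 1) ^ 2 * (2 * Δ / (9 * (u ^ 2 * b ^ 2)))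
      ≤ 3 * u * b ^ 2 * (2 * Δ / (9 * (u ^ 2 * b ^ 2))) := by
        rw [h2] at h4
        gcongr
    _ = 4 / 3 * Δ * (1 / 2 * (1 / u)) := by
        field_simp
        ring

namespace StochasticProblem

variable {M : ℕ} {L σ : ℝ} [NeZero M] {Q : StochasticProblem M L σ}

omit [NeZero M] in
theorem gradient_eq_zero_of_min {xs : Vec Q.n} (hxs : ∀ x, Q.obj xs ≤ Q.obj x) :
    gradient Q.obj xs = 0 := by
  have h1 : IsLocalMin Q.obj xs := Filter.Eventually.of_forall hxs
  rw [gradient, h1.fderiv_eq_zero, map_zero]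

/-- Dividing the one-step inequality by α_s² makes it telescope, because (1 - α_s)/α_s² is the
previous weight. The relaxation multiplies each step by 1/(1 - τ), which E_s = exp(2∑τ_i) absorbs.
The run has S + 1 steps, so the last weight is 1/α_S² ≥ ((S + 2)/2)². -/
theorem convex_run {γ Δ D W r : ℝ} (hγ : 0 < γ) (hL : 0 < L) (hΔ : 0 < Δ)
    (hW1 : 1 ≤ W) (hW : ∀ s : ℕ, Real.exp (2 * ∑ i ∈ Finset.range s, relaxation γ i) ≤ W)
    {S : ℕ} {acc : ℕ → ℝ} (hacc : ∀ s, 0 < acc s)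
    (hacc' : ∀ s, acc s = 2 * Δ / (9 * ((s : ℝ) + 1) ^ (4 + γ)))
    {θ : ℕ → GAParams} (hθ : ∀ s, θ s = gaParams M hL (hacc s) σ r)
    (hr : ∀ s < S + 1, L * (244 * (W * (L * D ^ 2 + Δ) / L)) / acc (s + 1)
      + σ ^ 2 / (L * acc (s + 1)) ≤ r)
    (hQ : ∀ m, ConvexOn ℝ Set.univ (Q.F m)) {x0 xs : Vec Q.n} (hmin : ∀ x, Q.obj xs ≤ Q.obj x)
    (hD : ‖x0 - xs‖ ≤ D) :
    (∀ s < S + 1, ExpLE Q.Pr (Q.subGap (convexScheme L) θ x0 (s + 1)) (acc (s + 1))) ∧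
    ExpLE Q.Pr (fun ω => Q.obj (Q.catX (convexScheme L) θ x0 (S + 1) ω) - Q.obj xs)
      (4 * (W * (L * D ^ 2 + Δ)) / ((S : ℝ) + 2) ^ 2) := by
  have h : Q.ProxRegular (2 * L) := by
    have := proxRegular_stronglyConvex (Q := Q) hL le_rfl hL.le fun m =>
      strongConvexOn_zero.2 (hQ m)
    rwa [zero_add] at this
  set sch := convexScheme L with hsch
  have h' : Q.ProxRegular sch.ν := h
  set α := alphaSeq 0 1 with hα
  have hα0 : ∀ s, 0 < α s := fun s => (alphaSeq_zero_one_mem s).1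
  have hα1 : ∀ s, α s ≤ 1 := fun s => (alphaSeq_zero_one_mem s).2
  have hxs : gradient Q.obj xs = 0 := gradient_eq_zero_of_min hmin
  set R := L * D ^ 2 + Δ with hR
  have hRΔ : Δ ≤ R := by
    have : 0 ≤ L * D ^ 2 := by positivity
    linarith
  have hR0 : 0 < R := hΔ.trans_le hRΔ
  set E : ℕ → ℝ := fun s => Real.exp (2 * ∑ i ∈ Finset.range s, relaxation γ i) with hE
  have hE1 : ∀ s, 1 ≤ E s := fun s => Real.one_le_exp
    (mul_nonneg zero_le_two (Finset.sum_nonneg fun i _ => (relaxation_pos γ i).le))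
  set V := Q.catV sch θ x0 α with hV
  -- The weight starts at 0 because α₀ = 1, so the initial objective gap does not enter the Lyapunov
  -- function.
  let A : ℕ → ℝ := fun s => Nat.casesOn s 0 fun s => 1 / α s ^ 2
  have hA0 : ∀ s, 0 ≤ A s := fun s => by
    cases s with
    | zero => exact le_rfl
    | succ s => exact one_div_nonneg.2 (sq_nonneg _)
  have hAα : ∀ s, 1 - α s = A s * α s ^ 2 := fun s => by
    cases s with
    | zero => simp [A, hα, alphaSeq]
    | succ s =>
      have h1 := alphaSeq_zero_one_sq s
      have h2 := (hα0 s).ne'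
      simp only [A]
      rw [hα] at h2 ⊢
      rw [h1]
      field_simp
  set G : ℕ → Q.Ω → ℝ := fun s ω =>
    A s * (Q.obj (Q.catX sch θ x0 s ω) - Q.obj xs) + L * ‖V s ω - xs‖ ^ 2 with hG
  have hobj0 : ∀ s ω, 0 ≤ A s * (Q.obj (Q.catX sch θ x0 s ω) - Q.obj xs) := fun s ω =>
    mul_nonneg (hA0 s) (sub_nonneg.2 (hmin _))
  have hV0 : ∀ s ω, 0 ≤ L * ‖V s ω - xs‖ ^ 2 := fun s ω => by positivity
  have hG0 : ∀ s ω, 0 ≤ G s ω := fun s ω => add_nonneg (hobj0 s ω) (hV0 s ω)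
  have hD2 : ‖x0 - xs‖ ^ 2 ≤ D ^ 2 := pow_le_pow_left₀ (norm_nonneg _) hD 2
  have hLD : L * ‖x0 - xs‖ ^ 2 ≤ L * D ^ 2 := mul_le_mul_of_nonneg_left hD2 hL.le
  have hRW : R ≤ W * R := le_mul_of_one_le_left hR0.le hW1
  have hbW : ∀ s, R * E s - Δ ≤ W * R := fun s => by
    have := mul_le_mul_of_nonneg_left (hW s) hR0.le
    linarith
  obtain ⟨hAP, hgaps⟩ := accelerated_run h' hL hacc hθ (show (0 : ℝ) ≤ 1 from zero_le_one)
    (show (1 : ℝ) ≤ 1 from le_rfl) momentum_zero_one_mem hxs (B := W * R / L)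
    (by
      rw [le_div_iff₀ hL]
      linarith) hr
    (P := fun s => ExpLE Q.Pr (G s) (R * E s - Δ))
    (by
      have h1 : G 0 = fun _ => 0 * (Q.obj x0 - Q.obj xs) + L * ‖x0 - xs‖ ^ 2 := rfl
      rw [h1]
      refine (ExpLE.const _).trans ?_
      simp only [hE, Finset.range_zero, Finset.sum_empty, mul_zero, Real.exp_zero]
      linarith)
    (by
      intro s _ hAs hAs' hPs hXs hgap
      have hXm' := hAs'.measurable_catX
      have hVm : Measurable (V (s + 1)) := measurable_catV hAs.measurable_catX hXm'
      have hτ0 := relaxation_pos γ s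
      have hτ1 := relaxation_le hγ s
      set τ := relaxation γ s with hτ
      have hαs : (1 / α s) ^ 2 ≤ ((s : ℝ) + 1) ^ 2 :=
        pow_le_pow_left₀ (one_div_nonneg.2 (hα0 s).le) (inv_alphaSeq_bounds s).2 2
      have hP' : ExpLE Q.Pr (G (s + 1)) (R * E (s + 1) - Δ) := by
        have hτ2 : 0 < 1 - τ := by linarith
        have hb := ((hPs.add (hgap.const_mul
          (show 0 ≤ (1 + 1 / τ) * ((s : ℝ) + 1) ^ 2 by positivity))).const_mul
          (inv_nonneg.2 hτ2.le)).of_le (f := G (s + 1))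
          ((((Q.continuous_obj.measurable.comp hXm').sub_const _).const_mul _).add
            (((hVm.sub_const xs).norm.pow_const 2).const_mul _)) (hG0 (s + 1)) (fun ω => by
            rw [← div_eq_inv_mul, le_div_iff₀ hτ2]
            have hstep := convex_step h (hα0 s) (hα1 s) hτ0 (x' := Q.catX sch θ x0 s ω)
              (v' := V s ω) (y := Q.catY sch θ x0 (s + 1) ω) (x := Q.catX sch θ x0 (s + 1) ω)
              (v := V (s + 1) ω) (xs := xs) (by
                rw [catY_succ_eq_catV (a := α) (b := α) (fun s => (hα0 s).ne') momentum_zero_one]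
                module)
              (catX_succ_eq_catV (fun s => (hα0 s).ne') s ω)
            rw [← subGap_eq Q sch θ x0 h', hAα s] at hstep
            have hg0 := subGap_nonneg Q sch θ x0 h' (s + 1) ω
            have h1 : A (s + 1) * (Q.obj (Q.catX sch θ x0 (s + 1) ω) - Q.obj xs)
                + (1 - τ) * (L * ‖V (s + 1) ω - xs‖ ^ 2)
                ≤ G s ω + (1 + 1 / τ) * (1 / α s) ^ 2 * Q.subGap sch θ x0 (s + 1) ω := by
              have h2 := mul_le_mul_of_nonneg_left hstep (sq_nonneg (1 / α s))
              have h3 := (hα0 s).ne'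
              have h4 : A (s + 1) = (1 / α s) ^ 2 := by simp [A]
              have h5 : (1 / α s) ^ 2 * α s ^ 2 = 1 := by field_simp
              rw [h4]
              simp only [hG]
              generalize (1 / α s) ^ 2 = c at h2 h5 ⊢
              have e1 : c * (Q.obj (Q.catX sch θ x0 (s + 1) ω) - Q.obj xs
                  + (1 - τ) * (L * α s ^ 2) * ‖V (s + 1) ω - xs‖ ^ 2)
                  = c * (Q.obj (Q.catX sch θ x0 (s + 1) ω) - Q.obj xs)
                    + (1 - τ) * (L * ‖V (s + 1) ω - xs‖ ^ 2) := by
                linear_combination ((1 - τ) * L * ‖V (s + 1) ω - xs‖ ^ 2) * h5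
              have e2 : c * (A s * α s ^ 2 * (Q.obj (Q.catX sch θ x0 s ω) - Q.obj xs)
                  + L * α s ^ 2 * ‖V s ω - xs‖ ^ 2
                  + (1 + 1 / τ) * Q.subGap sch θ x0 (s + 1) ω)
                  = A s * (Q.obj (Q.catX sch θ x0 s ω) - Q.obj xs) + L * ‖V s ω - xs‖ ^ 2
                    + (1 + 1 / τ) * c * Q.subGap sch θ x0 (s + 1) ω := by
                linear_combination (A s * (Q.obj (Q.catX sch θ x0 s ω) - Q.obj xs)
                  + L * ‖V s ω - xs‖ ^ 2) * h5
              rw [e1, e2] at h2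
              exact h2
            have h2 : (1 + 1 / τ) * (1 / α s) ^ 2 * Q.subGap sch θ x0 (s + 1) ω
                ≤ (1 + 1 / τ) * ((s : ℝ) + 1) ^ 2 * Q.subGap sch θ x0 (s + 1) ω := by
              gcongr
            have h3 := mul_nonneg hτ0.le (hobj0 (s + 1) ω)
            have h4 : G (s + 1) ω = A (s + 1) * (Q.obj (Q.catX sch θ x0 (s + 1) ω) - Q.obj xs)
              + L * ‖V (s + 1) ω - xs‖ ^ 2 := rfl
            rw [h4]
            linarith)
        refine hb.trans ?_
        rw [← div_eq_inv_mul, div_le_iff₀ hτ2, hacc']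
        have h1 := relaxation_error_le hγ hΔ.le s
        rw [← hτ] at h1
        -- Since (1 - τ)(1 + 2τ) = 1 + τ(1 - 2τ), the growth of E gains at least Δτ/2, and the
        -- offset -Δ in the bound gains another Δτ. Together they exceed the step error 4Δτ/3.
        have hEs : E s * (1 + 2 * τ) ≤ E (s + 1) := by
          have h1 : E (s + 1) = E s * Real.exp (2 * τ) := by
            simp only [hE, Finset.sum_range_succ, mul_add, Real.exp_add, hτ]
          rw [h1]
          refine mul_le_mul_of_nonneg_left ?_ (Real.exp_pos _).le
          linarith [Real.add_one_le_exp (2 * τ)]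
        have hRE : Δ ≤ R * E s := hRΔ.trans (le_mul_of_one_le_right hR0.le (hE1 s))
        have h2 := mul_le_mul_of_nonneg_left hEs (mul_nonneg hR0.le hτ2.le)
        have h3 : 0 ≤ τ * (1 - 2 * τ) := mul_nonneg hτ0.le (by linarith)
        have h4 := mul_le_mul_of_nonneg_left hRE h3
        have h5 : 0 ≤ Δ * τ * (1 / 4 - τ) := by
          have := sub_nonneg.2 hτ1
          positivity
        have h6 : 0 ≤ Δ * τ := mul_nonneg hΔ.le hτ0.le
        push_cast
        generalize (1 + 1 / τ) * ((s : ℝ) + 1) ^ 2 * (2 * Δ / (9 * ((s : ℝ) + 1 + 1) ^ (4 + γ))) = err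
          at h1 ⊢
        linarith
      refine ⟨hP', (((hP'.const_mul (inv_nonneg.2 hL.le)).const_mul (hα0 s).le).add
        (hXs.const_mul (sub_nonneg.2 (hα1 s)))).of_le
        ((hXm'.sub_const xs).norm.pow_const 2) (fun _ => sq_nonneg _) (fun ω => ?_) |>.trans ?_⟩
      -- The new iterate is a convex combination of v^{s+1}, controlled by the Lyapunov function,
      -- and x^s, controlled by induction; the same bound B therefore persists.
      · have h1 : Q.catX sch θ x0 (s + 1) ω - xs
            = α s • (V (s + 1) ω - xs) + (1 - α s) • (Q.catX sch θ x0 s ω - xs) := by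
          have := catX_succ_eq_catV (Q := Q) (sch := sch) (θ := θ) (x0 := x0)
            (fun s => (hα0 s).ne') s ω
          rw [← hV] at this
          rw [this]
          module
        have h2 := (convexOn_univ_norm (E := Vec Q.n)).pow (fun _ _ => norm_nonneg _) 2
        have h3 := h2.2 (Set.mem_univ (V (s + 1) ω - xs))
          (Set.mem_univ (Q.catX sch θ x0 s ω - xs)) (hα0 s).le (sub_nonneg.2 (hα1 s)) (by ring)
        rw [← h1] at h3
        simp only [Pi.pow_apply, smul_eq_mul] at h3
        refine h3.trans ?_
        have h4 : ‖V (s + 1) ω - xs‖ ^ 2 ≤ L⁻¹ * G (s + 1) ω := by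
          rw [← div_eq_inv_mul, le_div_iff₀ hL, mul_comm]
          exact le_add_of_nonneg_left (hobj0 (s + 1) ω)
        have h5 := mul_le_mul_of_nonneg_left h4 (hα0 s).le
        linarith
      · have h1 : L⁻¹ * (R * E (s + 1) - Δ) ≤ W * R / L := by
          rw [← div_eq_inv_mul]
          gcongr
          exact hbW (s + 1)
        have h2 := mul_le_mul_of_nonneg_left h1 (hα0 s).le
        linarith)
  refine ⟨hgaps, ?_⟩
  obtain ⟨hAS, hPS⟩ := hAP (S + 1) le_rfl
  have hlb : (((S : ℝ) + 2) / 2) ^ 2 ≤ A (S + 1) := by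
    have h1 := pow_le_pow_left₀ (by positivity) (inv_alphaSeq_bounds S).1 2
    rw [div_pow 1, one_pow] at h1
    exact h1
  refine (((hPS.trans (hbW (S + 1))).const_mul
    (show 0 ≤ 4 / ((S : ℝ) + 2) ^ 2 by positivity)).of_le
    ((Q.continuous_obj.measurable.comp hAS.measurable_catX).sub_const _)
    (fun ω => sub_nonneg.2 (hmin _)) fun ω => ?_).trans
    (by rw [div_mul_eq_mul_div])
  rw [div_mul_eq_mul_div, le_div_iff₀ (by positivity)]
  have h1 := mul_le_mul_of_nonneg_right hlb
    (sub_nonneg.2 (hmin (Q.catX sch θ x0 (S + 1) ω)))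
  have h2 := hV0 (S + 1) ω
  simp only [hG, Function.comp]
  linarith

end StochasticProblem

-- The rate 4WR/(S + 1)² fixes S of order √(WR/ε). The last call has the smallest accuracy, of order
-- Δ S^{-(4+γ)}; charging all S calls with its sample cost already gives the stated exponent.
set_option maxHeartbeats 1000000 in
theorem convex_case (γ : ℝ) (hγ : 0 < γ) (hγ1 : γ ≤ 1) :
    ∃ C : ℝ, 0 < C ∧ ∃ p : ℕ,
      ∀ (M : ℕ) [NeZero M] (L σ Δ D ε : ℝ), 0 < L → 0 ≤ σ → 0 ≤ D → 0 < ε → ε ≤ Δ →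
      ∃ (S : ℕ) (θ : ℕ → GAParams), 1 ≤ S ∧
        (commRounds S θ : ℝ) ≤
          C * √((L * D ^ 2 + Δ) / ε)
            * logFactor ((L * D ^ 2 + Δ) / ε + M * σ ^ 2 / (L * ε)) ^ p ∧
        (sampleCount S θ : ℝ) ≤
          C * (√((L * D ^ 2 + Δ) / ε)
              + σ ^ 2 / (L * Δ) * ((L * D ^ 2 + Δ) / ε) ^ (2.5 + γ / 2))
            * logFactor ((L * D ^ 2 + Δ) / ε + M * σ ^ 2 / (L * ε)) ^ p ∧
        ∀ (Q : StochasticProblem.{u, v} M L σ) (x0 xstar : Vec Q.n),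
          (∀ m, ConvexOn ℝ Set.univ (Q.F m)) →
          (∀ x, Q.obj xstar ≤ Q.obj x) →
          ‖x0 - xstar‖ ≤ D →
          Q.obj x0 - Q.optVal ≤ Δ →
          Q.MeetsCriterion (convexScheme L) S θ x0
            (fun s => 2 * Δ / (9 * ((s : ℝ) + 1) ^ (4 + γ))) ∧
          Integrable (fun ω => Q.obj (Q.catX (convexScheme L) θ x0 S ω)) Q.Pr ∧
          (∫ ω, Q.obj (Q.catX (convexScheme L) θ x0 S ω) ∂Q.Pr) - Q.optVal ≤ ε := by
  obtain ⟨W, hW1, hW⟩ := exists_sum_relaxation_le hγ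
  have hW0 : 0 < W := zero_lt_one.trans_le hW1
  obtain ⟨c, hc⟩ : ∃ c : ℝ, c = Real.log (1 + 1129000 * W ^ 6) + ((6 : ℕ) + 1) := ⟨_, rfl⟩
  have hc0 : 0 < c := by
    have : 0 ≤ Real.log (1 + 1129000 * W ^ 6) := Real.log_nonneg (by linarith [pow_pos hW0 6])
    rw [hc]; positivity
  set w := √W with hw
  have hw1 : 1 ≤ w := Real.one_le_sqrt.2 hW1
  have hw2 : w ^ 2 = W := Real.sq_sqrt hW0.le
  refine ⟨10 ^ 15 * (4 * w) ^ 6 * c, by positivity, 1, ?_⟩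
  intro M _ L σ Δ D ε hL hσ hD0 hε hεΔ
  have hΔ : 0 < Δ := hε.trans_le hεΔ
  set R := L * D ^ 2 + Δ with hR
  have hRΔ : Δ ≤ R := le_add_of_nonneg_left (by positivity)
  have hR0 : 0 < R := hΔ.trans_le hRΔ
  set Y := R / ε with hY
  have hY1 : 1 ≤ Y := (one_le_div hε).2 (hεΔ.trans hRΔ)
  have hY0 : 0 < Y := zero_lt_one.trans_le hY1
  set X := Y + M * σ ^ 2 / (L * ε) with hX
  have hYX : Y ≤ X := le_add_of_nonneg_right (by positivity)
  have hX0 : 0 ≤ X := hY0.le.trans hYX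
  have hσX : σ ^ 2 / (L * ε) ≤ X := by
    have h1 : (1 : ℝ) ≤ M := by exact_mod_cast Nat.one_le_iff_ne_zero.2 (NeZero.ne M)
    have h2 : σ ^ 2 / (L * ε) ≤ M * σ ^ 2 / (L * ε) := by
      gcongr
      exact le_mul_of_one_le_left (sq_nonneg σ) h1
    rw [hX]
    linarith
  set y := √Y with hy
  have hy1 : 1 ≤ y := Real.one_le_sqrt.2 hY1
  have hy2 : y ^ 2 = Y := Real.sq_sqrt hY0.le
  have hwy : 1 ≤ w * y := one_le_mul_of_one_le_of_one_le hw1 hy1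
  -- S is n + 1. As (2wy)² = 4WR/ε, the lower bound gives the accuracy ε, and the upper bound
  -- controls the costs.
  obtain ⟨n, hn1, hn2⟩ : ∃ n : ℕ, 2 * (w * y) ≤ (n : ℝ) + 1 ∧ (n : ℝ) + 1 ≤ 3 * (w * y) := by
    refine ⟨⌊2 * (w * y)⌋₊, (Nat.lt_floor_add_one _).le, ?_⟩
    have := Nat.floor_le (show 0 ≤ 2 * (w * y) by positivity)
    linarith
  set N : ℝ := (n : ℝ) + 1 + 1 with hN
  have hN4 : N ≤ 4 * (w * y) := by linarith
  have hN1 : 1 ≤ N := by rw [hN]; linarith [Nat.cast_nonneg (α := ℝ) n]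
  set acc : ℕ → ℝ := fun s => 2 * Δ / (9 * ((s : ℝ) + 1) ^ (4 + γ)) with hacc'
  have hacc : ∀ s, 0 < acc s := fun s => by positivity
  have hacclb : ∀ s ≤ n + 1, 2 * Δ / (9 * N ^ (4 + γ)) ≤ acc s := by
    intro s hs
    have h1 : (s : ℝ) ≤ n + 1 := by exact_mod_cast hs
    simp only [hacc']
    gcongr
    linarith
  set V := σ ^ 2 / (L * (2 * Δ / (9 * N ^ (4 + γ)))) with hV
  have hVs : ∀ s ≤ n + 1, σ ^ 2 / (L * acc s) ≤ V := by
    intro s hs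
    rw [hV]
    gcongr
    exact hacclb s hs
  have hV0 : 0 ≤ V := by positivity
  have hVeq : V = 4.5 * (σ ^ 2 / (L * Δ)) * N ^ (4 + γ) := by
    rw [hV]; field_simp; ring
  have hN5 : N ^ (4 + γ) ≤ 1024 * W ^ 5 * Y ^ 5 := by
    calc N ^ (4 + γ) ≤ N ^ ((5 : ℕ) : ℝ) := by
          refine Real.rpow_le_rpow_of_exponent_le hN1 ?_
          push_cast; linarith
      _ = N ^ 5 := Real.rpow_natCast _ _
      _ ≤ (4 * (w * y)) ^ 5 := by gcongr
      _ ≤ (4 * (w ^ 2 * y ^ 2)) ^ 5 := by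
          gcongr
          · exact le_self_pow₀ hw1 two_ne_zero
          · exact le_self_pow₀ hy1 two_ne_zero
      _ = _ := by rw [hw2, hy2]; ring
  set r := 1129000 * W ^ 6 * (1 + X) ^ 6 with hr
  have hr0 : 0 ≤ r := by positivity
  have hrle : ∀ s < n + 1, L * (244 * (W * (L * D ^ 2 + Δ) / L)) / acc (s + 1)
      + σ ^ 2 / (L * acc (s + 1)) ≤ r := by
    intro s hs
    have h1 := hVs (s + 1) hs
    have hX1 : 1 ≤ 1 + X := by linarith
    have hYX1 : Y ≤ 1 + X := by linarith
    have hWW : W ^ 5 ≤ W ^ 6 := pow_le_pow_right₀ hW1 (by norm_num)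
    have h2 : L * (244 * (W * (L * D ^ 2 + Δ) / L)) / acc (s + 1)
        ≤ 1124352 * W ^ 6 * (1 + X) ^ 6 := by
      have hRY : R / Δ ≤ 1 + X := le_trans (by rw [hY]; gcongr) hYX1
      calc L * (244 * (W * (L * D ^ 2 + Δ) / L)) / acc (s + 1)
          ≤ L * (244 * (W * (L * D ^ 2 + Δ) / L)) / (2 * Δ / (9 * N ^ (4 + γ))) := by
            gcongr L * (244 * (W * (L * D ^ 2 + Δ) / L)) / ?_
            exact hacclb (s + 1) hs
        _ = 1098 * W * N ^ (4 + γ) * (R / Δ) := by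
            rw [hR]; field_simp; ring
        _ ≤ 1098 * W * (1024 * W ^ 5 * (1 + X) ^ 5) * (1 + X) := by
            gcongr
            exact hN5.trans (by gcongr)
        _ = _ := by ring
    have h3 : V ≤ 4608 * W ^ 6 * (1 + X) ^ 6 := by
      have hσ' : σ ^ 2 / (L * Δ) ≤ 1 + X := by
        refine le_trans ?_ (hσX.trans (by linarith : X ≤ 1 + X))
        gcongr
      rw [hVeq]
      calc 4.5 * (σ ^ 2 / (L * Δ)) * N ^ (4 + γ)
          ≤ 4.5 * (1 + X) * (1024 * W ^ 6 * (1 + X) ^ 5) := by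
            gcongr
            exact hN5.trans (by gcongr)
        _ = _ := by ring
    have h4 : 0 ≤ W ^ 6 * (1 + X) ^ 6 := by positivity
    rw [hr]
    linarith
  have hlX1 : 1 ≤ logFactor X := one_le_logFactor hX0
  have hlX : 0 ≤ logFactor X := zero_le_one.trans hlX1
  have hlr : 0 ≤ logFactor r := zero_le_one.trans (one_le_logFactor hr0)
  have hlog : logFactor r ≤ c * logFactor X := by
    rw [hc]
    exact logFactor_le_of_le_poly hr0 hX0 (by positivity) le_rfl
  have hSle : ((n + 1 : ℕ) : ℝ) ≤ 3 * (w * y) := by push_cast; exact hn2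
  have hw6 : w ≤ (4 * w) ^ 6 :=
    (by linarith : w ≤ 4 * w).trans (le_self_pow₀ (by linarith) (by norm_num))
  set θ : ℕ → GAParams := fun s => gaParams M hL (hacc s) σ r with hθ
  refine ⟨n + 1, θ, by omega, ?_, ?_, ?_⟩
  · refine (commRounds_le hL hacc (fun _ => rfl) hr0).trans ?_
    calc ((n + 1 : ℕ) : ℝ) * (5000 * logFactor r)
        ≤ (3 * (w * y)) * (5000 * (c * logFactor X)) := by gcongr
      _ = 15000 * w * c * y * logFactor X ^ 1 := by ring
      _ ≤ 10 ^ 15 * (4 * w) ^ 6 * c * y * logFactor X ^ 1 := by gcongr; norm_num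
  · refine (sampleCount_le hL hacc (fun _ => rfl) hr0 fun s _ hs => hVs s hs).trans ?_
    have hNV : ((n + 1 : ℕ) : ℝ) * V
        ≤ 4.5 * (4 * w) ^ 6 * (σ ^ 2 / (L * Δ) * Y ^ (2.5 + γ / 2)) := by
      -- The power 4 + γ comes from the accuracy and one more from the number of calls; N ≤ 4w√Y
      -- halves the exponent of Y. Since γ ≤ 1, the constant needs at most the sixth power.
      have h1 : N ^ (5 + γ) ≤ (4 * w) ^ 6 * Y ^ (2.5 + γ / 2) := by
        calc N ^ (5 + γ) ≤ (4 * w * y) ^ (5 + γ) := by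
              refine Real.rpow_le_rpow (by linarith) (by linarith) (by linarith)
          _ = (4 * w) ^ (5 + γ) * y ^ (5 + γ) := Real.mul_rpow (by positivity) (by positivity)
          _ ≤ (4 * w) ^ ((6 : ℕ) : ℝ) * y ^ (5 + γ) := by
              gcongr
              · linarith
              · push_cast; linarith
          _ = _ := by
              rw [Real.rpow_natCast, hy, Real.sqrt_eq_rpow, ← Real.rpow_mul hY0.le]
              congr 2
              ring
      have h2 : ((n + 1 : ℕ) : ℝ) ≤ N := by push_cast; rw [hN]; linarith
      calc ((n + 1 : ℕ) : ℝ) * V ≤ N * V := by gcongr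
        _ = 4.5 * (σ ^ 2 / (L * Δ)) * N ^ (5 + γ) := by
            rw [hVeq, show 5 + γ = 4 + γ + 1 by ring, Real.rpow_add_one (by linarith) (4 + γ)]
            ring
        _ ≤ 4.5 * (σ ^ 2 / (L * Δ)) * ((4 * w) ^ 6 * Y ^ (2.5 + γ / 2)) := by gcongr
        _ = _ := by ring
    have h3 : ((n + 1 : ℕ) : ℝ) * (1 + V)
        ≤ 4.5 * (4 * w) ^ 6 * (y + σ ^ 2 / (L * Δ) * Y ^ (2.5 + γ / 2)) := by
      have h4 : w * y ≤ (4 * w) ^ 6 * y := by gcongr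
      have h5 : 0 ≤ (4 * w) ^ 6 * y := by positivity
      linarith
    have hB : 0 ≤ y + σ ^ 2 / (L * Δ) * Y ^ (2.5 + γ / 2) := by positivity
    generalize y + σ ^ 2 / (L * Δ) * Y ^ (2.5 + γ / 2) = B at h3 hB ⊢
    calc ((n + 1 : ℕ) : ℝ) * (2 * 10 ^ 14 * (1 + V) * logFactor r)
        = 2 * 10 ^ 14 * (((n + 1 : ℕ) : ℝ) * (1 + V)) * logFactor r := by ring
      _ ≤ 2 * 10 ^ 14 * (4.5 * (4 * w) ^ 6 * B) * (c * logFactor X) := by gcongr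
      _ = 9 * 10 ^ 14 * (4 * w) ^ 6 * c * B * logFactor X ^ 1 := by ring
      _ ≤ 10 ^ 15 * (4 * w) ^ 6 * c * B * logFactor X ^ 1 := by gcongr; norm_num
  · intro Q x0 xs hQ hmin hD _
    obtain ⟨hg, hS⟩ := StochasticProblem.convex_run hγ hL hΔ hW1 hW hacc (fun _ => rfl)
      (θ := θ) (fun _ => rfl) hrle hQ hmin hD
    have hint : Integrable (fun ω => Q.obj (Q.catX (convexScheme L) θ x0 (n + 1) ω)) Q.Pr :=
      (hS.1.add (integrable_const (Q.obj xs))).congr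
        (Filter.Eventually.of_forall fun ω => sub_add_cancel _ _)
    refine ⟨StochasticProblem.meetsCriterion_of_expLE hg, hint, ?_⟩
    have h1 := hS.2
    rw [integral_sub hint (integrable_const _)] at h1
    rw [StochasticProblem.optVal_eq hmin]
    have h2 : 4 * (W * (L * D ^ 2 + Δ)) / ((n : ℝ) + 2) ^ 2 ≤ ε := by
      rw [div_le_iff₀ (by positivity), ← hR]
      have h3 : R = ε * Y := by rw [hY]; field_simp
      have h4 : (2 * (w * y)) ^ 2 ≤ ((n : ℝ) + 2) ^ 2 := by gcongr; linarith
      have h5 : (2 * (w * y)) ^ 2 = 4 * (W * Y) := by rw [← hw2, ← hy2]; ring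
      rw [h5] at h4
      have h6 := mul_le_mul_of_nonneg_left h4 hε.le
      rw [h3]
      linarith
    simp only [integral_const, probReal_univ, one_smul] at h1
    exact h1.trans h2

end LocalCatalyst

end

theorem mainTheorem1 :
    -- strongly convex local functions
    (∃ C : ℝ, 0 < C ∧ ∃ p : ℕ,
      ∀ (M : ℕ) [NeZero M] (L μ σ Δ ε : ℝ), 0 < μ → μ ≤ L → 0 ≤ σ → 0 < ε → ε ≤ Δ →
      ∃ (S : ℕ) (θ : ℕ → GAParams), 1 ≤ S ∧
        (commRounds S θ : ℝ) ≤
          C * √(L / μ) * logFactor (L / μ + Δ / ε + M * σ ^ 2 / (μ * ε)) ^ p ∧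
        (sampleCount S θ : ℝ) ≤
          C * (√(L / μ) + √(L / μ) * σ ^ 2 / (μ * ε))
            * logFactor (L / μ + Δ / ε + M * σ ^ 2 / (μ * ε)) ^ p ∧
        ∀ (Q : StochasticProblem.{u, v} M L σ) (x0 : Vec Q.n),
          (∀ m, StrongConvexOn Set.univ μ (Q.F m)) →
          Q.obj x0 - Q.optVal ≤ Δ →
          Q.MeetsCriterion (scScheme L μ) S θ x0
            (fun s => 2 * (1 - 0.9 * √(μ / (μ + 2 * L))) ^ s * Δ / 9) ∧
          Integrable (fun ω => Q.obj (Q.catX (scScheme L μ) θ x0 S ω)) Q.Pr ∧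
          (∫ ω, Q.obj (Q.catX (scScheme L μ) θ x0 S ω) ∂Q.Pr) - Q.optVal ≤ ε) ∧
    -- convex local functions
    (∀ γ : ℝ, 0 < γ → γ ≤ 1 → ∃ C : ℝ, 0 < C ∧ ∃ p : ℕ,
      ∀ (M : ℕ) [NeZero M] (L σ Δ D ε : ℝ), 0 < L → 0 ≤ σ → 0 ≤ D → 0 < ε → ε ≤ Δ →
      ∃ (S : ℕ) (θ : ℕ → GAParams), 1 ≤ S ∧
        (commRounds S θ : ℝ) ≤
          C * √((L * D ^ 2 + Δ) / ε)
            * logFactor ((L * D ^ 2 + Δ) / ε + M * σ ^ 2 / (L * ε)) ^ p ∧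
        (sampleCount S θ : ℝ) ≤
          C * (√((L * D ^ 2 + Δ) / ε)
              + σ ^ 2 / (L * Δ) * ((L * D ^ 2 + Δ) / ε) ^ (2.5 + γ / 2))
            * logFactor ((L * D ^ 2 + Δ) / ε + M * σ ^ 2 / (L * ε)) ^ p ∧
        ∀ (Q : StochasticProblem.{u, v} M L σ) (x0 xstar : Vec Q.n),
          (∀ m, ConvexOn ℝ Set.univ (Q.F m)) →
          (∀ x, Q.obj xstar ≤ Q.obj x) →
          ‖x0 - xstar‖ ≤ D →
          Q.obj x0 - Q.optVal ≤ Δ →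
          Q.MeetsCriterion (convexScheme L) S θ x0
            (fun s => 2 * Δ / (9 * ((s : ℝ) + 1) ^ (4 + γ))) ∧
          Integrable (fun ω => Q.obj (Q.catX (convexScheme L) θ x0 S ω)) Q.Pr ∧
          (∫ ω, Q.obj (Q.catX (convexScheme L) θ x0 S ω) ∂Q.Pr) - Q.optVal ≤ ε) ∧
    -- nonconvex local functions
    (∃ C : ℝ, 0 < C ∧ ∃ p : ℕ,
      ∀ (M : ℕ) [NeZero M] (L σ Δ ε : ℝ), 0 < L → 0 ≤ σ → 0 < ε → ε ^ 2 ≤ L * Δ →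
      ∃ (S : ℕ) (θ : ℕ → GAParams), 1 ≤ S ∧
        (commRounds S θ : ℝ) ≤
          C * (L * Δ / ε ^ 2) * logFactor (L * Δ / ε ^ 2 + M * σ ^ 2 / ε ^ 2) ^ p ∧
        (sampleCount S θ : ℝ) ≤
          C * (L * Δ / ε ^ 2 + L * Δ * σ ^ 2 / ε ^ 4)
            * logFactor (L * Δ / ε ^ 2 + M * σ ^ 2 / ε ^ 2) ^ p ∧
        ∀ (Q : StochasticProblem.{u, v} M L σ) (x0 : Vec Q.n),
          BddBelow (Set.range Q.obj) →
          Q.obj x0 - Q.optVal ≤ Δ →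
          Q.MeetsCriterion (nonconvexScheme L) S θ x0 (fun _ => Δ / S) ∧
          (∀ s ∈ Finset.Icc 1 S,
            Integrable (fun ω => ‖gradient Q.obj (Q.catX (nonconvexScheme L) θ x0 s ω)‖ ^ 2)
              Q.Pr) ∧
          (1 / (S : ℝ)) * ∑ s ∈ Finset.Icc 1 S,
            (∫ ω, ‖gradient Q.obj (Q.catX (nonconvexScheme L) θ x0 s ω)‖ ^ 2 ∂Q.Pr) ≤ ε ^ 2) :=
  ⟨stronglyConvex_case, convex_case, nonconvex_case⟩
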